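/- Let $Z=\{Z(x,t):x\in\mathbb S^2,\ t\in\mathbb R\}$ be a jointly measurable, centred Gaussian random field with unit variance, isotropic and stationary, i.e. $\mathbb E[Z(x,t)Z(y,s)]=\Gamma(\langle x,y\rangle,t-s)$ with $\Gamma:[-1,1]\times\mathbb R\to\mathbb R$ continuous. Let $P_\ell$ be the Legendre polynomials, let $\Gamma(\theta,\tau)=\sum_{\ell\ge0}\frac{2\ell+1}{4\pi}C_\ell(\tau)P_\ell(\theta)$ be the Legendre expansion, that is $C_\ell(\tau)=2\pi\int_{-1}^1\Gamma(\theta,\tau)P_\ell(\theta)\,d\theta$, and let $\widetilde{\mathbb N}=\{\ell\ge0:C_\ell(0)\neq0\}$. Fix $\alpha\ge2$ and put $g_\beta(\tau)=(1+|\tau|)^{-\beta}$ for $\beta\in(0,1)$, $g_1(\tau)=(1+|\tau|)^{-\alpha}$. Assume: (i) there are $\beta_\ell\in(0,1]$, $\ell\in\widetilde{\mathbb N}$, with $C_\ell=G_\ell\,g_{\beta_\ell}$ and $\sup_{\ell\in\widetilde{\mathbb N}}\left|\frac{G_\ell(\tau)}{C_\ell(0)}-1\right|\to0$ as $\tau\to+\infty$;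 moreover $0\in\widetilde{\mathbb N}$, and $\int_{\mathbb R}C_0(\tau)\,d\tau>0$ if $\beta_0=1$; (ii) $\beta_{\ell^\star}:=\min\{\beta_\ell:\ell\in\widetilde{\mathbb N},\ \ell\ge1\}$ exists; put $\mathcal I^\star:=\{\ell\in\widetilde{\mathbb N}:\beta_\ell=\beta_{\ell^\star}\}$. If there are $\ell\in\widetilde{\mathbb N}\setminus\mathcal I^\star$ with $\ell\ge1$, then $\beta_\ell$ attains a minimum over these $\ell$; (iii) $\mathcal I^\star$ contains an even $\ell$. For $T>0$ let $\mathcal A_0(t)$ be the area of $\{x\in\mathbb S^2:Z(x,t)\ge0\}$, $\mathcal M_T(0)=\int_0^T(\mathcal A_0(t)-\mathbb E[\mathcal A_0(t)])\,dt$ and $\widetilde{\mathcal M}_T(0)=\mathcal M_T(0)/\sqrt{\mathrm{Var}(\mathcal M_T(0))}$. Let $$S:=\sum_{\ell_1,\ell_2,\ell_3\in\mathcal I^\star}\mathcal G^{000}_{\ell_1\ell_2\ell_3}\prod_{i=1}^3\sqrt{\tfrac{2\ell_i+1}{4\pi}}\;C_{\ell_i}(0),\qquad \mathcal G^{000}_{\ell_1\ell_2\ell_3}:=\int_{\mathbb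 S^2}Y_{\ell_1,0}Y_{\ell_2,0}Y_{\ell_3,0}\,dx,$$ where $Y_{\ell,0}(x)=\sqrt{\frac{2\ell+1}{4\pi}}\,P_\ell(x_3)$. Then the series $S$ converges absolutely, $S>0$, and: (a) if $3\beta_{\ell^\star}<\min(1,\beta_0)$, then $$\lim_{T\to\infty}\frac{\mathrm{Var}(\mathcal M_T(0))}{T^{2-3\beta_{\ell^\star}}}=\frac{4}{3!\,(1-3\beta_{\ell^\star})(2-3\beta_{\ell^\star})}\,S;$$ (b) if $\beta_0=1$ and $3\beta_{\ell^\star}=1$, then $$\lim_{T\to\infty}\frac{\mathrm{Var}(\mathcal M_T(0))}{T\log T}=\frac{4}{3!}\,S;$$ (c) in both cases (a) and (b), with $H_3(z)=z^3-3z$, $$\widetilde{\mathcal M}_T(0)=-\frac{\mathrm{Var}(\mathcal M_T(0))^{-1/2}}{3!\,\sqrt{2\pi}}\int_{\mathbb S^2\times[0,T]}H_3(Z(x,t))\,dx\,dt+R_T,$$ where $R_T\to0$ in probability as $T\to+\infty$. -/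

import Mathlib

open MeasureTheory ProbabilityTheory Filter Topology Polynomial
open scoped Nat

noncomputable section

namespace SphereTime

/-- The unit sphere of three-dimensional Euclidean space. -/
abbrev S2 : Type := Metric.sphere (0 : EuclideanSpace ℝ (Fin 3)) 1

/-- The surface measure of the sphere (of total mass `4π`). -/
def area : Measure S2 := (volume : Measure (EuclideanSpace ℝ (Fin 3))).toSphere

instance : IsFiniteMeasure area :=
  inferInstanceAs
    (IsFiniteMeasure (volume : Measure (EuclideanSpace ℝ (Fin 3))).toSphere)

/-- The `ℓ`-th Legendre polynomial, by Rodrigues' formula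
`P_ℓ = (2 ^ ℓ ℓ!)⁻¹ (d/dX) ^ ℓ (X ^ 2 - 1) ^ ℓ`. -/
def legendre (ℓ : ℕ) : ℝ[X] :=
  C (1 / (2 ^ ℓ * (ℓ ! : ℝ))) * derivative^[ℓ] ((X ^ 2 - 1) ^ ℓ)

/-- The zonal spherical harmonic `Y_{ℓ,0}(x) = √((2ℓ+1)/4π) P_ℓ(cos θ_x)`, where `cos θ_x` is the
last coordinate of `x`. -/
def zonal (ℓ : ℕ) (x : S2) : ℝ :=
  √((2 * ℓ + 1) / (4 * Real.pi)) * (legendre ℓ).eval (x.1 2)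

/-- The Gaunt integral with vanishing orders, `∫ Y_{ℓ₁,0} Y_{ℓ₂,0} Y_{ℓ₃,0}` over the sphere. -/
def gaunt (ℓ₁ ℓ₂ ℓ₃ : ℕ) : ℝ :=
  ∫ x, zonal ℓ₁ x * zonal ℓ₂ x * zonal ℓ₃ x ∂area

section Field

variable {Ω : Type*} [MeasurableSpace Ω]

/-- `Z` is a jointly measurable, centred Gaussian, isotropic and stationary, mean square continuous
random field on `𝕊² × ℝ`, with covariance function `Γ` and unit variance. Only the values of `Γ` on
`[-1,1] × ℝ` matter. -/
structure IsSphereTimeField (P : Measure Ω) (Z : S2 × ℝ → Ω → ℝ) (Γ : ℝ → ℝ → ℝ) : Prop where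
  measurable : Measurable fun p : Ω × (S2 × ℝ) => Z p.2 p.1
  gaussian : IsGaussianProcess Z P
  centred : ∀ p, ∫ ω, Z p ω ∂P = 0
  covariance : ∀ (x y : S2) (t s : ℝ),
    ∫ ω, Z (x, t) ω * Z (y, s) ω ∂P = Γ (inner ℝ x.1 y.1) (t - s)
  continuous : ContinuousOn (fun q : ℝ × ℝ => Γ q.1 q.2) (Set.Icc (-1) 1 ×ˢ Set.univ)
  unit_variance : ∀ p, ∫ ω, Z p ω ^ 2 ∂P = 1

/-- The excursion area `𝒜_u(t) = area {x | Z(x,t) ≥ u}`. -/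
def excursionArea (Z : S2 × ℝ → Ω → ℝ) (u t : ℝ) (ω : Ω) : ℝ :=
  area.real {x : S2 | u ≤ Z (x, t) ω}

/-- `ℳ_T(u) = ∫_{[0,T]} (𝒜_u(t) - 𝔼[𝒜_u(t)]) dt`. -/
def excursionStat (P : Measure Ω) (Z : S2 × ℝ → Ω → ℝ) (u T : ℝ) (ω : Ω) : ℝ :=
  ∫ t in Set.Icc 0 T, (excursionArea Z u t ω - ∫ ω', excursionArea Z u t ω' ∂P)

/-- The standardised statistic `ℳ_T(u) / √Var(ℳ_T(u))`. -/
def excursionStatNormalized (P : Measure Ω) (Z : S2 × ℝ → Ω → ℝ) (u T : ℝ) (ω : Ω) : ℝ :=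
  excursionStat P Z u T ω / √(variance (excursionStat P Z u T) P)

/-- The third Hermite polynomial. -/
def H3 (x : ℝ) : ℝ := x ^ 3 - 3 * x

/-- `∫_{𝕊² × [0,T]} H₃(Z(x,t)) dx dt`. -/
def thirdHermiteIntegral (Z : S2 × ℝ → Ω → ℝ) (T : ℝ) (ω : Ω) : ℝ :=
  ∫ p, H3 (Z p ω) ∂(area.prod (volume.restrict (Set.Icc 0 T)))

end Field

/-- The angular power spectrum `C_ℓ(τ)` of `Γ`: the coefficients of the Legendre expansion
`Γ(θ,τ) = ∑_ℓ (2ℓ+1)/(4π) C_ℓ(τ) P_ℓ(θ)`. They are given by `C_ℓ(τ) = 2π ∫_{-1}^1 Γ(θ,τ) P_ℓ(θ) dθ`,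
because `∫_{-1}^1 P_ℓ P_k = 2/(2ℓ+1) δ_{ℓk}`. -/
def powerSpectrum (Γ : ℝ → ℝ → ℝ) (ℓ : ℕ) (τ : ℝ) : ℝ :=
  2 * Real.pi * ∫ θ in (-1 : ℝ)..1, Γ θ τ * (legendre ℓ).eval θ

/-- The multipoles that are present: `{ℓ | C_ℓ(0) ≠ 0}`. -/
def multipoles (Γ : ℝ → ℝ → ℝ) : Set ℕ := {ℓ | powerSpectrum Γ ℓ 0 ≠ 0}

/-- `g_β(τ) = (1+|τ|)^{-β}` for `β < 1`, and `g_1(τ) = (1+|τ|)^{-α}`. -/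
def decay (α β τ : ℝ) : ℝ :=
  if β = 1 then (1 + |τ|) ^ (-α) else (1 + |τ|) ^ (-β)

/-- The memory condition with exponents `β_ℓ ∈ (0,1]`: `C_ℓ = G_ℓ · g_{β_ℓ}` with
`sup_ℓ |G_ℓ(τ)/C_ℓ(0) - 1| → 0` as `τ → +∞`; moreover `C_0(0) ≠ 0`, and `∫ C_0 > 0` if `β_0 = 1`. -/
structure MemoryCondition (Γ : ℝ → ℝ → ℝ) (α : ℝ) (β : ℕ → ℝ) : Prop where
  two_le : 2 ≤ α
  mem_Ioc : ∀ ℓ ∈ multipoles Γ, β ℓ ∈ Set.Ioc (0 : ℝ) 1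
  factor : ∃ G : ℕ → ℝ → ℝ,
    (∀ ℓ ∈ multipoles Γ, ∀ τ, powerSpectrum Γ ℓ τ = G ℓ τ * decay α (β ℓ) τ) ∧
    TendstoUniformlyOn (fun τ ℓ => G ℓ τ / powerSpectrum Γ ℓ 0) (fun _ => 1) atTop (multipoles Γ)
  zero_mem : 0 ∈ multipoles Γ
  integral_pos : β 0 = 1 → 0 < ∫ τ, powerSpectrum Γ 0 τ

/-- `ℐ^⋆`: the multipoles (possibly including `0`) whose exponent is `βs`. -/
def minimalMultipoles (Γ : ℝ → ℝ → ℝ) (β : ℕ → ℝ) (βs : ℝ) : Set ℕ :=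
  {ℓ | ℓ ∈ multipoles Γ ∧ β ℓ = βs}

/-- `βs` is the minimum of the exponents over the multipoles `ℓ ≥ 1`, and the exponents over the
remaining multipoles `ℓ ≥ 1`, if there are any, have a minimum as well. -/
structure IsMinimalExponent (Γ : ℝ → ℝ → ℝ) (β : ℕ → ℝ) (βs : ℝ) : Prop where
  isLeast : IsLeast (β '' {ℓ | ℓ ∈ multipoles Γ ∧ 1 ≤ ℓ}) βs
  second : {ℓ | ℓ ∈ multipoles Γ \ minimalMultipoles Γ β βs ∧ 1 ≤ ℓ}.Nonempty →
    ∃ βss, IsLeast (β '' {ℓ | ℓ ∈ multipoles Γ \ minimalMultipoles Γ β βs ∧ 1 ≤ ℓ}) βss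

/-- The term `𝒢_{ℓ₁ℓ₂ℓ₃}^{000} ∏ᵢ √((2ℓᵢ+1)/4π) C_{ℓᵢ}(0)` of the limiting variance. -/
def gauntTerm (Γ : ℝ → ℝ → ℝ) (ℓ : Fin 3 → ℕ) : ℝ :=
  gaunt (ℓ 0) (ℓ 1) (ℓ 2) *
    ∏ i, (√((2 * ℓ i + 1) / (4 * Real.pi)) * powerSpectrum Γ (ℓ i) 0)

/-- The sum of `gauntTerm` over `ℓ₁, ℓ₂, ℓ₃ ∈ I`. -/
def gauntSum (Γ : ℝ → ℝ → ℝ) (I : Set ℕ) : ℝ :=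
  ∑' ℓ : Fin 3 → I, gauntTerm Γ (fun i => ℓ i)

end SphereTime

end

/-! Let `X`, `Y` be standard normal with correlation `ρ`. By Sheppard's formula (`quadrant`) the
indicators of `X ≥ 0` and `Y ≥ 0` have covariance `arcsin ρ / (2π)`. Hence by Fubini `Var ℳ_T` is
twice `∫_0^T (T - τ) κ(τ) dτ` with `κ(τ) = 4π ∫_{-1}^1 arcsin Γ(θ,τ) dθ`, and everything reduces to
the behaviour of `κ` at infinity.

Write `arcsin x = x + x³/6 + o(x³)`. The linear term integrates to `2 C_0(τ)`, which is
`o(τ^{-3βs})` in both regimes. For the cubic term, `τ^{βs} Γ(θ,τ)` converges, dominatedly in `θ`, to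
the Legendre series `s(θ)` of `Γ(·,0)` restricted to `ℐ^⋆` (`IsSphereTimeField.tendsto_field`). So
`τ^{3βs} κ(τ) → (2π/3) ∫ s³ = S/3`, the last equality by multiplying out the cube
(`hasSum_gauntTerm`). The passage from `κ` to the variance is Abelian:
`tendsto_triangleIntegral_rpow` and `tendsto_triangleIntegral_log`.

The series can be handled because `Γ` is positive definite. The Funk–Hecke formula (`funk_hecke`)
exhibits `C_ℓ(t - s)`, up to a positive factor, as the covariance of the field tested against a
zonal harmonic, so `C_ℓ(0) ≥ 0` and `|C_ℓ(τ)| ≤ C_ℓ(0)`. A Bessel inequality gives `∑ (2ℓ+1)/(4π)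
C_ℓ(0) ≤ 1`. With `|P_ℓ| ≤ 1` and the uniformity in `ℓ` of the memory condition, this is a summable
majorant throughout.

Positivity of `S` rests on Adams' closed form (`tripleIntegral_eq_adams`): `∫ P_a P_b P_c ≥ 0`
always, and `∫ P_ℓ³ > 0` for even `ℓ`.

For the chaotic reduction, subtract from the centred indicator its projection on `H₃`. By Mehler's
formula the remainder has covariance `arcsin ρ/(2π) - ρ³/(12π)`. The kernel of the cubic part has
the same limit `S/3`, so the second moment of the remainder is negligible against the variance and
Chebyshev's inequality concludes (`IsSphereTimeField.tendstoInMeasure_remainder`). -/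

noncomputable section

namespace SphereTime

/-! ### Legendre polynomials from Rodrigues' formula -/

/-- The antiderivative `(2 ^ (n+1) (n+1)!)⁻¹ (d/dX) ^ n (X ^ 2 - 1) ^ (n+1)` of `P_{n+1}`. -/
def legendreAnti (n : ℕ) : ℝ[X] :=
  C (1 / (2 ^ (n + 1) * ((n + 1)! : ℝ))) * derivative^[n] ((X ^ 2 - 1) ^ (n + 1))

lemma derivative_legendreAnti (n : ℕ) : derivative (legendreAnti n) = legendre (n + 1) := by
  rw [legendreAnti, legendre, derivative_C_mul, Function.iterate_succ_apply']

/-- The factor `2(n+1)` is the one released by differentiating `(X² - 1)^(n+1)` once; it is absorbed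
by the change of normalisation from `n+1` to `n`. -/
lemma rodrigues_const (n : ℕ) :
    (1 / (2 ^ (n + 1) * ((n + 1)! : ℝ))) * (2 * (n + 1)) = 1 / (2 ^ n * (n ! : ℝ)) := by
  rw [Nat.factorial_succ]
  push_cast
  field_simp
  try ring

/-- One derivative of `(X² - 1)^(n+2)` leaves `X (X² - 1)^(n+1)`, and Leibniz' rule for a product
with `X` has only two terms. -/
lemma legendre_succ_succ (n : ℕ) :
    legendre (n + 2) = X * legendre (n + 1) + C ((n : ℝ) + 1) * legendreAnti n := by
  have hd : derivative ((X ^ 2 - 1 : ℝ[X]) ^ (n + 2)) =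
      C (2 * ((n : ℝ) + 1 + 1)) * (X * (X ^ 2 - 1) ^ (n + 1)) := by
    rw [derivative_pow]
    simp [map_ofNat]
    ring
  have h := rodrigues_const (n + 1)
  push_cast at h
  rw [legendre, legendre, legendreAnti, Function.iterate_succ_apply, hd, iterate_derivative_C_mul,
    ← mul_assoc, ← C_mul, h, mul_comm X (_ ^ _), iterate_derivative_mul_X]
  simp only [Nat.add_sub_cancel, nsmul_eq_mul, C_add, map_natCast, C_1]
  push_cast
  ring

/-- Two derivatives of `(X² - 1)^(n+2)` are taken, and the resulting `X²` is rewritten as `(X² - 1)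
+ 1`. -/
lemma legendre_succ_succ_sub (n : ℕ) :
    legendre (n + 2) = C (2 * (n : ℝ) + 3) * legendreAnti n + legendre n := by
  have hd : derivative (derivative ((X ^ 2 - 1 : ℝ[X]) ^ (n + 2))) =
      C (2 * ((n : ℝ) + 1 + 1)) * (C (2 * (n : ℝ) + 3) * (X ^ 2 - 1) ^ (n + 1) +
        C (2 * ((n : ℝ) + 1)) * (X ^ 2 - 1) ^ n) := by
    rw [derivative_pow, derivative_mul, derivative_mul, derivative_pow]
    simp [derivative_pow, map_ofNat]
    ring
  have h := rodrigues_const (n + 1)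
  have h' := rodrigues_const n
  push_cast at h
  rw [legendre, legendre, legendreAnti, Function.iterate_succ_apply, Function.iterate_succ_apply,
    hd, iterate_derivative_C_mul, ← mul_assoc, ← C_mul, h, iterate_map_add,
    iterate_derivative_C_mul, iterate_derivative_C_mul, ← h', mul_add]
  simp only [C_mul, C_add, C_1]
  ring

@[simp] lemma legendre_zero : legendre 0 = 1 := by simp [legendre]

@[simp] lemma legendre_one : legendre 1 = X := by
  simp only [legendre, pow_one, Nat.factorial_one, Function.iterate_one, derivative_sub,
    derivative_X_pow, derivative_one]
  norm_num
  rw [← mul_assoc, ← C_mul]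
  norm_num

/-- Bonnet's recursion formula. -/
lemma legendre_bonnet (n : ℕ) :
    C (2 * (n : ℝ) + 1) * (X * legendre n) =
      C ((n : ℝ) + 1) * legendre (n + 1) + C (n : ℝ) * legendre (n - 1) := by
  cases n with
  -- The truncated index `n - 1 = 0` is harmless here: its coefficient is `n = 0`.
  | zero => simp
  | succ n =>
    have h1 := legendre_succ_succ n
    have h2 := legendre_succ_succ_sub n
    push_cast
    simp only [map_add, map_mul, map_one, map_ofNat] at h1 h2 ⊢
    -- These multipliers eliminate `legendreAnti n` between the two identities.
    linear_combination (-(2 * C (n : ℝ) + 3)) * h1 + (C (n : ℝ) + 1) * h2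

lemma legendre_bonnet_eval (n : ℕ) (x : ℝ) :
    (2 * (n : ℝ) + 1) * (x * (legendre n).eval x) =
      ((n : ℝ) + 1) * (legendre (n + 1)).eval x + n * (legendre (n - 1)).eval x := by
  simpa using congrArg (eval x) (legendre_bonnet n)

lemma legendre_eval_one (n : ℕ) : (legendre n).eval 1 = 1 := by
  induction n using Nat.strong_induction_on with
  | _ n ih =>
    cases n with
    | zero => simp
    | succ n =>
      have h := legendre_bonnet_eval n 1
      rw [ih n (by omega), ih (n - 1) (by omega)] at h
      have : (n : ℝ) + 1 ≠ 0 := by positivity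
      apply mul_left_cancel₀ this
      linarith

lemma legendre_eval_neg_one (n : ℕ) : (legendre n).eval (-1) = (-1) ^ n := by
  induction n using Nat.strong_induction_on with
  | _ n ih =>
    cases n with
    | zero => simp
    | succ n =>
      have h := legendre_bonnet_eval n (-1)
      rw [ih n (by omega), ih (n - 1) (by omega)] at h
      have : (n : ℝ) + 1 ≠ 0 := by positivity
      apply mul_left_cancel₀ this
      cases n with
      | zero => simp at h ⊢
      | succ n =>
        simp only [Nat.add_sub_cancel] at h
        push_cast at h ⊢
        rw [pow_succ] at h
        rw [pow_succ, pow_succ]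
        linarith

lemma legendre_natDegree_le (n : ℕ) : (legendre n).natDegree ≤ n := by
  unfold legendre
  refine (natDegree_C_mul_le _ _).trans ((natDegree_iterate_derivative _ _).trans ?_)
  have : ((X ^ 2 - 1 : ℝ[X]) ^ n).natDegree ≤ n * 2 := by
    refine natDegree_pow_le_of_le n ?_
    compute_degree
  omega

/-- Bonnet's formula relates consecutive leading coefficients by a nonzero factor. The exact degree
is what lets the `P_k` with `k ≤ n` span the polynomials of degree at most `n`. -/
lemma legendre_degree_coeff (n : ℕ) : (legendre n).coeff n ≠ 0 := by
  induction n with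
  | zero => simp
  | succ n ih =>
    have h := congrArg (fun p => coeff p (n + 1)) (legendre_bonnet n)
    simp only [coeff_C_mul, coeff_X_mul, coeff_add] at h
    have h0 : (legendre (n - 1)).coeff (n + 1) = 0 :=
      coeff_eq_zero_of_natDegree_lt ((legendre_natDegree_le _).trans_lt (by omega))
    rw [h0, mul_zero, add_zero] at h
    intro hc
    rw [hc, mul_zero] at h
    have : (2 * (n : ℝ) + 1) ≠ 0 := by positivity
    simp_all

lemma polynomial_intervalIntegrable (p : ℝ[X]) (a b : ℝ) :
    IntervalIntegrable (fun x => p.eval x) volume a b :=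
  p.continuous.intervalIntegrable a b

/-- The antiderivative of `P_{n+1}` is `(P_{n+2} - P_n)/(2n+3)`, which vanishes at both endpoints
because the two indices have the same parity. -/
lemma integral_legendre (n : ℕ) :
    ∫ x in (-1 : ℝ)..1, (legendre n).eval x = if n = 0 then 2 else 0 := by
  cases n with
  | zero => norm_num
  | succ n =>
    rw [if_neg (by omega)]
    have hU : ∀ x : ℝ, (legendreAnti n).eval x = ((legendre (n + 2)).eval x - (legendre n).eval x) /
        (2 * n + 3) := fun x => by
      have h := congrArg (eval x) (legendre_succ_succ_sub n)
      simp at h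
      rw [h]
      field_simp
      ring
    have hd : ∀ x ∈ Set.uIcc (-1 : ℝ) 1,
        HasDerivAt (fun x => (legendreAnti n).eval x) ((legendre (n + 1)).eval x) x := fun x _ => by
      rw [← derivative_legendreAnti]
      exact (legendreAnti n).hasDerivAt x
    rw [intervalIntegral.integral_eq_sub_of_hasDerivAt hd (polynomial_intervalIntegrable _ _ _),
      hU, hU, legendre_eval_one, legendre_eval_one, legendre_eval_neg_one, legendre_eval_neg_one]
    simp [pow_add]

/-! ### Triple products of Legendre polynomials and Adams' formula -/

/-- A double sequence satisfying the recursion that Bonnet's formula imposes on the integrals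
`∫ P_a P_b q` is determined by its values at `a = 0`. -/
lemma eq_of_bonnet_recursion {F G : ℕ → ℕ → ℝ}
    (hF : ∀ a b : ℕ, (2 * (b : ℝ) + 1) * ((a + 1) * F (a + 1) b + a * F (a - 1) b) =
      (2 * (a : ℝ) + 1) * ((b + 1) * F a (b + 1) + b * F a (b - 1)))
    (hG : ∀ a b : ℕ, (2 * (b : ℝ) + 1) * ((a + 1) * G (a + 1) b + a * G (a - 1) b) =
      (2 * (a : ℝ) + 1) * ((b + 1) * G a (b + 1) + b * G a (b - 1)))
    (h0 : ∀ b, F 0 b = G 0 b) (a b : ℕ) : F a b = G a b := by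
  induction a using Nat.strong_induction_on generalizing b with
  | _ a ih =>
    cases a with
    | zero => exact h0 b
    | succ a =>
      have h1 := hF a b
      have h2 := hG a b
      rw [ih a (by omega), ih a (by omega), ih (a - 1) (by omega), ← h2] at h1
      have hb : (2 * (b : ℝ) + 1) ≠ 0 := by positivity
      have ha : (a : ℝ) + 1 ≠ 0 := by positivity
      have h3 := mul_left_cancel₀ hb h1
      exact mul_left_cancel₀ ha (add_right_cancel h3)

/-- The integral `∫_{-1}^1 P_a P_b P_c`. -/
def tripleIntegral (a b c : ℕ) : ℝ :=
  ∫ x in (-1 : ℝ)..1, (legendre a).eval x * (legendre b).eval x * (legendre c).eval x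

/-- Both sides equal `(2a+1)(2b+1) ∫ x P_a P_b P_c`, with Bonnet's formula applied to `x P_a` on one
side and to `x P_b` on the other. -/
lemma tripleIntegral_recursion (c a b : ℕ) :
    (2 * (b : ℝ) + 1) * ((a + 1) * tripleIntegral (a + 1) b c + a * tripleIntegral (a - 1) b c) =
      (2 * (a : ℝ) + 1) *
        ((b + 1) * tripleIntegral a (b + 1) c + b * tripleIntegral a (b - 1) c) := by
  unfold tripleIntegral
  simp only [← intervalIntegral.integral_const_mul]
  rw [← intervalIntegral.integral_add, ← intervalIntegral.integral_add,
    ← intervalIntegral.integral_const_mul, ← intervalIntegral.integral_const_mul]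
  · congr 1
    ext x
    have h1 := legendre_bonnet_eval a x
    have h2 := legendre_bonnet_eval b x
    linear_combination (-(2 * (b : ℝ) + 1) * eval x (legendre b) * eval x (legendre c)) * h1 +
      ((2 * (a : ℝ) + 1) * eval x (legendre a) * eval x (legendre c)) * h2
  all_goals
    apply Continuous.intervalIntegrable
    fun_prop

/-- The numbers `(2n-1)!!/n!`, extended by zero to the negative integers. -/
def oddRatio (n : ℤ) : ℝ :=
  if n < 0 then 0 else ∏ k ∈ Finset.range n.toNat, (2 * (k : ℝ) + 1) / (k + 1)

lemma oddRatio_of_neg {n : ℤ} (h : n < 0) : oddRatio n = 0 := if_pos h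

lemma oddRatio_pos {n : ℤ} (h : 0 ≤ n) : 0 < oddRatio n := by
  rw [oddRatio, if_neg (by omega)]
  exact Finset.prod_pos fun k _ => by positivity

lemma oddRatio_nonneg (n : ℤ) : 0 ≤ oddRatio n := by
  rcases lt_or_ge n 0 with h | h
  · rw [oddRatio_of_neg h]
  · exact (oddRatio_pos h).le

lemma oddRatio_zero : oddRatio 0 = 1 := by simp [oddRatio]

/-- The extension by zero is consistent with the recursion on all of `ℤ`: at `n = -1` the factor `n
+ 1` and the value `oddRatio (-1)` both vanish. Thus Adams' formula covers triples violating the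
triangle inequality without a case distinction. -/
lemma oddRatio_succ (n : ℤ) : ((n : ℝ) + 1) * oddRatio (n + 1) = (2 * n + 1) * oddRatio n := by
  rcases lt_trichotomy n (-1) with h | rfl | h
  · rw [oddRatio_of_neg (by omega), oddRatio_of_neg (by omega)]
    simp
  · rw [oddRatio_of_neg (n := -1) (by omega)]
    simp
  · lift n to ℕ using by omega
    rw [oddRatio, oddRatio, if_neg (by omega), if_neg (by omega)]
    have : ((n : ℤ) + 1).toNat = n + 1 := by omega
    rw [this, Finset.prod_range_succ]
    push_cast
    have : (n : ℝ) + 1 ≠ 0 := by positivity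
    simp
    field_simp

/-- Adams' closed form of `∫_{-1}^1 P_a P_b P_c`. -/
def adams (a b c : ℤ) : ℝ :=
  if Even (a + b + c) then
    2 * oddRatio ((a + b + c) / 2 - a) * oddRatio ((a + b + c) / 2 - b) *
      oddRatio ((a + b + c) / 2 - c) /
        (oddRatio ((a + b + c) / 2) * (2 * ((a + b + c) / 2 : ℤ) + 1))
  else 0

/-- The natural variables are the differences `p, q, r` between the half-perimeter and the three
indices. -/
lemma adams_half (p q r : ℤ) :
    adams (q + r) (p + r) (p + q) = 2 * oddRatio p * oddRatio q * oddRatio r /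
      (oddRatio (p + q + r) * (2 * (p + q + r : ℤ) + 1)) := by
  have h : q + r + (p + r) + (p + q) = 2 * (p + q + r) := by ring
  rw [adams, h, if_pos (even_two_mul _), Int.mul_ediv_cancel_left _ two_ne_zero]
  ring_nf

/-- This is the Bonnet recursion at `(a, b, c) = (q+r+1, p+r+1, p+q+1)`, whose sum is odd, so that
the four neighbours have integral half-perimeter. The hypothesis keeps the `oddRatio` values in the
denominators positive. -/
lemma adams_recursion_aux (p q r : ℤ) (hs : 1 ≤ p + q + r + 2) :
    (2 * ((p : ℝ) + r + 1) + 1) * ((q + r + 2) * adams (q + r + 2) (p + r + 1) (p + q + 1) +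
      (q + r + 1) * adams (q + r) (p + r + 1) (p + q + 1)) =
    (2 * ((q : ℝ) + r + 1) + 1) * ((p + r + 2) * adams (q + r + 1) (p + r + 2) (p + q + 1) +
      (p + r + 1) * adams (q + r + 1) (p + r) (p + q + 1)) := by
  have e1 := adams_half p (q + 1) (r + 1)
  have e2 := adams_half (p + 1) q r
  have e3 := adams_half (p + 1) q (r + 1)
  have e4 := adams_half p (q + 1) r
  rw [show q + 1 + (r + 1) = q + r + 2 by ring, show p + (r + 1) = p + r + 1 by ring,
    show p + (q + 1) = p + q + 1 by ring] at e1
  rw [show p + 1 + r = p + r + 1 by ring, show p + 1 + q = p + q + 1 by ring] at e2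
  rw [show q + (r + 1) = q + r + 1 by ring, show p + 1 + (r + 1) = p + r + 2 by ring,
    show p + 1 + q = p + q + 1 by ring] at e3
  rw [show q + 1 + r = q + r + 1 by ring, show p + (q + 1) = p + q + 1 by ring] at e4
  rw [e1, e2, e3, e4, show p + q + 1 + (r + 1) = (p + q + r + 1) + 1 by ring,
    show p + q + 1 + r = p + q + r + 1 by ring]
  have hA := oddRatio_succ (p + q + r + 1)
  have hpos : 0 < oddRatio (p + q + r + 1) := oddRatio_pos (by omega)
  have hpos' : 0 < oddRatio (p + q + r + 1 + 1) := oddRatio_pos (by omega)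
  have hsR : (1 : ℝ) ≤ p + q + r + 2 := by exact_mod_cast hs
  have hp := oddRatio_succ p
  have hq := oddRatio_succ q
  have hr := oddRatio_succ r
  push_cast at hA ⊢
  have n1 : (2 * ((p : ℝ) + q + r + 1) + 1) ≠ 0 := by linarith
  have n2 : (2 * ((p : ℝ) + q + r + 1 + 1) + 1) ≠ 0 := by linarith
  have n3 : ((p : ℝ) + q + r + 1 + 1) ≠ 0 := by linarith
  have hinv : oddRatio (p + q + r + 1) * (2 * ((p : ℝ) + q + r + 1) + 1) =
    ((p : ℝ) + q + r + 1 + 1) * oddRatio (p + q + r + 1 + 1) := by linarith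
  rw [hinv]
  -- Once the two half-perimeter denominators are brought to a common one, only values of `oddRatio`
  -- at `p, q, r` and their successors remain.
  suffices h : (2 * ((p : ℝ) + r + 1) + 1) * ((q + r + 2) * ((p : ℝ) + q + r + 1 + 1) *
        (oddRatio p * oddRatio (q + 1) * oddRatio (r + 1)) +
      (q + r + 1) * (2 * ((p : ℝ) + q + r + 1 + 1) + 1) *
        (oddRatio (p + 1) * oddRatio q * oddRatio r)) =
    (2 * ((q : ℝ) + r + 1) + 1) * ((p + r + 2) * ((p : ℝ) + q + r + 1 + 1) *
        (oddRatio (p + 1) * oddRatio q * oddRatio (r + 1)) +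
      (p + r + 1) * (2 * ((p : ℝ) + q + r + 1 + 1) + 1) *
        (oddRatio p * oddRatio (q + 1) * oddRatio r)) by
    set B := oddRatio (p + q + r + 1 + 1)
    have q1 (x : ℝ) : x / (B * (2 * ((p : ℝ) + q + r + 1 + 1) + 1)) =
        x * ((p : ℝ) + q + r + 1 + 1) * (1 / (B * (2 * ((p : ℝ) + q + r + 1 + 1) + 1) *
          ((p : ℝ) + q + r + 1 + 1))) := by
      field_simp
    have q2 (x : ℝ) : x / (((p : ℝ) + q + r + 1 + 1) * B) =
        x * (2 * ((p : ℝ) + q + r + 1 + 1) + 1) * (1 / (B * (2 * ((p : ℝ) + q + r + 1 + 1) + 1) *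
          ((p : ℝ) + q + r + 1 + 1))) := by
      generalize (2 * ((p : ℝ) + q + r + 1 + 1) + 1) = d at n2 ⊢
      field_simp
    rw [q1, q1, q2, q2]
    linear_combination (2 * (1 / (B * (2 * ((p : ℝ) + q + r + 1 + 1) + 1) *
          ((p : ℝ) + q + r + 1 + 1)))) * h
  have hz : oddRatio (-1) = 0 := oddRatio_of_neg (by norm_num)
  have hz' : oddRatio (-1 + 1) = 1 := oddRatio_zero
  have hsolve (n : ℤ) (hn : n ≠ -1) :
      oddRatio (n + 1) = (2 * n + 1) / (n + 1) * oddRatio n ∧ (n : ℝ) + 1 ≠ 0 := by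
    have hne : (n : ℝ) + 1 ≠ 0 := by
      intro h
      apply hn
      have : n + 1 = 0 := by exact_mod_cast h
      omega
    refine ⟨?_, hne⟩
    have := oddRatio_succ n
    field_simp
    linarith
  clear hinv n1 n2 n3 hp hq hr hsR hpos hpos' hA e1 e2 e3 e4
  -- Away from `-1` the recursion expresses `oddRatio (n + 1)` through `oddRatio n`; at `-1` that
  -- would divide by zero, but there the two values are `0` and `1`.
  by_cases hp : p = -1 <;> by_cases hq : q = -1 <;> by_cases hr : r = -1
  all_goals
    first | subst hp | (obtain ⟨hp1, hp2⟩ := hsolve p hp; rw [hp1])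
    first | subst hq | (obtain ⟨hq1, hq2⟩ := hsolve q hq; rw [hq1])
    first | subst hr | (obtain ⟨hr1, hr2⟩ := hsolve r hr; rw [hr1])
    try rw [hz]
    try rw [hz']
    push_cast
    try field_simp
    try ring

lemma adams_odd {a b c : ℤ} (h : ¬ Even (a + b + c)) : adams a b c = 0 := if_neg h

/-- All four neighbours have index sum of parity opposite to `a + b + c`, so for an even sum every
term vanishes. The coefficients `a` and `b` make truncated subtraction agree with subtraction in
`ℤ`. -/
lemma adams_recursion (c a b : ℕ) :
    (2 * (b : ℝ) + 1) * ((a + 1) * adams (a + 1 : ℕ) b c + a * adams (a - 1 : ℕ) b c) =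
      (2 * (a : ℝ) + 1) * ((b + 1) * adams a (b + 1 : ℕ) c + b * adams a (b - 1 : ℕ) c) := by
  have ha : (a : ℝ) * adams (a - 1 : ℕ) b c = a * adams ((a : ℤ) - 1) b c := by
    cases a <;> simp
  have hb : (b : ℝ) * adams a (b - 1 : ℕ) c = b * adams a ((b : ℤ) - 1) c := by
    cases b <;> simp
  rw [ha, hb]
  rcases Int.even_or_odd' ((a : ℤ) + b + c) with ⟨k, hk | hk⟩
  · rw [adams_odd, adams_odd, adams_odd, adams_odd]
    · ring
    all_goals
      rw [Int.not_even_iff_odd]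
      push_cast
    · exact ⟨k - 1, by omega⟩
    · exact ⟨k, by omega⟩
    · exact ⟨k - 1, by omega⟩
    · exact ⟨k, by omega⟩
  · have h := adams_recursion_aux (k - a) (k - b) (k - c) (by omega)
    rw [show k - b + (k - c) + 2 = ((a + 1 : ℕ) : ℤ) by push_cast; omega,
      show k - a + (k - c) + 1 = (b : ℤ) by omega, show k - a + (k - b) + 1 = (c : ℤ) by omega,
      show k - b + (k - c) = (a : ℤ) - 1 by omega,
      show (a : ℤ) - 1 + 1 = a by omega,
      show k - a + (k - c) + 2 = ((b + 1 : ℕ) : ℤ) by push_cast; omega,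
      show k - a + (k - c) = (b : ℤ) - 1 by omega] at h
    have hkR : (a : ℝ) + b + c = 2 * k + 1 := by exact_mod_cast hk
    have e1 : ((k - a : ℤ) : ℝ) = ((b : ℝ) + c - a - 1) / 2 := by push_cast; linarith
    have e2 : ((k - b : ℤ) : ℝ) = ((a : ℝ) + c - b - 1) / 2 := by push_cast; linarith
    have e3 : ((k - c : ℤ) : ℝ) = ((a : ℝ) + b - c - 1) / 2 := by push_cast; linarith
    rw [e1, e2, e3] at h
    linear_combination h

lemma adams_symm (a b c : ℤ) : adams a b c = adams b c a := by
  have h : a + b + c = b + c + a := by ring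
  rw [adams, adams, h]
  split_ifs
  · ring
  · rfl

lemma adams_zero_zero (c : ℕ) : adams 0 0 c = if c = 0 then 2 else 0 := by
  rcases Nat.eq_zero_or_pos c with rfl | hc
  · simp [adams, oddRatio_zero]
  · rw [if_neg (by omega), adams]
    split_ifs with h
    · rw [oddRatio_of_neg (n := (0 + 0 + (c : ℤ)) / 2 - c)]
      · simp
      · omega
    · rfl

lemma tripleIntegral_symm (a b c : ℕ) : tripleIntegral a b c = tripleIntegral b c a := by
  unfold tripleIntegral
  congr 1
  ext x
  ring

/-- The recursion reduces `(a, b, c)` to `(0, b, c)`; cyclic symmetry rewrites this as `(b, c, 0)`,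
where a second use reduces to `(0, c, 0)`, that is to `∫ P_c`. -/
lemma tripleIntegral_eq_adams (a b c : ℕ) : tripleIntegral a b c = adams a b c := by
  refine eq_of_bonnet_recursion (F := fun a b => tripleIntegral a b c)
    (G := fun a b => adams a b c) (tripleIntegral_recursion c) (adams_recursion c)
    (fun b => ?_) a b
  have h := eq_of_bonnet_recursion (F := fun b c => tripleIntegral b c 0)
    (G := fun b c => adams b c 0) (tripleIntegral_recursion 0) (adams_recursion 0)
    (fun c => ?_) b c
  · simp only [tripleIntegral_symm 0 b c, h]
    exact (adams_symm 0 b c).symm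
  · have := adams_zero_zero c
    simp only [← tripleIntegral_symm 0 0 c]
    simp only [Nat.cast_zero, ← adams_symm 0 0 c]
    simp [tripleIntegral, this, integral_legendre]

lemma tripleIntegral_nonneg (a b c : ℕ) : 0 ≤ tripleIntegral a b c := by
  rw [tripleIntegral_eq_adams, adams]
  split_ifs
  · have h := @oddRatio_nonneg
    have h' : (0 : ℝ) ≤ (((a : ℤ) + b + c) / 2 : ℤ) := by
      exact_mod_cast (by omega : (0 : ℤ) ≤ ((a : ℤ) + b + c) / 2)
    have := h (((a : ℤ) + b + c) / 2)
    exact div_nonneg (mul_nonneg (mul_nonneg (mul_nonneg zero_le_two (h _)) (h _)) (h _))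
      (mul_nonneg this (by linarith))
  · exact le_rfl

lemma tripleIntegral_self_pos {ℓ : ℕ} (h : Even ℓ) : 0 < tripleIntegral ℓ ℓ ℓ := by
  obtain ⟨k, rfl⟩ := h
  rw [tripleIntegral_eq_adams]
  have := adams_half (k : ℤ) k k
  push_cast at this ⊢
  rw [this]
  have h1 : 0 < oddRatio k := oddRatio_pos (by omega)
  have h2 : 0 < oddRatio (k + k + k : ℤ) := oddRatio_pos (by omega)
  positivity

/-- Orthogonality is the case `c = 0` of Adams' formula: for `m ≠ n` the half-perimeter is smaller
than one of the indices, which gives a zero factor. -/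
lemma integral_legendre_mul (m n : ℕ) :
    ∫ x in (-1 : ℝ)..1, (legendre m).eval x * (legendre n).eval x =
      if m = n then 2 / (2 * (n : ℝ) + 1) else 0 := by
  have h := tripleIntegral_eq_adams m n 0
  simp only [tripleIntegral, legendre_zero, eval_one, mul_one] at h
  rw [h]
  split_ifs with hmn
  · subst hmn
    have := adams_half 0 0 (m : ℤ)
    simp only [zero_add, add_zero, oddRatio_zero] at this
    have hpos : 0 < oddRatio (m : ℤ) := oddRatio_pos (by omega)
    push_cast
    rw [this]
    field_simp
    simp
  · rw [adams]
    split_ifs with he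
    · push_cast at he ⊢
      rcases lt_or_gt_of_ne hmn with hlt | hlt
      · rw [oddRatio_of_neg (n := ((m : ℤ) + n + 0) / 2 - n)]
        · simp
        · omega
      · rw [oddRatio_of_neg (n := ((m : ℤ) + n + 0) / 2 - m)]
        · simp
        · omega
    · rfl

/-! ### Rotation invariance of the surface measure -/

/-- The ambient Euclidean space of the sphere. -/
abbrev E3 : Type := EuclideanSpace ℝ (Fin 3)

/-- A linear isometry acting on the sphere. -/
def sphereMap (L : E3 ≃ₗᵢ[ℝ] E3) (x : S2) : S2 :=
  ⟨L x.1, by simp⟩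

lemma continuous_sphereMap (L : E3 ≃ₗᵢ[ℝ] E3) : Continuous (sphereMap L) :=
  (L.continuous.comp continuous_subtype_val).subtype_mk _

/-- The surface measure of a set is, up to a constant, the volume of the cone over it, and linear
isometries carry cones to cones and preserve volume. -/
lemma measurePreserving_sphereMap (L : E3 ≃ₗᵢ[ℝ] E3) :
    MeasurePreserving (sphereMap L) area area := by
  refine ⟨(continuous_sphereMap L).measurable, ?_⟩
  ext s hs
  rw [Measure.map_apply (continuous_sphereMap L).measurable hs, area,
    Measure.toSphere_apply' _ hs,
    Measure.toSphere_apply' _ ((continuous_sphereMap L).measurable hs)]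
  congr 1
  rw [← L.symm.measurePreserving.measure_preimage_emb L.symm.toHomeomorph.measurableEmbedding]
  congr 1
  ext y
  simp only [Set.mem_smul, Set.mem_image, Set.mem_preimage]
  constructor
  · rintro ⟨r, hr, _, ⟨z, hz, rfl⟩, h⟩
    refine ⟨r, hr, _, ⟨_, hz, rfl⟩, ?_⟩
    rw [sphereMap, ← map_smul, h, L.apply_symm_apply]
  · rintro ⟨r, hr, _, ⟨z, hz, rfl⟩, rfl⟩
    refine ⟨r, hr, L.symm z.1, ⟨sphereMap L.symm z, ?_, rfl⟩, by simp⟩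
    convert hz
    ext1
    simp [sphereMap]

lemma integral_sphereMap (L : E3 ≃ₗᵢ[ℝ] E3) {f : S2 → ℝ} (hf : Continuous f) :
    ∫ x, f (sphereMap L x) ∂area = ∫ x, f x ∂area := by
  conv_rhs => rw [← (measurePreserving_sphereMap L).map_eq]
  exact (integral_map (continuous_sphereMap L).aemeasurable hf.aestronglyMeasurable).symm

lemma integrable_area {f : S2 → ℝ} (hf : Continuous f) : Integrable f area :=
  hf.integrable_of_hasCompactSupport (HasCompactSupport.of_compactSpace f)

lemma integrable_area_prod {f : S2 × S2 → ℝ} (hf : Continuous f) :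
    Integrable f (area.prod area) :=
  hf.integrable_of_hasCompactSupport (HasCompactSupport.of_compactSpace f)

lemma inner_mem_Icc (x y : S2) : inner ℝ x.1 y.1 ∈ Set.Icc (-1 : ℝ) 1 := by
  have h := abs_real_inner_le_norm x.1 y.1
  rw [norm_eq_of_mem_sphere, norm_eq_of_mem_sphere, mul_one] at h
  exact abs_le.mp h

@[fun_prop]
lemma continuous_inner_sphere {A : Type*} [TopologicalSpace A] {f g : A → S2}
    (hf : Continuous f) (hg : Continuous g) :
    Continuous fun a => inner ℝ (f a).1 (g a).1 :=
  (continuous_subtype_val.comp hf).inner (continuous_subtype_val.comp hg)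

/-- Any orthonormal pair can be moved to the last two vectors of the standard basis. -/
lemma exists_isometry_pair {x e : E3} (hx : ‖x‖ = 1) (he : ‖e‖ = 1) (hxe : inner ℝ x e = 0) :
    ∃ L : E3 ≃ₗᵢ[ℝ] E3, ∀ y : E3, inner ℝ x y = (L y) 2 ∧ inner ℝ e y = (L y) 1 := by
  have hv : Orthonormal ℝ (({1, 2} : Set (Fin 3)).domRestrict ![0, e, x]) := by
    constructor
    · rintro ⟨i, rfl | rfl⟩ <;> simp [hx, he]
    · rintro ⟨i, rfl | rfl⟩ ⟨j, rfl | rfl⟩ hij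
      · simp at hij
      · simpa [real_inner_comm] using hxe
      · simpa using hxe
      · simp at hij
  obtain ⟨b, hb⟩ := hv.exists_orthonormalBasis_extension_of_card_eq (by simp)
  refine ⟨b.repr, fun y => ⟨?_, ?_⟩⟩
  · rw [b.repr_apply_apply, hb 2 (by simp)]
    rfl
  · rw [b.repr_apply_apply, hb 1 (by simp)]
    rfl

lemma exists_isometry_single {x : E3} (hx : ‖x‖ = 1) :
    ∃ L : E3 ≃ₗᵢ[ℝ] E3, ∀ y : E3, inner ℝ x y = (L y) 2 := by
  have hv : Orthonormal ℝ (({2} : Set (Fin 3)).domRestrict ![0, 0, x]) := by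
    constructor
    · rintro ⟨i, rfl⟩
      simp [hx]
    · rintro ⟨i, rfl⟩ ⟨j, rfl⟩ hij
      simp at hij
  obtain ⟨b, hb⟩ := hv.exists_orthonormalBasis_extension_of_card_eq (by simp)
  refine ⟨b.repr, fun y => ?_⟩
  rw [b.repr_apply_apply, hb 2 (by simp)]
  rfl

/-- A vector orthogonal to a unit vector `x` is a multiple of a unit vector orthogonal to `x`. -/
lemma exists_unit_direction {x w : E3} (hx : ‖x‖ = 1) (hxw : inner ℝ x w = 0) :
    ∃ e : E3, ‖e‖ = 1 ∧ inner ℝ x e = 0 ∧ w = ‖w‖ • e := by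
  by_cases hw : w = 0
  · obtain ⟨L, hL⟩ := exists_isometry_single hx
    refine ⟨L.symm (EuclideanSpace.single 1 1), by simp, ?_, by simp [hw]⟩
    rw [hL]
    simp
  · have hn : ‖w‖ ≠ 0 := norm_ne_zero_iff.mpr hw
    refine ⟨‖w‖⁻¹ • w, ?_, ?_, ?_⟩
    · rw [norm_smul, norm_inv, norm_norm, inv_mul_cancel₀ hn]
    · rw [inner_smul_right, hxw, mul_zero]
    · rw [smul_smul, mul_inv_cancel₀ hn, one_smul]

/-! ### Archimedes' theorem through Gaussian moments -/

section HatBox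

/-- Gaussian moments on the half line. -/
def halfMoment (k : ℕ) : ℝ := ∫ r in Set.Ioi (0 : ℝ), r ^ k * Real.exp (-r ^ 2)

lemma halfMoment_eq (k : ℕ) : halfMoment k = (1 / 2) * Real.Gamma ((k + 1) / 2) := by
  have h := integral_rpow_mul_exp_neg_rpow (p := 2) (q := k) two_pos
    (by have : (0 : ℝ) ≤ k := k.cast_nonneg
        linarith)
  rw [← h, halfMoment]
  refine setIntegral_congr_fun measurableSet_Ioi fun r _ => ?_
  simp

lemma halfMoment_pos (k : ℕ) : 0 < halfMoment k := by
  rw [halfMoment_eq]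
  have := Real.Gamma_pos_of_pos (s := ((k : ℝ) + 1) / 2) (by positivity)
  positivity

lemma halfMoment_add_two (k : ℕ) : halfMoment (k + 2) = (k + 1) / 2 * halfMoment k := by
  rw [halfMoment_eq, halfMoment_eq]
  have : (((k + 2 : ℕ) : ℝ) + 1) / 2 = ((k : ℝ) + 1) / 2 + 1 := by
    push_cast
    ring
  rw [this, Real.Gamma_add_one (by positivity)]
  ring

lemma fullMoment (k : ℕ) :
    ∫ t : ℝ, t ^ k * Real.exp (-t ^ 2) = (1 + (-1) ^ k) * halfMoment k := by
  rcases Nat.even_or_odd k with hk | hk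
  · have h := integral_comp_abs (f := fun t => t ^ k * Real.exp (-t ^ 2))
    simp only [hk.pow_abs, sq_abs] at h
    rw [h, hk.neg_one_pow, halfMoment]
    norm_num
  · have h := integral_neg_eq_self (fun t : ℝ => t ^ k * Real.exp (-t ^ 2)) volume
    simp only [hk.neg_pow, even_two.neg_pow, neg_mul, integral_neg] at h
    rw [hk.neg_one_pow]
    linarith

/-- In polar coordinates the integrand splits as `r^n e^{-r²}` times a function on the sphere, and
the Jacobian `r²` raises the radial exponent to `n + 2`. -/
lemma sphere_polar (n : ℕ) :
    ∫ y : E3, y 2 ^ n * Real.exp (-‖y‖ ^ 2) =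
      (∫ x : S2, x.1 2 ^ n ∂area) * halfMoment (n + 2) := by
  let f : S2 → ℝ := fun x => x.1 2 ^ n
  let g : Set.Ioi (0 : ℝ) → ℝ := fun r => r.1 ^ n * Real.exp (-r.1 ^ 2)
  have hd : Module.finrank ℝ E3 - 1 = 2 := by simp
  calc
    _ = ∫ y : ({(0)}ᶜ : Set E3), y.1 2 ^ n * Real.exp (-‖y.1‖ ^ 2)
          ∂((volume : Measure E3).comap (↑)) := by
      rw [integral_subtype_comap (measurableSet_singleton _).compl
        fun y : E3 => y 2 ^ n * Real.exp (-‖y‖ ^ 2), restrict_compl_singleton]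
    _ = ∫ z, f z.1 * g z.2 ∂area.prod (.volumeIoiPow 2) := by
      have h := (volume : Measure E3).measurePreserving_homeomorphUnitSphereProd.integral_comp
        (Homeomorph.measurableEmbedding _) (fun z => f z.1 * g z.2)
      rw [hd] at h
      rw [area, ← h]
      congr 1
      ext y
      have hy : ‖y.1‖ ≠ 0 := norm_ne_zero_iff.mpr y.2
      simp only [f, g, homeomorphUnitSphereProd_apply_fst_coe, homeomorphUnitSphereProd_apply_snd_coe,
        PiLp.smul_apply, smul_eq_mul]
      rw [mul_pow, inv_pow]
      field_simp
    _ = (∫ x, f x ∂area) * ∫ r, g r ∂(.volumeIoiPow 2) := integral_prod_mul f g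
    _ = _ := by
      congr 1
      simp only [Measure.volumeIoiPow, ENNReal.ofReal]
      rw [integral_withDensity_eq_integral_smul,
        integral_subtype_comap measurableSet_Ioi
          fun a : ℝ => Real.toNNReal (a ^ 2) • (a ^ n * Real.exp (-a ^ 2)), halfMoment,
        setIntegral_congr_fun measurableSet_Ioi fun x hx => ?_]
      · simp only [NNReal.smul_def, Real.coe_toNNReal _ (sq_nonneg x), smul_eq_mul]
        ring
      · exact (measurable_subtype_coe.pow_const _).real_toNNReal

/-- The same integral in Cartesian coordinates, where the two idle coordinates contribute `√π` each.
-/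
lemma cartesian_moment (n : ℕ) :
    ∫ y : E3, y 2 ^ n * Real.exp (-‖y‖ ^ 2) = Real.pi * ((1 + (-1) ^ n) * halfMoment n) := by
  let f : Fin 3 → ℝ → ℝ := fun i t => if i = 2 then t ^ n * Real.exp (-t ^ 2) else Real.exp (-t ^ 2)
  have h := integral_fintype_prod_volume_eq_prod f
  have hG : ∫ t : ℝ, Real.exp (-t ^ 2) = √Real.pi := by
    simpa using integral_gaussian 1
  have e : ∫ y : E3, y 2 ^ n * Real.exp (-‖y‖ ^ 2) = ∫ y : Fin 3 → ℝ, ∏ i, f i (y i) := by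
    rw [← (PiLp.volume_preserving_toLp (Fin 3)).integral_comp
      (MeasurableEquiv.toLp 2 (Fin 3 → ℝ)).measurableEmbedding]
    congr 1
    ext y
    simp only [EuclideanSpace.norm_sq_eq, Fin.sum_univ_three, Fin.prod_univ_three, f]
    simp [Real.exp_add]
    ring
  rw [e, h, Fin.prod_univ_three]
  simp only [f]
  simp only [Fin.reduceEq, if_false, if_true, hG, fullMoment]
  rw [Real.mul_self_sqrt Real.pi_pos.le]

lemma sphere_moment (n : ℕ) :
    ∫ x : S2, x.1 2 ^ n ∂area = 2 * Real.pi * ∫ t in (-1 : ℝ)..1, t ^ n := by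
  have h := (sphere_polar n).symm.trans (cartesian_moment n)
  rw [halfMoment_add_two] at h
  have hp := (halfMoment_pos n).ne'
  have hn : (n : ℝ) + 1 ≠ 0 := by positivity
  rw [integral_pow, one_pow, pow_succ]
  field_simp at h ⊢
  linear_combination h

end HatBox

lemma continuous_coord (i : Fin 3) : Continuous fun x : S2 => x.1 i := by fun_prop

lemma coord_mem_Icc (x : S2) : x.1 2 ∈ Set.Icc (-1 : ℝ) 1 := by
  have h := inner_mem_Icc ⟨EuclideanSpace.single 2 1, by simp⟩ x
  simpa [EuclideanSpace.inner_single_left] using h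

lemma sphere_integral_polynomial (p : ℝ[X]) :
    ∫ x : S2, p.eval (x.1 2) ∂area = 2 * Real.pi * ∫ t in (-1 : ℝ)..1, p.eval t := by
  induction p using Polynomial.induction_on' with
  | add p q hp hq =>
    simp only [eval_add]
    rw [integral_add, intervalIntegral.integral_add, hp, hq]
    · ring
    · exact polynomial_intervalIntegrable _ _ _
    · exact polynomial_intervalIntegrable _ _ _
    · exact integrable_area (p.continuous.comp (continuous_coord 2))
    · exact integrable_area (q.continuous.comp (continuous_coord 2))
  | monomial n a =>
    simp only [eval_monomial]
    rw [integral_const_mul, intervalIntegral.integral_const_mul, sphere_moment]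
    ring

/-- Archimedes' hat-box theorem. -/
lemma sphere_integral_coord {h : ℝ → ℝ} (hc : Continuous h) :
    ∫ x : S2, h (x.1 2) ∂area = 2 * Real.pi * ∫ t in (-1 : ℝ)..1, h t := by
  -- By Weierstrass, `h` is replaced by a polynomial up to `ε` on `[-1,1]`; the error is at most `ε`
  -- times the area on the left and `4π ε` on the right.
  have key : ∀ ε > 0, |∫ x : S2, h (x.1 2) ∂area - 2 * Real.pi * ∫ t in (-1 : ℝ)..1, h t| ≤
      ε * (area.real Set.univ + 4 * Real.pi) := by
    intro ε hε
    obtain ⟨p, hp⟩ := exists_polynomial_near_of_continuousOn (-1) 1 h hc.continuousOn ε hε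
    have e1 : |∫ x : S2, (p.eval (x.1 2) - h (x.1 2)) ∂area| ≤ ε * area.real Set.univ := by
      exact norm_integral_le_of_norm_le_const (μ := area)
        (f := fun x : S2 => p.eval (x.1 2) - h (x.1 2))
        (Eventually.of_forall fun x => (hp _ (coord_mem_Icc x)).le)
    have e2 : |∫ t in (-1 : ℝ)..1, (p.eval t - h t)| ≤ ε * |1 - (-1)| := by
      refine intervalIntegral.norm_integral_le_of_norm_le_const
        (f := fun t => p.eval t - h t) fun t ht => ?_
      rw [Set.uIoc_of_le (by norm_num)] at ht
      exact (hp t ⟨ht.1.le, ht.2⟩).le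
    rw [integral_sub (f := fun x : S2 => p.eval (x.1 2)) (g := fun x : S2 => h (x.1 2))
      (integrable_area (p.continuous.comp (continuous_coord 2)))
      (integrable_area (hc.comp (continuous_coord 2))), sphere_integral_polynomial] at e1
    rw [intervalIntegral.integral_sub (polynomial_intervalIntegrable _ _ _)
      (hc.intervalIntegrable _ _)] at e2
    have hpi := Real.pi_pos
    rw [show |(1 : ℝ) - (-1)| = 2 by norm_num] at e2
    rw [abs_le] at *
    constructor <;> nlinarith
  have hpi := Real.pi_pos
  by_contra hne
  have hpos := abs_pos.mpr (sub_ne_zero.mpr hne)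
  set d := |∫ x : S2, h (x.1 2) ∂area - 2 * Real.pi * ∫ t in (-1 : ℝ)..1, h t|
  have hA : 0 < area.real Set.univ + 4 * Real.pi := by positivity
  have := key (d / (2 * (area.real Set.univ + 4 * Real.pi))) (by positivity)
  rw [div_mul_eq_mul_div, le_div_iff₀ (by positivity)] at this
  nlinarith

lemma sphere_integral_inner {h : ℝ → ℝ} (hc : Continuous h) (x : S2) :
    ∫ y : S2, h (inner ℝ x.1 y.1) ∂area = 2 * Real.pi * ∫ t in (-1 : ℝ)..1, h t := by
  obtain ⟨L, hL⟩ := exists_isometry_single (norm_eq_of_mem_sphere x)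
  rw [← sphere_integral_coord hc,
    ← integral_sphereMap L (f := fun y => h (y.1 2)) (hc.comp (continuous_coord 2))]
  simp only [hL]
  rfl

lemma area_real_univ : area.real Set.univ = 4 * Real.pi := by
  have h := sphere_integral_coord (h := fun _ => 1) continuous_const
  simp only [integral_const, smul_eq_mul, mul_one] at h
  rw [h]
  norm_num
  ring

/-! ### The Funk–Hecke formula and its consequences -/

/-- A polynomial of degree at most `n` is a combination of the Legendre polynomials up to `n`. -/
lemma exists_legendre_expansion (n : ℕ) : ∀ q : ℝ[X], q.natDegree ≤ n →
    ∃ c : ℕ → ℝ, ∀ x, q.eval x = ∑ k ∈ Finset.range (n + 1), c k * (legendre k).eval x := by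
  induction n with
  | zero =>
    intro q hq
    refine ⟨fun _ => q.coeff 0, fun x => ?_⟩
    rw [eq_C_of_natDegree_le_zero hq]
    simp
  | succ n ih =>
    intro q hq
    set a := q.coeff (n + 1) / (legendre (n + 1)).coeff (n + 1) with ha
    have hdeg : (q - C a * legendre (n + 1)).natDegree ≤ n := by
      rw [natDegree_le_iff_coeff_eq_zero]
      intro N hN
      rw [coeff_sub, coeff_C_mul]
      rcases Nat.eq_or_lt_of_le (Nat.succ_le_of_lt hN) with h | h
      · rw [← h, ha, Nat.succ_eq_add_one, div_mul_cancel₀ _ (legendre_degree_coeff _), sub_self]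
      · rw [coeff_eq_zero_of_natDegree_lt (hq.trans_lt h),
          coeff_eq_zero_of_natDegree_lt ((legendre_natDegree_le _).trans_lt h)]
        simp
    obtain ⟨c, hc⟩ := ih _ hdeg
    refine ⟨fun k => if k = n + 1 then a else c k, fun x => ?_⟩
    have h := hc x
    rw [eval_sub, eval_mul, eval_C] at h
    rw [Finset.sum_range_succ, sub_eq_iff_eq_add.mp h]
    beta_reduce
    rw [if_pos rfl]
    congr 1
    refine Finset.sum_congr rfl fun k hk => ?_
    rw [if_neg (Finset.mem_range.mp hk).ne]

lemma integral_sum_legendre_mul (s : Finset ℕ) (c : ℕ → ℝ) {k : ℕ} (hk : k ∈ s) :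
    ∫ x in (-1 : ℝ)..1, (∑ j ∈ s, c j * (legendre j).eval x) * (legendre k).eval x =
      c k * (2 / (2 * (k : ℝ) + 1)) := by
  simp only [Finset.sum_mul, mul_assoc]
  rw [intervalIntegral.integral_finsetSum]
  · simp only [intervalIntegral.integral_const_mul, integral_legendre_mul, mul_ite, mul_zero]
    rw [Finset.sum_ite_eq' s k, if_pos hk]
  · intro j _
    apply Continuous.intervalIntegrable
    fun_prop

/-- The mixed moments of the zonal function `H` around an axis. -/
def axisMoment (H : ℝ → ℝ) (j : ℕ) : ℝ := ∫ y : S2, H (y.1 2) * y.1 1 ^ j ∂area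

lemma integral_axis_pair {H : ℝ → ℝ} (hH : Continuous H) (j : ℕ) {x e : E3} (hx : ‖x‖ = 1)
    (he : ‖e‖ = 1) (hxe : inner ℝ x e = 0) :
    ∫ y : S2, H (inner ℝ x y.1) * inner ℝ e y.1 ^ j ∂area = axisMoment H j := by
  obtain ⟨L, hL⟩ := exists_isometry_pair hx he hxe
  rw [axisMoment, ← integral_sphereMap L (f := fun y => H (y.1 2) * y.1 1 ^ j)
    ((hH.comp (continuous_coord 2)).mul ((continuous_coord 1).pow j))]
  simp only [hL]
  rfl

/-- By rotation invariance `e` and `-e` give the same moment, while an odd power changes sign. -/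
lemma axisMoment_odd {H : ℝ → ℝ} (hH : Continuous H) {j : ℕ} (hj : Odd j) :
    axisMoment H j = 0 := by
  have hx : ‖(EuclideanSpace.single 2 1 : E3)‖ = 1 := by simp
  have he : ‖(EuclideanSpace.single 1 1 : E3)‖ = 1 := by simp
  have hxe : inner ℝ (EuclideanSpace.single 2 1 : E3) (EuclideanSpace.single 1 1) = 0 := by
    simp [EuclideanSpace.inner_single_left]
  have h1 := integral_axis_pair hH j hx he hxe
  have h2 := integral_axis_pair hH j hx ((norm_neg _).trans he)
    (by rw [inner_neg_right, hxe, neg_zero])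
  simp only [inner_neg_left, hj.neg_pow, mul_neg, integral_neg] at h2
  linarith

lemma integral_axis {H : ℝ → ℝ} (hH : Continuous H) (j : ℕ) {x w : E3} (hx : ‖x‖ = 1)
    (hxw : inner ℝ x w = 0) :
    ∫ y : S2, H (inner ℝ x y.1) * inner ℝ w y.1 ^ j ∂area = ‖w‖ ^ j * axisMoment H j := by
  obtain ⟨e, he, hxe, hw⟩ := exists_unit_direction hx hxw
  have h : ∀ y : S2, H (inner ℝ x y.1) * inner ℝ w y.1 ^ j =
      ‖w‖ ^ j * (H (inner ℝ x y.1) * inner ℝ e y.1 ^ j) := fun y => by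
    conv_lhs => rw [hw]
    rw [real_inner_smul_left, mul_pow]
    ring
  simp only [h]
  rw [integral_const_mul, integral_axis_pair hH j hx he hxe]

/-- A zonal kernel maps zonal powers to zonal polynomials of no larger degree. -/
lemma exists_zonal_pow {K : ℝ → ℝ} (hK : Continuous K) (n : ℕ) :
    ∃ q : ℝ[X], q.natDegree ≤ n ∧ ∀ x e : S2,
      ∫ y : S2, K (inner ℝ x.1 y.1) * inner ℝ e.1 y.1 ^ n ∂area = q.eval (inner ℝ x.1 e.1) := by
  -- With `u = ⟨x, e⟩` and `w = e - u x` orthogonal to `x`, the power `⟨e, y⟩^n = (u ⟨x, y⟩ + ⟨w,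
  -- y⟩)^n` is expanded binomially. Odd moments of `⟨w, y⟩` vanish, and even ones carry `‖w‖^(n-j) =
  -- (1 - u²)^((n-j)/2)`, a polynomial in `u`.
  let t : ℕ → ℝ[X] := fun j =>
    if Even (n - j) then
      C ((n.choose j : ℝ) * axisMoment (fun s => K s * s ^ j) (n - j)) *
        (X ^ j * (1 - X ^ 2) ^ ((n - j) / 2))
    else 0
  refine ⟨∑ j ∈ Finset.range (n + 1), t j, ?_, fun x e => ?_⟩
  · refine natDegree_sum_le_of_forall_le _ _ fun j hj => ?_
    have hj := Finset.mem_range.mp hj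
    simp only [t]
    split_ifs
    · refine (natDegree_C_mul_le _ _).trans (natDegree_mul_le.trans ?_)
      have h1 : (X ^ j : ℝ[X]).natDegree ≤ j := natDegree_X_pow_le j
      have h2 : ((1 - X ^ 2 : ℝ[X]) ^ ((n - j) / 2)).natDegree ≤ (n - j) / 2 * 2 := by
        refine natDegree_pow_le_of_le _ ?_
        compute_degree
      omega
    · simp
  · have hx := norm_eq_of_mem_sphere x
    set u := inner ℝ x.1 e.1 with hu
    set w : E3 := e.1 - u • x.1 with hw
    have hxw : inner ℝ x.1 w = 0 := by
      rw [hw, inner_sub_right, inner_smul_right, real_inner_self_eq_norm_sq, hx]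
      simp [hu]
    have hnorm : ‖w‖ ^ 2 = 1 - u ^ 2 := by
      rw [← real_inner_self_eq_norm_sq, hw, inner_sub_left, ← hw, inner_smul_left, hxw, hw,
        inner_sub_right, real_inner_self_eq_norm_sq, norm_eq_of_mem_sphere e, inner_smul_right,
        real_inner_comm, ← hu]
      simp
      ring
    have hexp : ∀ y : S2, K (inner ℝ x.1 y.1) * inner ℝ e.1 y.1 ^ n =
        ∑ j ∈ Finset.range (n + 1), (u ^ j * n.choose j) *
          ((K (inner ℝ x.1 y.1) * inner ℝ x.1 y.1 ^ j) * inner ℝ w y.1 ^ (n - j)) := fun y => by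
      have he : inner ℝ e.1 y.1 = u * inner ℝ x.1 y.1 + inner ℝ w y.1 := by
        rw [hw, inner_sub_left, real_inner_smul_left]
        ring
      rw [he, add_pow, Finset.mul_sum]
      refine Finset.sum_congr rfl fun j _ => ?_
      rw [mul_pow]
      ring
    simp only [hexp]
    rw [integral_finsetSum, eval_finsetSum]
    · refine Finset.sum_congr rfl fun j _ => ?_
      rw [integral_const_mul, integral_axis (H := fun s => K s * s ^ j) (by fun_prop) _ hx hxw]
      simp only [t]
      split_ifs with hev
      · have h2 : ‖w‖ ^ (n - j) = (1 - u ^ 2) ^ ((n - j) / 2) := by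
          rw [← hnorm, ← pow_mul, Nat.mul_div_cancel' hev.two_dvd]
        rw [h2]
        simp
        ring
      · rw [axisMoment_odd (by fun_prop) (Nat.not_even_iff_odd.mp hev)]
        simp
    · intro j _
      apply integrable_area
      fun_prop

lemma exists_zonal_polynomial {K : ℝ → ℝ} (hK : Continuous K) (p : ℝ[X]) :
    ∃ q : ℝ[X], q.natDegree ≤ p.natDegree ∧ ∀ x e : S2,
      ∫ y : S2, K (inner ℝ x.1 y.1) * p.eval (inner ℝ e.1 y.1) ∂area =
        q.eval (inner ℝ x.1 e.1) := by
  choose q hq hqe using exists_zonal_pow hK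
  refine ⟨∑ j ∈ Finset.range (p.natDegree + 1), C (p.coeff j) * q j, ?_, fun x e => ?_⟩
  · refine natDegree_sum_le_of_forall_le _ _ fun j hj => ?_
    have := Finset.mem_range.mp hj
    exact (natDegree_C_mul_le _ _).trans ((hq j).trans (by omega))
  · have hexp : ∀ y : S2, K (inner ℝ x.1 y.1) * p.eval (inner ℝ e.1 y.1) =
        ∑ j ∈ Finset.range (p.natDegree + 1),
          p.coeff j * (K (inner ℝ x.1 y.1) * inner ℝ e.1 y.1 ^ j) := fun y => by
      rw [eval_eq_sum_range, Finset.mul_sum]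
      exact Finset.sum_congr rfl fun j _ => by ring
    simp only [hexp]
    rw [integral_finsetSum, eval_finsetSum]
    · exact Finset.sum_congr rfl fun j _ => by rw [integral_const_mul, hqe, eval_mul, eval_C]
    · intro j _
      apply integrable_area
      fun_prop

/-- The Funk–Hecke formula for zonal harmonics. -/
theorem funk_hecke {K : ℝ → ℝ} (hK : Continuous K) (n : ℕ) (x e : S2) :
    ∫ y : S2, K (inner ℝ x.1 y.1) * (legendre n).eval (inner ℝ e.1 y.1) ∂area =
      (2 * Real.pi * ∫ t in (-1 : ℝ)..1, K t * (legendre n).eval t) *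
        (legendre n).eval (inner ℝ x.1 e.1) := by
  obtain ⟨q, hqd, hq⟩ := exists_zonal_polynomial hK (legendre n)
  obtain ⟨c, hc⟩ := exists_legendre_expansion n q (hqd.trans (legendre_natDegree_le n))
  have hpi := Real.pi_pos
  -- The operator with kernel `K(⟨x, y⟩)` is symmetric and does not raise degrees. It maps `P_k` to
  -- degree at most `k < n`, orthogonal to `P_n`; hence the image of `P_n` has no component along
  -- `P_k`.
  have horth : ∀ k < n, c k = 0 := by
    intro k hk
    obtain ⟨r, hrd, hr⟩ := exists_zonal_polynomial hK (legendre k)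
    obtain ⟨d, hd⟩ := exists_legendre_expansion k r (hrd.trans (legendre_natDegree_le k))
    have hswap : ∫ x : S2, (∫ y : S2, K (inner ℝ x.1 y.1) * (legendre n).eval (inner ℝ e.1 y.1)
          ∂area) * (legendre k).eval (inner ℝ e.1 x.1) ∂area =
        ∫ y : S2, (∫ x : S2, K (inner ℝ y.1 x.1) * (legendre k).eval (inner ℝ e.1 x.1)
          ∂area) * (legendre n).eval (inner ℝ e.1 y.1) ∂area := by
      simp only [← integral_mul_const]
      rw [integral_integral_swap]
      · congr 1
        ext y
        congr 1
        ext x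
        rw [real_inner_comm]
        ring
      · apply integrable_area_prod
        simp only [Function.uncurry_def]
        fun_prop
    have hl := sphere_integral_inner (h := fun t => q.eval t * (legendre k).eval t) (by fun_prop) e
    have hr' := sphere_integral_inner (h := fun t => r.eval t * (legendre n).eval t)
      (by fun_prop) e
    have e1 : ∫ t in (-1 : ℝ)..1, q.eval t * (legendre k).eval t =
        ∫ t in (-1 : ℝ)..1, r.eval t * (legendre n).eval t := by
      apply mul_left_cancel₀ (by positivity : (2 * Real.pi) ≠ 0)
      rw [← hl, ← hr']
      simp only [hq, hr] at hswap
      simp only [fun a : S2 => real_inner_comm a.1 e.1] at hswap ⊢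
      exact hswap
    have e2 : ∫ t in (-1 : ℝ)..1, r.eval t * (legendre n).eval t = 0 := by
      simp only [hd, Finset.sum_mul, mul_assoc]
      rw [intervalIntegral.integral_finsetSum]
      · refine Finset.sum_eq_zero fun j hj => ?_
        have := Finset.mem_range.mp hj
        rw [intervalIntegral.integral_const_mul, integral_legendre_mul, if_neg (by omega), mul_zero]
      · intro j _
        apply Continuous.intervalIntegrable
        fun_prop
    rw [e2] at e1
    simp only [hc] at e1
    rw [integral_sum_legendre_mul _ _ (Finset.mem_range.mpr (by omega))] at e1
    have : (2 / (2 * (k : ℝ) + 1)) ≠ 0 := by positivity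
    exact (mul_eq_zero.mp e1).resolve_right this
  have hqn : ∀ t, q.eval t = c n * (legendre n).eval t := fun t => by
    rw [hc, Finset.sum_range_succ, Finset.sum_eq_zero, zero_add]
    intro k hk
    rw [horth k (Finset.mem_range.mp hk), zero_mul]
  -- The eigenvalue is read off at `x = e`, where `P_n(1) = 1`.
  have hcn : c n = 2 * Real.pi * ∫ t in (-1 : ℝ)..1, K t * (legendre n).eval t := by
    have h1 := hq e e
    rw [hqn, real_inner_self_eq_norm_sq, norm_eq_of_mem_sphere, one_pow, legendre_eval_one,
      mul_one] at h1
    rw [← h1]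
    exact sphere_integral_inner (h := fun t => K t * (legendre n).eval t) (by fun_prop) e
  rw [hq, hqn, hcn]

/-- The reproducing property of the Legendre kernels. -/
lemma legendre_reproducing (n : ℕ) (x e : S2) :
    ∫ y : S2, (legendre n).eval (inner ℝ x.1 y.1) * (legendre n).eval (inner ℝ e.1 y.1) ∂area =
      4 * Real.pi / (2 * n + 1) * (legendre n).eval (inner ℝ x.1 e.1) := by
  rw [funk_hecke (K := fun t => (legendre n).eval t) (by fun_prop), integral_legendre_mul,
    if_pos rfl]
  ring

/-- Lets pointwise facts on `[-1,1]` be proved for pairs of points of the sphere, where positivity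
and the field itself are available. -/
lemma exists_inner_eq {t : ℝ} (ht : t ∈ Set.Icc (-1 : ℝ) 1) :
    ∃ x y : S2, inner ℝ x.1 y.1 = t := by
  have h1 : 0 ≤ 1 - t ^ 2 := by nlinarith [ht.1, ht.2]
  refine ⟨⟨EuclideanSpace.single 2 1, by simp⟩, ⟨!₂[0, √(1 - t ^ 2), t], ?_⟩, ?_⟩
  · rw [mem_sphere_zero_iff_norm, EuclideanSpace.norm_eq, Fin.sum_univ_three]
    simp [Real.sq_sqrt h1]
  · simp [EuclideanSpace.inner_single_left]

/-- By the reproducing property, `∫ (P_n(⟨x, y⟩) ± P_n(⟨e, y⟩))² dy ≥ 0` reads `2 ± 2 P_n(⟨x, e⟩) ≥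
0` up to a positive factor. -/
lemma abs_legendre_le_one (n : ℕ) {t : ℝ} (ht : t ∈ Set.Icc (-1 : ℝ) 1) :
    |(legendre n).eval t| ≤ 1 := by
  obtain ⟨x, e, rfl⟩ := exists_inner_eq ht
  have hpi := Real.pi_pos
  set l := 4 * Real.pi / (2 * (n : ℝ) + 1) with hl
  have hlpos : 0 < l := by positivity
  have hself (z : S2) : ∫ y : S2, (legendre n).eval (inner ℝ z.1 y.1) *
      (legendre n).eval (inner ℝ z.1 y.1) ∂area = l := by
    rw [legendre_reproducing, real_inner_self_eq_norm_sq, norm_eq_of_mem_sphere, one_pow,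
      legendre_eval_one, mul_one]
  have key (s : ℝ) (hs : s ^ 2 = 1) :
      0 ≤ l + 2 * s * (l * (legendre n).eval (inner ℝ x.1 e.1)) + l := by
    rw [← legendre_reproducing, ← integral_const_mul]
    nth_rw 1 [← hself x]
    rw [← hself e, ← integral_add, ← integral_add]
    · refine integral_nonneg fun y => ?_
      have := sq_nonneg (eval (inner ℝ x.1 y.1) (legendre n) +
        s * eval (inner ℝ e.1 y.1) (legendre n))
      have h2 : (eval (inner ℝ x.1 y.1) (legendre n) +
        s * eval (inner ℝ e.1 y.1) (legendre n)) ^ 2 = _ :=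
          add_sq _ _
      rw [mul_pow, hs] at h2
      simp only [Pi.zero_apply]
      linarith
    all_goals
      apply integrable_area
      fun_prop
  have h1 := key 1 (by norm_num)
  have h2 := key (-1) (by norm_num)
  rw [abs_le]
  constructor <;> nlinarith

/-! ### Abelian asymptotics of triangle-weighted integrals -/

section Cesaro

/-- The weighted integral `∫_0^T (T - τ) κ(τ) dτ`. -/
def triangleIntegral (κ : ℝ → ℝ) (T : ℝ) : ℝ := ∫ τ in (0 : ℝ)..T, (T - τ) * κ τ

lemma exists_bound_of_tendsto_atTop {f : ℝ → ℝ} {c : ℝ} (hf : ContinuousOn f (Set.Ici 0))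
    (h : Tendsto f atTop (𝓝 c)) : ∃ B, 0 ≤ B ∧ ∀ τ, 0 ≤ τ → |f τ| ≤ B := by
  obtain ⟨a, ha⟩ := eventually_atTop.mp ((h.abs).eventually (gt_mem_nhds (lt_add_one |c|)))
  obtain ⟨M, hM⟩ := isCompact_Icc.exists_bound_of_continuousOn
    (hf.mono (Set.Icc_subset_Ici_self : Set.Icc 0 a ⊆ Set.Ici 0))
  refine ⟨max (|c| + 1) M, le_max_of_le_left (by positivity), fun τ hτ => ?_⟩
  rcases le_total a τ with h1 | h1
  · exact (ha τ h1).le.trans (le_max_left _ _)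
  · exact (hM τ ⟨hτ, h1⟩).trans (le_max_right _ _)

/-- After `τ = T u` the normalised integrand is `(1 - u) u^{-b}` times `(T u)^b κ(T u)`, dominated
by a multiple of `u^{-b}`; the limit is `c ∫_0^1 (1 - u) u^{-b} du`. -/
lemma tendsto_triangleIntegral_rpow {κ : ℝ → ℝ} (hκ : Continuous κ) {b c : ℝ} (hb0 : 0 < b)
    (hb1 : b < 1) (h : Tendsto (fun τ => τ ^ b * κ τ) atTop (𝓝 c)) :
    Tendsto (fun T => triangleIntegral κ T / T ^ (2 - b)) atTop
      (𝓝 (c / ((1 - b) * (2 - b)))) := by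
  have hcont : Continuous fun τ : ℝ => τ ^ b * κ τ :=
    (Real.continuous_rpow_const hb0.le).mul hκ
  obtain ⟨B, hB0, hB⟩ := exists_bound_of_tendsto_atTop hcont.continuousOn h
  have hlim : ∫ u in (0 : ℝ)..1, (1 - u) * (u ^ (-b) * c) = c / ((1 - b) * (2 - b)) := by
    have e : ∀ u ∈ Set.uIoc (0 : ℝ) 1, (1 - u) * (u ^ (-b) * c) =
        c * u ^ (-b) - c * u ^ (1 - b) := fun u hu => by
      rw [Set.uIoc_of_le zero_le_one] at hu
      rw [sub_eq_add_neg 1 b, Real.rpow_add hu.1, Real.rpow_one]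
      ring
    rw [intervalIntegral.integral_congr_ae (Eventually.of_forall e), intervalIntegral.integral_sub,
      intervalIntegral.integral_const_mul, intervalIntegral.integral_const_mul,
      integral_rpow (Or.inl (by linarith)), integral_rpow (Or.inl (by linarith))]
    · have h1 : -b + 1 ≠ 0 := by linarith
      have h2 : 1 - b + 1 ≠ 0 := by linarith
      rw [Real.one_rpow, Real.one_rpow, Real.zero_rpow h1, Real.zero_rpow h2]
      have h3 : 1 - b ≠ 0 := by linarith
      have h4 : 2 - b ≠ 0 := by linarith
      rw [show -b + 1 = 1 - b by ring, show 1 - b + 1 = 2 - b by ring]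
      field_simp
      ring
    · exact (intervalIntegral.intervalIntegrable_rpow' (by linarith)).const_mul _
    · exact (intervalIntegral.intervalIntegrable_rpow' (by linarith)).const_mul _
  rw [← hlim]
  have heq : ∀ᶠ T : ℝ in atTop, ∫ u in (0 : ℝ)..1, (1 - u) * (T ^ b * κ (T * u)) =
      triangleIntegral κ T / T ^ (2 - b) := by
    filter_upwards [eventually_gt_atTop 0] with T hT
    have hs := intervalIntegral.mul_integral_comp_mul_left (a := 0) (b := 1)
      (f := fun τ => (T - τ) * κ τ) T
    rw [mul_zero, mul_one] at hs
    rw [triangleIntegral, ← hs, Real.rpow_sub hT, Real.rpow_two, ← intervalIntegral.integral_const_mul,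
      ← intervalIntegral.integral_div]
    congr 1
    ext u
    have := (Real.rpow_pos_of_pos hT b).ne'
    field_simp
  refine Tendsto.congr' heq ?_
  refine intervalIntegral.tendsto_integral_filter_of_dominated_convergence
    (fun u => B * u ^ (-b)) ?_ ?_ ?_ ?_
  · refine Eventually.of_forall fun T => Continuous.aestronglyMeasurable ?_
    fun_prop
  · filter_upwards [eventually_gt_atTop 0] with T hT
    refine Eventually.of_forall fun u hu => ?_
    rw [Set.uIoc_of_le zero_le_one] at hu
    have hTu : 0 < T * u := mul_pos hT hu.1
    have h1 := hB _ hTu.le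
    have h2 : T ^ b * κ (T * u) = u ^ (-b) * ((T * u) ^ b * κ (T * u)) := by
      rw [Real.mul_rpow hT.le hu.1.le, Real.rpow_neg hu.1.le]
      have := (Real.rpow_pos_of_pos hu.1 b).ne'
      field_simp
    have h3 := Real.rpow_nonneg hu.1.le (-b)
    rw [h2, norm_mul, norm_mul, Real.norm_eq_abs, Real.norm_eq_abs, Real.norm_eq_abs,
      abs_of_nonneg h3, abs_of_nonneg (by linarith [hu.2] : 0 ≤ 1 - u)]
    calc (1 - u) * (u ^ (-b) * |(T * u) ^ b * κ (T * u)|) ≤ 1 * (u ^ (-b) * B) := by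
          gcongr
          linarith [hu.1]
      _ = _ := by ring
  · exact (intervalIntegral.intervalIntegrable_rpow' (by linarith)).const_mul _
  · refine Eventually.of_forall fun u hu => ?_
    rw [Set.uIoc_of_le zero_le_one] at hu
    have ht : Tendsto (fun T : ℝ => T * u) atTop atTop := tendsto_id.atTop_mul_const hu.1
    refine (((h.comp ht).const_mul (u ^ (-b))).const_mul (1 - u)).congr' ?_
    filter_upwards [eventually_gt_atTop 0] with T hT
    simp only [Function.comp]
    rw [Real.mul_rpow hT.le hu.1.le, Real.rpow_neg hu.1.le]
    have := (Real.rpow_pos_of_pos hu.1 b).ne'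
    field_simp

/-- The substitution `τ = (1 + T)^u - 1` turns the quotient into the mean over `u ∈ [0,1]` of `(1 +
τ) κ(τ)`, to which bounded convergence applies. Using `1 + τ` avoids a singularity at the origin. -/
lemma tendsto_integral_div_log {κ : ℝ → ℝ} (hκ : Continuous κ) {c : ℝ}
    (h : Tendsto (fun τ => (1 + τ) * κ τ) atTop (𝓝 c)) :
    Tendsto (fun T => (∫ τ in (0 : ℝ)..T, κ τ) / Real.log (1 + T)) atTop (𝓝 c) := by
  obtain ⟨B, hB0, hB⟩ := exists_bound_of_tendsto_atTop (f := fun τ => (1 + τ) * κ τ)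
    (by fun_prop) h
  have hlim : ∫ _ in (0 : ℝ)..1, c = c := by simp
  rw [← hlim]
  have hL : Tendsto (fun T : ℝ => Real.log (1 + T)) atTop atTop :=
    Real.tendsto_log_atTop.comp (tendsto_atTop_add_const_left _ _ tendsto_id)
  let w : ℝ → ℝ → ℝ := fun T u => Real.exp (u * Real.log (1 + T)) - 1
  have heq : ∀ᶠ T : ℝ in atTop, ∫ u in (0 : ℝ)..1, (1 + w T u) * κ (w T u) =
      (∫ τ in (0 : ℝ)..T, κ τ) / Real.log (1 + T) := by
    filter_upwards [eventually_gt_atTop 0, hL.eventually_gt_atTop 0] with T hT hLT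
    have hs := intervalIntegral.integral_comp_mul_deriv (a := 0) (b := 1) (f := w T)
      (f' := fun u => Real.exp (u * Real.log (1 + T)) * Real.log (1 + T)) (g := κ)
      (fun u _ => by
        have := ((hasDerivAt_id u).mul_const (Real.log (1 + T))).exp.sub_const 1
        simpa [w] using this)
      (by fun_prop) hκ
    have h0 : w T 0 = 0 := by simp [w]
    have h1 : w T 1 = T := by simp [w, Real.exp_log (by linarith : 0 < 1 + T)]
    rw [h0, h1] at hs
    rw [← hs, ← intervalIntegral.integral_div]
    congr 1
    ext u
    simp only [w, Function.comp]
    field_simp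
    ring
  refine Tendsto.congr' heq ?_
  refine intervalIntegral.tendsto_integral_filter_of_dominated_convergence
    (fun _ => B) ?_ ?_ ?_ ?_
  · refine Eventually.of_forall fun T => Continuous.aestronglyMeasurable ?_
    fun_prop
  · filter_upwards [hL.eventually_gt_atTop 0] with T hLT
    refine Eventually.of_forall fun u hu => ?_
    rw [Set.uIoc_of_le zero_le_one] at hu
    refine hB _ ?_
    have := Real.one_le_exp (mul_nonneg hu.1.le hLT.le)
    simp only [w]
    linarith
  · exact intervalIntegrable_const
  · refine Eventually.of_forall fun u hu => ?_
    rw [Set.uIoc_of_le zero_le_one] at hu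
    refine h.comp (tendsto_atTop_add_const_right _ _ ?_)
    exact Real.tendsto_exp_atTop.comp (hL.const_mul_atTop hu.1)

lemma tendsto_log_one_add_div_log :
    Tendsto (fun T : ℝ => Real.log (1 + T) / Real.log T) atTop (𝓝 1) := by
  have h1 : Tendsto (fun T : ℝ => Real.log (1 + T⁻¹)) atTop (𝓝 (Real.log (1 + 0))) :=
    (tendsto_inv_atTop_zero.const_add 1).log (by norm_num)
  have h2 := h1.div_atTop Real.tendsto_log_atTop
  have h3 := h2.const_add 1
  rw [add_zero] at h3
  refine h3.congr' ?_
  filter_upwards [eventually_gt_atTop 1] with T hT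
  have hl := (Real.log_pos hT).ne'
  have hT0 : T ≠ 0 := by linarith
  have hsum : (1 : ℝ) + T⁻¹ ≠ 0 := by positivity
  rw [show 1 + T = T * (1 + T⁻¹) by field_simp; ring, Real.log_mul hT0 hsum]
  field_simp

/-- In `T ∫ κ - ∫ τ κ` the second term is `O(T)`, since `τ κ(τ)` is bounded, and so is negligible
against `T log T`. -/
lemma tendsto_triangleIntegral_log {κ : ℝ → ℝ} (hκ : Continuous κ) {c : ℝ}
    (h : Tendsto (fun τ => τ * κ τ) atTop (𝓝 c)) :
    Tendsto (fun T => triangleIntegral κ T / (T * Real.log T)) atTop (𝓝 c) := by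
  obtain ⟨B, hB0, hB⟩ := exists_bound_of_tendsto_atTop (f := fun τ => τ * κ τ)
    (by fun_prop) h
  have h0 : Tendsto κ atTop (𝓝 0) := by
    refine (h.div_atTop tendsto_id).congr' ?_
    filter_upwards [eventually_gt_atTop 0] with τ hτ
    simp only [id]
    field_simp
  have h1 : Tendsto (fun τ => (1 + τ) * κ τ) atTop (𝓝 c) := by
    have := h0.add h
    rw [zero_add] at this
    refine this.congr fun τ => ?_
    ring
  have hA := (tendsto_integral_div_log hκ h1).mul tendsto_log_one_add_div_log
  rw [mul_one] at hA
  have hR : Tendsto (fun T => (∫ τ in (0 : ℝ)..T, τ * κ τ) / T / Real.log T) atTop (𝓝 0) := by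
    refine squeeze_zero_norm' (a := fun T => B / Real.log T) ?_
      (tendsto_const_nhds.div_atTop Real.tendsto_log_atTop)
    filter_upwards [eventually_gt_atTop 1] with T hT
    have hl := Real.log_pos hT
    have hT0 : 0 < T := by linarith
    have := intervalIntegral.norm_integral_le_of_norm_le_const (a := 0) (b := T)
      (f := fun τ => τ * κ τ) (C := B) (fun τ hτ => by
        rw [Set.uIoc_of_le hT0.le] at hτ
        exact hB τ hτ.1.le)
    rw [sub_zero, abs_of_pos hT0] at this
    rw [norm_div, norm_div, Real.norm_of_nonneg hT0.le, Real.norm_of_nonneg hl.le]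
    gcongr
    rwa [div_le_iff₀ hT0]
  have hsub := hA.sub hR
  rw [sub_zero] at hsub
  refine hsub.congr' ?_
  filter_upwards [eventually_gt_atTop 1] with T hT
  have hl := (Real.log_pos hT).ne'
  have hl' := (Real.log_pos (by linarith : 1 < 1 + T)).ne'
  have hT0 : T ≠ 0 := by linarith
  have e : triangleIntegral κ T = T * (∫ τ in (0 : ℝ)..T, κ τ) - ∫ τ in (0 : ℝ)..T, τ * κ τ := by
    rw [triangleIntegral, ← intervalIntegral.integral_const_mul, ← intervalIntegral.integral_sub]
    · congr 1
      ext τ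
      ring
    · apply Continuous.intervalIntegrable
      fun_prop
    · apply Continuous.intervalIntegrable
      fun_prop
  rw [e]
  field_simp

/-- The antiderivative `F` of the even `κ` from `0` is odd, so the inner integral `F(t) - F(t - T)`
has total integral `2 ∫_0^T F`; integration by parts turns `∫ F` into the triangle weight. -/
lemma integral_integral_sub_eq {κ : ℝ → ℝ} (hκ : Continuous κ) (heven : ∀ τ, κ (-τ) = κ τ)
    (T : ℝ) :
    ∫ t in (0 : ℝ)..T, ∫ s in (0 : ℝ)..T, κ (t - s) = 2 * triangleIntegral κ T := by
  let F : ℝ → ℝ := fun t => ∫ τ in (0 : ℝ)..t, κ τ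
  have hint : ∀ a b, IntervalIntegrable κ volume a b := fun a b => hκ.intervalIntegrable a b
  have hF : ∀ t, HasDerivAt F (κ t) t := fun t =>
    intervalIntegral.integral_hasDerivAt_right (hint _ _)
      hκ.aestronglyMeasurable.stronglyMeasurableAtFilter hκ.continuousAt
  have hFc : Continuous F := continuous_iff_continuousAt.mpr fun t => (hF t).continuousAt
  have hodd : ∀ t, F (-t) = -F t := fun t => by
    have h := intervalIntegral.integral_comp_neg (a := 0) (b := t) κ
    simp only [heven, neg_zero] at h
    simp only [F]
    rw [intervalIntegral.integral_symm, ← h]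
  have h1 : ∀ t, ∫ s in (0 : ℝ)..T, κ (t - s) = F t - F (t - T) := fun t => by
    rw [intervalIntegral.integral_comp_sub_left, sub_zero]
    exact (intervalIntegral.integral_interval_sub_left (hint _ _) (hint _ _)).symm
  have h2 : ∫ t in (0 : ℝ)..T, F (t - T) = -∫ t in (0 : ℝ)..T, F t := by
    have h := intervalIntegral.integral_comp_sub_left (a := 0) (b := T) (fun t => F t) T
    rw [sub_self, sub_zero] at h
    rw [← h, ← intervalIntegral.integral_neg]
    congr 1
    ext t
    rw [← hodd, neg_sub]
  have h3 : triangleIntegral κ T = ∫ t in (0 : ℝ)..T, F t := by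
    have h := intervalIntegral.integral_mul_deriv_eq_deriv_mul (a := 0) (b := T)
      (u := fun τ => T - τ) (u' := fun _ => -1) (v := F) (v' := κ)
      (fun τ _ => by simpa using (hasDerivAt_id τ).const_sub T) (fun τ _ => hF τ)
      intervalIntegrable_const (hint _ _)
    have hF0 : F 0 = 0 := intervalIntegral.integral_same
    rw [triangleIntegral, h, hF0]
    simp
  simp only [h1]
  rw [intervalIntegral.integral_sub (hFc.intervalIntegrable _ _)
    (by apply Continuous.intervalIntegrable; fun_prop), h2, h3]
  ring

end Cesaro

/-! ### Moments and Hermite coefficients under the standard normal law -/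

/-- The standard normal distribution. -/
abbrev stdNormal : Measure ℝ := gaussianReal 0 1

/-- The indicator function of the nonnegative half line. -/
def halfLine (x : ℝ) : ℝ := if 0 ≤ x then 1 else 0

lemma measurable_halfLine : Measurable halfLine :=
  Measurable.ite measurableSet_Ici measurable_const measurable_const

lemma halfLine_mem (x : ℝ) : halfLine x ∈ Set.Icc (0 : ℝ) 1 := by
  unfold halfLine
  split_ifs <;> simp

lemma integral_stdNormal (f : ℝ → ℝ) :
    ∫ x, f x ∂stdNormal = (√(2 * Real.pi))⁻¹ * ∫ x, f x * Real.exp (-x ^ 2 / 2) := by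
  rw [integral_gaussianReal_eq_integral_smul one_ne_zero, ← integral_const_mul]
  congr 1
  ext x
  simp [gaussianPDFReal]
  ring

lemma integrable_pow_stdNormal (k : ℕ) : Integrable (fun x : ℝ => x ^ k) stdNormal := by
  have h := (memLp_id_gaussianReal' (μ := 0) (v := 1) (k : ENNReal) (by simp)).integrable_norm_pow'
  refine h.mono' (by fun_prop) (Eventually.of_forall fun x => ?_)
  simp

lemma moment_stdNormal (k : ℕ) :
    ∫ x, x ^ k ∂stdNormal = √2 ^ k / √Real.pi * ((1 + (-1) ^ k) * halfMoment k) := by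
  have h2 : (0 : ℝ) < √2 := by positivity
  have hs := Measure.integral_comp_mul_left (fun x : ℝ => x ^ k * Real.exp (-x ^ 2 / 2)) √2
  rw [integral_stdNormal, ← fullMoment]
  have e : ∀ x : ℝ, (√2 * x) ^ k * Real.exp (-(√2 * x) ^ 2 / 2) =
      √2 ^ k * (x ^ k * Real.exp (-x ^ 2)) := fun x => by
    rw [mul_pow, mul_pow √2 x 2, Real.sq_sqrt zero_le_two, mul_assoc]
    congr 3
    ring
  simp only [e] at hs
  rw [integral_const_mul, smul_eq_mul, abs_inv, abs_of_pos h2] at hs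
  rw [Real.sqrt_mul zero_le_two]
  have hpi : √Real.pi ≠ 0 := (Real.sqrt_pos.mpr Real.pi_pos).ne'
  field_simp at hs ⊢
  linear_combination -hs

lemma half_moment_stdNormal (k : ℕ) :
    ∫ x, halfLine x * x ^ k ∂stdNormal = √2 ^ k / √Real.pi * halfMoment k := by
  have h2 : (0 : ℝ) < √2 := by positivity
  have hs := integral_comp_mul_left_Ioi (fun x : ℝ => x ^ k * Real.exp (-x ^ 2 / 2)) 0 h2
  rw [integral_stdNormal]
  have e : ∀ x : ℝ, (√2 * x) ^ k * Real.exp (-(√2 * x) ^ 2 / 2) =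
      √2 ^ k * (x ^ k * Real.exp (-x ^ 2)) := fun x => by
    rw [mul_pow, mul_pow √2 x 2, Real.sq_sqrt zero_le_two, mul_assoc]
    congr 3
    ring
  have e' : ∫ x, halfLine x * x ^ k * Real.exp (-x ^ 2 / 2) =
      ∫ x in Set.Ioi 0, x ^ k * Real.exp (-x ^ 2 / 2) := by
    rw [← integral_Ici_eq_integral_Ioi, ← integral_indicator measurableSet_Ici]
    congr 1
    ext x
    by_cases hx : 0 ≤ x <;> simp [halfLine, Set.indicator, hx]
  rw [mul_zero] at hs
  simp only [e] at hs
  rw [integral_const_mul, smul_eq_mul, ← halfMoment] at hs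
  rw [e', Real.sqrt_mul zero_le_two]
  have hpi : √Real.pi ≠ 0 := (Real.sqrt_pos.mpr Real.pi_pos).ne'
  field_simp at hs ⊢
  linear_combination -hs

lemma halfMoment_zero : halfMoment 0 = √Real.pi / 2 := by
  rw [halfMoment_eq, Nat.cast_zero, zero_add, Real.Gamma_one_half_eq]
  ring

lemma halfMoment_one : halfMoment 1 = 1 / 2 := by
  rw [halfMoment_eq]
  norm_num

lemma continuous_H3 : Continuous H3 := by
  unfold H3
  fun_prop

lemma integrable_H3_sq : Integrable (fun x => H3 x ^ 2) stdNormal := by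
  have h : (fun x => H3 x ^ 2) = fun x => x ^ 6 - 6 * x ^ 4 + 9 * x ^ 2 := by
    ext x
    unfold H3
    ring
  rw [h]
  exact ((integrable_pow_stdNormal 6).sub ((integrable_pow_stdNormal 4).const_mul 6)).add
    ((integrable_pow_stdNormal 2).const_mul 9)

lemma integrable_H3 : Integrable H3 stdNormal := by
  have h := (integrable_pow_stdNormal 1).const_mul 3
  simp only [pow_one] at h
  exact (integrable_pow_stdNormal 3).sub h

lemma memLp_H3 : MemLp H3 2 stdNormal :=
  (memLp_two_iff_integrable_sq continuous_H3.aestronglyMeasurable).mpr integrable_H3_sq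

lemma integral_H3 : ∫ x, H3 x ∂stdNormal = 0 := by
  unfold H3
  have h := (integrable_pow_stdNormal 1).const_mul 3
  simp only [pow_one] at h
  rw [integral_sub (integrable_pow_stdNormal 3) h, integral_const_mul, moment_stdNormal]
  have h1 := moment_stdNormal 1
  simp only [pow_one] at h1
  rw [h1]
  norm_num

lemma integral_H3_sq : ∫ x, H3 x * H3 x ∂stdNormal = 6 := by
  have h : (fun x => H3 x * H3 x) = fun x => x ^ 6 - 6 * x ^ 4 + 9 * x ^ 2 := by
    ext x
    unfold H3
    ring
  have hpi : √Real.pi ≠ 0 := (Real.sqrt_pos.mpr Real.pi_pos).ne'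
  have h2 : √2 ^ 2 = 2 := Real.sq_sqrt zero_le_two
  have i46 : Integrable (fun x : ℝ => x ^ 6 - 6 * x ^ 4) stdNormal :=
    (integrable_pow_stdNormal 6).sub ((integrable_pow_stdNormal 4).const_mul 6)
  rw [h, integral_add i46 ((integrable_pow_stdNormal 2).const_mul 9),
    integral_sub (integrable_pow_stdNormal 6)
    ((integrable_pow_stdNormal 4).const_mul 6), integral_const_mul, integral_const_mul,
    moment_stdNormal, moment_stdNormal, moment_stdNormal, halfMoment_add_two 4,
    halfMoment_add_two 2, halfMoment_add_two 0, halfMoment_zero,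
    show √2 ^ 6 = (√2 ^ 2) ^ 3 by ring, show √2 ^ 4 = (√2 ^ 2) ^ 2 by ring, h2]
  field_simp
  norm_num

lemma integrable_halfLine_mul {f : ℝ → ℝ} (hf : Integrable f stdNormal) :
    Integrable (fun x => halfLine x * f x) stdNormal := by
  refine hf.norm.mono' (measurable_halfLine.aestronglyMeasurable.mul hf.aestronglyMeasurable)
    (Eventually.of_forall fun x => ?_)
  have := halfLine_mem x
  rw [norm_mul, Real.norm_eq_abs (halfLine x), abs_of_nonneg this.1]
  exact mul_le_of_le_one_left (norm_nonneg _) this.2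

lemma integral_halfLine : ∫ x, halfLine x ∂stdNormal = 1 / 2 := by
  have h := half_moment_stdNormal 0
  simp only [pow_zero, mul_one] at h
  have hpi : √Real.pi ≠ 0 := (Real.sqrt_pos.mpr Real.pi_pos).ne'
  rw [h, halfMoment_zero]
  field_simp

/-- The Hermite coefficient of degree three of the indicator, responsible for the factor `-1/(3!
√(2π))` of the expansion. -/
lemma integral_halfLine_mul_H3 :
    ∫ x, halfLine x * H3 x ∂stdNormal = -(1 / √(2 * Real.pi)) := by
  have h1 : ∀ x, halfLine x * H3 x = halfLine x * x ^ 3 - 3 * (halfLine x * x ^ 1) := fun x => by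
    unfold H3
    ring
  have hpi : √Real.pi ≠ 0 := (Real.sqrt_pos.mpr Real.pi_pos).ne'
  have h2 : √2 ^ 2 = 2 := Real.sq_sqrt zero_le_two
  simp only [h1]
  rw [integral_sub (integrable_halfLine_mul (integrable_pow_stdNormal 3))
    ((integrable_halfLine_mul (integrable_pow_stdNormal 1)).const_mul 3), integral_const_mul,
    half_moment_stdNormal, half_moment_stdNormal, halfMoment_add_two, halfMoment_one,
    Real.sqrt_mul zero_le_two, show √2 ^ 3 = √2 ^ 2 * √2 by ring, h2]
  field_simp
  rw [h2]
  norm_num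

/-! ### Correlated Gaussian pairs and Mehler's formula -/

/-- The standard pair with correlation `ρ`, as a function of two independent normal variables. -/
def correlate (ρ : ℝ) (p : ℝ × ℝ) : ℝ × ℝ := (p.1, ρ * p.1 + √(1 - ρ ^ 2) * p.2)

lemma continuous_correlate (ρ : ℝ) : Continuous (correlate ρ) := by
  unfold correlate
  fun_prop

section Pair

variable {Ω : Type*} [MeasurableSpace Ω] {P : Measure Ω} {X Y : Ω → ℝ}

/-- `X`, `Y` are jointly Gaussian, centred, of unit variance, with correlation `ρ`. -/
structure IsStdPair (P : Measure Ω) (X Y : Ω → ℝ) (ρ : ℝ) : Prop where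
  gaussian : HasGaussianLaw (fun ω => (X ω, Y ω)) P
  mean_fst : ∫ ω, X ω ∂P = 0
  mean_snd : ∫ ω, Y ω ∂P = 0
  sq_fst : ∫ ω, X ω ^ 2 ∂P = 1
  sq_snd : ∫ ω, Y ω ^ 2 ∂P = 1
  mul : ∫ ω, X ω * Y ω ∂P = ρ

/-- A Gaussian characteristic function sees only the mean and variance of `L(X, Y)`, so the joint
law depends on `ρ` alone; this permits replacing the pair by the explicit model `correlate ρ`. -/
lemma IsStdPair.charFunDual_eq {ρ : ℝ} (h : IsStdPair P X Y ρ) (L : StrongDual ℝ (ℝ × ℝ)) :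
    charFunDual (P.map fun ω => (X ω, Y ω)) L =
      Complex.exp (-((L (1, 0) ^ 2 + 2 * ρ * L (1, 0) * L (0, 1) + L (0, 1) ^ 2 : ℝ) / 2 : ℂ)) := by
  have hX : MemLp X 2 P := (h.gaussian.map_fun (ContinuousLinearMap.fst ℝ ℝ ℝ)).memLp_two
  have hY : MemLp Y 2 P := (h.gaussian.map_fun (ContinuousLinearMap.snd ℝ ℝ ℝ)).memLp_two
  have hprob := h.gaussian.isProbabilityMeasure
  have hL : ∀ ω, L (X ω, Y ω) = L (1, 0) * X ω + L (0, 1) * Y ω := fun ω => by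
    have : (X ω, Y ω) = X ω • ((1 : ℝ), (0 : ℝ)) + Y ω • ((0 : ℝ), (1 : ℝ)) := by simp
    rw [this, map_add, map_smul, map_smul, smul_eq_mul, smul_eq_mul]
    ring
  have hXi := hX.integrable one_le_two
  have hYi := hY.integrable one_le_two
  have hmean : ∫ ω, L (X ω, Y ω) ∂P = 0 := by
    simp only [hL]
    rw [integral_add (hXi.const_mul _) (hYi.const_mul _), integral_const_mul, integral_const_mul,
      h.mean_fst, h.mean_snd]
    ring
  have hvar : Var[fun ω => L (X ω, Y ω); P] =
      L (1, 0) ^ 2 + 2 * ρ * L (1, 0) * L (0, 1) + L (0, 1) ^ 2 := by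
    rw [variance_of_integral_eq_zero _ hmean]
    · have e : ∀ ω, L (X ω, Y ω) ^ 2 = L (1, 0) ^ 2 * X ω ^ 2 +
          2 * L (1, 0) * L (0, 1) * (X ω * Y ω) + L (0, 1) ^ 2 * Y ω ^ 2 := fun ω => by
        rw [hL]
        ring
      simp only [e]
      rw [integral_add, integral_add, integral_const_mul, integral_const_mul, integral_const_mul,
        h.sq_fst, h.sq_snd, h.mul]
      · ring
      · exact hX.integrable_sq.const_mul _
      · exact (hX.integrable_mul hY).const_mul _
      · exact (hX.integrable_sq.const_mul _).add ((hX.integrable_mul hY).const_mul _)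
      · exact hY.integrable_sq.const_mul _
    · exact L.continuous.measurable.comp_aemeasurable h.gaussian.aemeasurable
  rw [h.gaussian.charFunDual_map_eq_fun, hmean, hvar]
  simp

lemma isStdPair_correlate {ρ : ℝ} (hρ : ρ ^ 2 ≤ 1) :
    IsStdPair (stdNormal.prod stdNormal) (fun p => (correlate ρ p).1)
      (fun p => (correlate ρ p).2) ρ := by
  have i1 : Integrable (fun x : ℝ => x) stdNormal := by
    simpa using integrable_pow_stdNormal 1
  have i2 := integrable_pow_stdNormal 2
  have m1 : ∫ x, x ∂stdNormal = 0 := integral_id_gaussianReal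
  have m2 : ∫ x, x ^ 2 ∂stdNormal = 1 := by
    rw [moment_stdNormal, halfMoment_add_two 0, halfMoment_zero, Real.sq_sqrt zero_le_two]
    have hpi : √Real.pi ≠ 0 := (Real.sqrt_pos.mpr Real.pi_pos).ne'
    field_simp
    norm_num
  have f1 : ∫ p : ℝ × ℝ, p.1 ∂stdNormal.prod stdNormal = 0 := by
    rw [integral_fun_fst (fun x : ℝ => x), m1, smul_zero]
  have f2 : ∫ p : ℝ × ℝ, p.2 ∂stdNormal.prod stdNormal = 0 := by
    rw [integral_fun_snd (fun x : ℝ => x), m1, smul_zero]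
  have q1 : ∫ p : ℝ × ℝ, p.1 ^ 2 ∂stdNormal.prod stdNormal = 1 := by
    rw [integral_fun_fst (fun x : ℝ => x ^ 2), m2]
    simp
  have q2 : ∫ p : ℝ × ℝ, p.2 ^ 2 ∂stdNormal.prod stdNormal = 1 := by
    rw [integral_fun_snd (fun x : ℝ => x ^ 2), m2]
    simp
  have q12 : ∫ p : ℝ × ℝ, p.1 * p.2 ∂stdNormal.prod stdNormal = 0 := by
    rw [integral_prod_mul (fun x : ℝ => x) (fun x : ℝ => x), m1, zero_mul]
  have I1 : Integrable (fun p : ℝ × ℝ => p.1) (stdNormal.prod stdNormal) := i1.comp_fst _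
  have I2 : Integrable (fun p : ℝ × ℝ => p.2) (stdNormal.prod stdNormal) := i1.comp_snd _
  have J1 : Integrable (fun p : ℝ × ℝ => p.1 ^ 2) (stdNormal.prod stdNormal) := i2.comp_fst _
  have J2 : Integrable (fun p : ℝ × ℝ => p.2 ^ 2) (stdNormal.prod stdNormal) := i2.comp_snd _
  have J12 : Integrable (fun p : ℝ × ℝ => p.1 * p.2) (stdNormal.prod stdNormal) := i1.mul_prod i1
  have hs : √(1 - ρ ^ 2) ^ 2 = 1 - ρ ^ 2 := Real.sq_sqrt (by linarith)
  refine ⟨?_, f1, ?_, q1, ?_, ?_⟩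
  · let L : ℝ × ℝ →L[ℝ] ℝ × ℝ := (ContinuousLinearMap.fst ℝ ℝ ℝ).prod
      (ρ • ContinuousLinearMap.fst ℝ ℝ ℝ + √(1 - ρ ^ 2) • ContinuousLinearMap.snd ℝ ℝ ℝ)
    exact (IsGaussian.hasGaussianLaw_id (μ := stdNormal.prod stdNormal)).map_fun L
  · simp only [correlate]
    rw [integral_add (I1.const_mul _) (I2.const_mul _), integral_const_mul, integral_const_mul,
      f1, f2]
    ring
  · have e : ∀ p : ℝ × ℝ, (correlate ρ p).2 ^ 2 = ρ ^ 2 * p.1 ^ 2 +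
        2 * ρ * √(1 - ρ ^ 2) * (p.1 * p.2) + √(1 - ρ ^ 2) ^ 2 * p.2 ^ 2 := fun p => by
      simp only [correlate]
      ring
    simp only [e]
    rw [integral_add, integral_add (J1.const_mul _) (J12.const_mul _), integral_const_mul,
      integral_const_mul, integral_const_mul, q1, q2, q12, hs]
    · ring
    · exact (J1.const_mul _).add (J12.const_mul _)
    · exact J2.const_mul _
  · have e : ∀ p : ℝ × ℝ, (correlate ρ p).1 * (correlate ρ p).2 = ρ * p.1 ^ 2 +
        √(1 - ρ ^ 2) * (p.1 * p.2) := fun p => by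
      simp only [correlate]
      ring
    simp only [e]
    rw [integral_add (J1.const_mul _) (J12.const_mul _), integral_const_mul, integral_const_mul,
      q1, q12]
    ring

/-- The second moment of `Y - ρ X` is `1 - ρ²`. -/
lemma IsStdPair.sq_le_one {ρ : ℝ} (h : IsStdPair P X Y ρ) : ρ ^ 2 ≤ 1 := by
  have hX : MemLp X 2 P := (h.gaussian.map_fun (ContinuousLinearMap.fst ℝ ℝ ℝ)).memLp_two
  have hY : MemLp Y 2 P := (h.gaussian.map_fun (ContinuousLinearMap.snd ℝ ℝ ℝ)).memLp_two
  have e : ∀ ω, (Y ω - ρ * X ω) ^ 2 = Y ω ^ 2 - 2 * ρ * (X ω * Y ω) + ρ ^ 2 * X ω ^ 2 :=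
    fun ω => by ring
  have h0 : 0 ≤ ∫ ω, (Y ω - ρ * X ω) ^ 2 ∂P := integral_nonneg fun ω => sq_nonneg _
  simp only [e] at h0
  rw [integral_add, integral_sub, integral_const_mul, integral_const_mul, h.sq_fst, h.sq_snd,
    h.mul] at h0
  · nlinarith
  · exact hY.integrable_sq
  · exact (hX.integrable_mul hY).const_mul _
  · exact hY.integrable_sq.sub ((hX.integrable_mul hY).const_mul _)
  · exact hX.integrable_sq.const_mul _

lemma IsStdPair.map_eq {ρ : ℝ} (h : IsStdPair P X Y ρ) :
    P.map (fun ω => (X ω, Y ω)) = (stdNormal.prod stdNormal).map (correlate ρ) := by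
  have hprob := h.gaussian.isProbabilityMeasure
  have h' := isStdPair_correlate h.sq_le_one
  refine Measure.ext_of_charFunDual ?_
  ext L
  rw [h.charFunDual_eq]
  exact (h'.charFunDual_eq L).symm

lemma IsStdPair.map_fst {ρ : ℝ} (h : IsStdPair P X Y ρ) : P.map X = stdNormal := by
  have hg : HasGaussianLaw X P := h.gaussian.map_fun (ContinuousLinearMap.fst ℝ ℝ ℝ)
  rw [hg.map_eq_gaussianReal, variance_of_integral_eq_zero hg.aemeasurable h.mean_fst, h.mean_fst,
    h.sq_fst, Real.toNNReal_one]

lemma IsStdPair.symm {ρ : ℝ} (h : IsStdPair P X Y ρ) : IsStdPair P Y X ρ where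
  gaussian := h.gaussian.map_fun
    ((ContinuousLinearMap.snd ℝ ℝ ℝ).prod (ContinuousLinearMap.fst ℝ ℝ ℝ))
  mean_fst := h.mean_snd
  mean_snd := h.mean_fst
  sq_fst := h.sq_snd
  sq_snd := h.sq_fst
  mul := by simpa only [mul_comm] using h.mul

lemma IsStdPair.integral_comp {ρ : ℝ} (h : IsStdPair P X Y ρ) {F : ℝ × ℝ → ℝ}
    (hF : Measurable F) :
    ∫ ω, F (X ω, Y ω) ∂P = ∫ p, F (correlate ρ p) ∂stdNormal.prod stdNormal := by
  rw [← integral_map h.gaussian.aemeasurable hF.aestronglyMeasurable, h.map_eq,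
    integral_map (continuous_correlate ρ).aemeasurable hF.aestronglyMeasurable]

/-- Mehler's formula in degree three. -/
lemma IsStdPair.integral_mul_H3 {ρ : ℝ} (h : IsStdPair P X Y ρ) {F : ℝ → ℝ} (hF : Measurable F)
    (hF2 : MemLp F 2 stdNormal) :
    ∫ ω, F (X ω) * H3 (Y ω) ∂P = ρ ^ 3 * ∫ x, F x * H3 x ∂stdNormal := by
  have h' := isStdPair_correlate h.sq_le_one
  have hs : √(1 - ρ ^ 2) ^ 2 = 1 - ρ ^ 2 := Real.sq_sqrt (by linarith [h.sq_le_one])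
  have hint : Integrable (fun p : ℝ × ℝ => F (correlate ρ p).1 * H3 (correlate ρ p).2)
      (stdNormal.prod stdNormal) := by
    have m1 : MemLp (fun p : ℝ × ℝ => F (correlate ρ p).1) 2 (stdNormal.prod stdNormal) :=
      MemLp.comp_of_map (by rw [h'.map_fst]; exact hF2)
        (continuous_correlate ρ).fst.aemeasurable
    have m2 : MemLp (fun p : ℝ × ℝ => H3 (correlate ρ p).2) 2 (stdNormal.prod stdNormal) :=
      MemLp.comp_of_map (g := H3) (f := fun p : ℝ × ℝ => (correlate ρ p).2)
        (by rw [h'.symm.map_fst]; exact memLp_H3)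
        (continuous_correlate ρ).snd.aemeasurable
    exact m1.integrable_mul m2
  rw [h.integral_comp (F := fun p => F p.1 * H3 p.2)
    ((hF.comp measurable_fst).mul (continuous_H3.measurable.comp measurable_snd)),
    integral_prod _ hint, ← integral_const_mul]
  congr 1
  ext x
  -- Expanding in powers of the independent variable `w` and integrating it out leaves `ρ³ x³ - 3ρ x
  -- + 3ρ x (1 - ρ²) = ρ³ H₃(x)`.
  have e : ∀ w, H3 (ρ * x + √(1 - ρ ^ 2) * w) = ρ ^ 3 * x ^ 3 - 3 * ρ * x +
      (3 * ρ ^ 2 * x ^ 2 * √(1 - ρ ^ 2) - 3 * √(1 - ρ ^ 2)) * w ^ 1 +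
      3 * ρ * x * √(1 - ρ ^ 2) ^ 2 * w ^ 2 + √(1 - ρ ^ 2) ^ 3 * w ^ 3 := fun w => by
    unfold H3
    ring
  have m2 : ∫ x, x ^ 2 ∂stdNormal = 1 := by
    rw [moment_stdNormal, halfMoment_add_two 0, halfMoment_zero, Real.sq_sqrt zero_le_two]
    have hpi : √Real.pi ≠ 0 := (Real.sqrt_pos.mpr Real.pi_pos).ne'
    field_simp
    norm_num
  simp only [correlate]
  rw [integral_const_mul]
  simp only [e]
  have i (k : ℕ) (c : ℝ) : Integrable (fun w : ℝ => c * w ^ k) stdNormal :=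
    (integrable_pow_stdNormal k).const_mul c
  have i0 (c : ℝ) : Integrable (fun _ : ℝ => c) stdNormal := integrable_const c
  rw [integral_add, integral_add, integral_add (i0 _) (i 1 _),
    integral_const_mul, integral_const_mul, integral_const_mul, m2, moment_stdNormal 1,
    moment_stdNormal 3, hs]
  · unfold H3
    simp
    ring
  · exact (i0 _).add (i 1 _)
  · exact i 2 _
  · exact ((i0 _).add (i 1 _)).add (i 2 _)
  · exact i 3 _

end Pair

/-! ### Sheppard's formula in polar coordinates -/

section Sector

/-- With `a = arcsin ρ` the second linear form is `sin(a + θ)`, so both are nonnegative exactly for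
`θ ∈ [-a, π/2]`, up to a null set. -/
lemma sector_volume {ρ : ℝ} (hρ : ρ ^ 2 ≤ 1) :
    ∫ θ in Set.Ioo (-Real.pi) Real.pi,
      halfLine (Real.cos θ) * halfLine (ρ * Real.cos θ + √(1 - ρ ^ 2) * Real.sin θ) =
      Real.pi / 2 + Real.arcsin ρ := by
  have hpi := Real.pi_pos
  obtain ⟨h1, h2⟩ := abs_le.mp ((sq_le_one_iff_abs_le_one ρ).mp hρ)
  set a := Real.arcsin ρ with ha
  have ha1 : -(Real.pi / 2) ≤ a := Real.neg_pi_div_two_le_arcsin ρ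
  have ha2 : a ≤ Real.pi / 2 := Real.arcsin_le_pi_div_two ρ
  have hsin : Real.sin a = ρ := Real.sin_arcsin h1 h2
  have hcos : Real.cos a = √(1 - ρ ^ 2) := Real.cos_arcsin ρ
  have hae : ∀ᵐ θ : ℝ, θ ∈ Set.Ioo (-Real.pi) Real.pi →
      halfLine (Real.cos θ) * halfLine (ρ * Real.cos θ + √(1 - ρ ^ 2) * Real.sin θ) =
        (Set.Icc (-a) (Real.pi / 2)).indicator (fun _ => (1 : ℝ)) θ := by
    -- For `a = -π/2` both factors equal `1` at `θ = -π/2`, outside the interval; this single angle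
    -- is discarded.
    have hne : ∀ᵐ θ : ℝ, θ ≠ -(Real.pi / 2) := by simp [ae_iff, measure_singleton]
    filter_upwards [hne] with θ hθ hmem
    have hadd : ρ * Real.cos θ + √(1 - ρ ^ 2) * Real.sin θ = Real.sin (a + θ) := by
      rw [Real.sin_add, hsin, hcos]
    rw [hadd]
    by_cases hm : θ ∈ Set.Icc (-a) (Real.pi / 2)
    · rw [Set.indicator_of_mem hm]
      have c1 : 0 ≤ Real.cos θ := Real.cos_nonneg_of_mem_Icc ⟨by linarith [hm.1], hm.2⟩
      have c2 : 0 ≤ Real.sin (a + θ) :=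
        Real.sin_nonneg_of_nonneg_of_le_pi (by linarith [hm.1]) (by linarith [hm.2])
      simp [halfLine, c1, c2]
    · rw [Set.indicator_of_notMem hm]
      rcases lt_or_ge (Real.cos θ) 0 with hc | hc
      · simp [halfLine, hc.not_ge]
      · have b1 : θ ≤ Real.pi / 2 := by
          by_contra hb
          push Not at hb
          have := Real.cos_neg_of_pi_div_two_lt_of_lt hb (by linarith [hmem.2])
          linarith
        have b2 : -(Real.pi / 2) ≤ θ := by
          by_contra hb
          push Not at hb
          have := Real.cos_neg_of_pi_div_two_lt_of_lt (x := -θ) (by linarith)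
            (by linarith [hmem.1])
          rw [Real.cos_neg] at this
          linarith
        have b2' : -(Real.pi / 2) < θ := lt_of_le_of_ne b2 (Ne.symm hθ)
        have b3 : θ < -a := by
          by_contra hb
          exact hm ⟨not_lt.mp hb, b1⟩
        have c2 : Real.sin (a + θ) < 0 :=
          Real.sin_neg_of_neg_of_neg_pi_lt (by linarith) (by linarith)
        simp [halfLine, c2.not_ge]
  rw [setIntegral_congr_ae measurableSet_Ioo hae, setIntegral_indicator measurableSet_Icc,
    setIntegral_const, smul_eq_mul, mul_one, measureReal_def]
  have hv : volume (Set.Ioo (-Real.pi) Real.pi ∩ Set.Icc (-a) (Real.pi / 2)) =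
      ENNReal.ofReal (Real.pi / 2 + a) := by
    have hsub : Set.Icc (-a) (Real.pi / 2) ⊆ Set.Ioo (-Real.pi) Real.pi :=
      fun θ hθ => ⟨by linarith [hθ.1], by linarith [hθ.2]⟩
    rw [Set.inter_eq_right.mpr hsub, Real.volume_Icc]
    congr 1
    ring
  rw [hv, ENNReal.toReal_ofReal (by linarith)]

lemma halfLine_mul {r : ℝ} (hr : 0 < r) (x : ℝ) : halfLine (r * x) = halfLine x := by
  simp [halfLine, mul_nonneg_iff_of_pos_left hr]

lemma integral_radial : ∫ r in Set.Ioi (0 : ℝ), r * Real.exp (-r ^ 2 / 2) = 1 := by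
  have h2 : (0 : ℝ) < √2 := by positivity
  have hs := integral_comp_mul_left_Ioi (fun x : ℝ => x * Real.exp (-x ^ 2 / 2)) 0 h2
  have e : ∀ x : ℝ, (√2 * x) * Real.exp (-(√2 * x) ^ 2 / 2) =
      √2 * (x ^ 1 * Real.exp (-x ^ 2)) := fun x => by
    rw [mul_pow √2 x 2, Real.sq_sqrt zero_le_two, mul_assoc, pow_one]
    congr 3
    ring
  rw [mul_zero] at hs
  simp only [e] at hs
  rw [integral_const_mul, smul_eq_mul, ← halfMoment, halfMoment_one] at hs
  rw [eq_inv_mul_iff_mul_eq₀ h2.ne', ← mul_assoc, Real.mul_self_sqrt zero_le_two] at hs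
  linarith

/-- Sheppard's quadrant formula. -/
lemma quadrant {ρ : ℝ} (hρ : ρ ^ 2 ≤ 1) :
    ∫ p, halfLine (correlate ρ p).1 * halfLine (correlate ρ p).2 ∂stdNormal.prod stdNormal =
      1 / 4 + Real.arcsin ρ / (2 * Real.pi) := by
  have hpi := Real.pi_pos
  let g : ℝ × ℝ → ℝ := fun p => halfLine (correlate ρ p).1 * halfLine (correlate ρ p).2
  have hgm : Measurable g :=
    (measurable_halfLine.comp (continuous_correlate ρ).fst.measurable).mul
      (measurable_halfLine.comp (continuous_correlate ρ).snd.measurable)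
  have hg1 : ∀ p, ‖g p‖ ≤ 1 := fun p => by
    have a := halfLine_mem (correlate ρ p).1
    have b := halfLine_mem (correlate ρ p).2
    rw [Real.norm_eq_abs, abs_of_nonneg (mul_nonneg a.1 b.1)]
    exact mul_le_one₀ a.2 b.1 b.2
  have hgi : Integrable g (stdNormal.prod stdNormal) :=
    Integrable.of_bound hgm.aestronglyMeasurable 1 (Eventually.of_forall hg1)
  have hE : Integrable (fun x : ℝ => Real.exp (-x ^ 2 / 2)) := by
    have := integrable_exp_neg_mul_sq (b := 1 / 2) (by norm_num)
    refine this.congr (Eventually.of_forall fun x => ?_)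
    simp only
    congr 1
    ring
  have hGi : Integrable (fun p : ℝ × ℝ =>
      g p * (Real.exp (-p.1 ^ 2 / 2) * Real.exp (-p.2 ^ 2 / 2))) :=
    (hE.mul_prod hE).bdd_mul hgm.aestronglyMeasurable (Eventually.of_forall hg1)
  have h1 : ∫ p, g p ∂stdNormal.prod stdNormal = (2 * Real.pi)⁻¹ *
      ∫ p : ℝ × ℝ, g p * (Real.exp (-p.1 ^ 2 / 2) * Real.exp (-p.2 ^ 2 / 2)) := by
    rw [integral_prod _ hgi, Measure.volume_eq_prod, integral_prod _ hGi, integral_stdNormal]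
    simp only [integral_stdNormal]
    have hsq : (2 * Real.pi)⁻¹ = (√(2 * Real.pi))⁻¹ * (√(2 * Real.pi))⁻¹ := by
      rw [← mul_inv, Real.mul_self_sqrt (by positivity)]
    rw [hsq, mul_assoc]
    congr 1
    rw [← integral_const_mul]
    congr 1
    ext x
    rw [mul_assoc, ← integral_mul_const]
    congr 2
    ext y
    ring
  -- The indicators are invariant under positive scaling, so the polar integral factors into a
  -- radial part equal to `1` and the angular length.
  have h2 : ∫ p : ℝ × ℝ, g p * (Real.exp (-p.1 ^ 2 / 2) * Real.exp (-p.2 ^ 2 / 2)) =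
      Real.pi / 2 + Real.arcsin ρ := by
    have ht : polarCoord.target = Set.Ioi (0 : ℝ) ×ˢ Set.Ioo (-Real.pi) Real.pi := rfl
    have hprod := setIntegral_prod_mul (μ := volume) (ν := volume)
      (fun r : ℝ => r * Real.exp (-r ^ 2 / 2))
      (fun θ => halfLine (Real.cos θ) * halfLine (ρ * Real.cos θ + √(1 - ρ ^ 2) * Real.sin θ))
      (Set.Ioi 0) (Set.Ioo (-Real.pi) Real.pi)
    rw [integral_radial, one_mul, sector_volume hρ, ← Measure.volume_eq_prod] at hprod
    rw [← integral_comp_polarCoord_symm, ← hprod, ht]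
    refine setIntegral_congr_fun (measurableSet_Ioi.prod measurableSet_Ioo) fun p hp => ?_
    have hr : 0 < p.1 := hp.1
    simp only [polarCoord_symm_apply, g, correlate, smul_eq_mul]
    rw [show ρ * (p.1 * Real.cos p.2) + √(1 - ρ ^ 2) * (p.1 * Real.sin p.2) =
      p.1 * (ρ * Real.cos p.2 + √(1 - ρ ^ 2) * Real.sin p.2) by ring, halfLine_mul hr,
      halfLine_mul hr, ← Real.exp_add]
    have : -(p.1 * Real.cos p.2) ^ 2 / 2 + -(p.1 * Real.sin p.2) ^ 2 / 2 = -p.1 ^ 2 / 2 := by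
      have := Real.sin_sq_add_cos_sq p.2
      linear_combination (-p.1 ^ 2 / 2) * this
    rw [this]
    ring
  change ∫ p, g p ∂stdNormal.prod stdNormal = _
  rw [h1, h2]
  field_simp
  ring

end Sector

/-! ### Covariances of the indicator and of its remainder -/

/-- The centred indicator of the half line. -/
def centredSign (x : ℝ) : ℝ := halfLine x - 1 / 2

/-- The centred indicator of the half line, minus its projection on the third Hermite polynomial. -/
def signRemainder (x : ℝ) : ℝ := centredSign x + 1 / (6 * √(2 * Real.pi)) * H3 x

section PairMoments

variable {Ω : Type*} [MeasurableSpace Ω] {P : Measure Ω} {X Y : Ω → ℝ} {ρ : ℝ}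

lemma measurable_centredSign : Measurable centredSign := measurable_halfLine.sub_const _

lemma measurable_signRemainder : Measurable signRemainder :=
  measurable_centredSign.add (continuous_H3.measurable.const_mul _)

lemma abs_centredSign_le (x : ℝ) : |centredSign x| ≤ 1 := by
  have := halfLine_mem x
  rw [abs_le]
  unfold centredSign
  constructor <;> linarith [this.1, this.2]

lemma memLp_centredSign : MemLp centredSign 2 stdNormal :=
  MemLp.of_bound measurable_centredSign.aestronglyMeasurable 1
    (Eventually.of_forall abs_centredSign_le)

lemma memLp_signRemainder : MemLp signRemainder 2 stdNormal :=
  memLp_centredSign.add (memLp_H3.const_mul _)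

lemma integral_centredSign : ∫ x, centredSign x ∂stdNormal = 0 := by
  unfold centredSign
  rw [integral_sub _ (integrable_const _), integral_halfLine]
  · simp
  · exact Integrable.of_bound measurable_halfLine.aestronglyMeasurable 1
      (Eventually.of_forall fun x => by
        rw [Real.norm_eq_abs, abs_of_nonneg (halfLine_mem x).1]; exact (halfLine_mem x).2)

lemma integral_centredSign_mul_H3 :
    ∫ x, centredSign x * H3 x ∂stdNormal = -(1 / √(2 * Real.pi)) := by
  simp only [centredSign, sub_mul]
  rw [integral_sub (integrable_halfLine_mul integrable_H3) (integrable_H3.const_mul _),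
    integral_halfLine_mul_H3, integral_const_mul, integral_H3]
  ring

lemma IsStdPair.integral_fst (h : IsStdPair P X Y ρ) {F : ℝ → ℝ} (hF : Measurable F) :
    ∫ ω, F (X ω) ∂P = ∫ x, F x ∂stdNormal := by
  have hg : HasGaussianLaw X P := h.gaussian.map_fun (ContinuousLinearMap.fst ℝ ℝ ℝ)
  rw [← h.map_fst, integral_map hg.aemeasurable hF.aestronglyMeasurable]

lemma IsStdPair.integral_centredSign (h : IsStdPair P X Y ρ) :
    ∫ ω, centredSign (X ω) * centredSign (Y ω) ∂P = Real.arcsin ρ / (2 * Real.pi) := by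
  have hprob := h.gaussian.isProbabilityMeasure
  have hX : AEMeasurable X P := (h.gaussian.map_fun (ContinuousLinearMap.fst ℝ ℝ ℝ)).aemeasurable
  have hY : AEMeasurable Y P := (h.gaussian.map_fun (ContinuousLinearMap.snd ℝ ℝ ℝ)).aemeasurable
  have hb : ∀ x, ‖halfLine x‖ ≤ 1 := fun x => by
    rw [Real.norm_eq_abs, abs_of_nonneg (halfLine_mem x).1]
    exact (halfLine_mem x).2
  have i1 : Integrable (fun ω => halfLine (X ω)) P :=
    Integrable.of_bound (measurable_halfLine.comp_aemeasurable hX).aestronglyMeasurable 1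
      (Eventually.of_forall fun ω => hb _)
  have i2 : Integrable (fun ω => halfLine (Y ω)) P :=
    Integrable.of_bound (measurable_halfLine.comp_aemeasurable hY).aestronglyMeasurable 1
      (Eventually.of_forall fun ω => hb _)
  have i12 : Integrable (fun ω => halfLine (X ω) * halfLine (Y ω)) P :=
    i2.bdd_mul i1.aestronglyMeasurable (Eventually.of_forall fun ω => hb _)
  have e : ∀ ω, centredSign (X ω) * centredSign (Y ω) = halfLine (X ω) * halfLine (Y ω) -
      1 / 2 * halfLine (X ω) - 1 / 2 * halfLine (Y ω) + 1 / 4 := fun ω => by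
    unfold centredSign
    ring
  simp only [e]
  rw [integral_add, integral_sub, integral_sub i12 (i1.const_mul _),
    integral_const_mul, integral_const_mul, h.integral_fst measurable_halfLine,
    h.symm.integral_fst measurable_halfLine, integral_halfLine,
    h.integral_comp (F := fun p => halfLine p.1 * halfLine p.2)
      ((measurable_halfLine.comp measurable_fst).mul (measurable_halfLine.comp measurable_snd)),
    quadrant h.sq_le_one]
  · simp
    ring
  · exact i12.sub (i1.const_mul _)
  · exact i2.const_mul _
  · exact (i12.sub (i1.const_mul _)).sub (i2.const_mul _)
  · exact integrable_const _

/-- By Mehler's formula each of the two cross terms contributes `-ρ³/(12π)` and the square of the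
`H₃` part contributes `+ρ³/(12π)`, using `E[H₃²] = 6`. -/
lemma IsStdPair.integral_signRemainder (h : IsStdPair P X Y ρ) :
    ∫ ω, signRemainder (X ω) * signRemainder (Y ω) ∂P =
      Real.arcsin ρ / (2 * Real.pi) - ρ ^ 3 / (12 * Real.pi) := by
  have hpi := Real.pi_pos
  have hX : AEMeasurable X P := (h.gaussian.map_fun (ContinuousLinearMap.fst ℝ ℝ ℝ)).aemeasurable
  have hY : AEMeasurable Y P := (h.gaussian.map_fun (ContinuousLinearMap.snd ℝ ℝ ℝ)).aemeasurable
  have compX {F : ℝ → ℝ} (hF : MemLp F 2 stdNormal) : MemLp (fun ω => F (X ω)) 2 P :=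
    MemLp.comp_of_map (by rw [h.map_fst]; exact hF) hX
  have compY {F : ℝ → ℝ} (hF : MemLp F 2 stdNormal) : MemLp (fun ω => F (Y ω)) 2 P :=
    MemLp.comp_of_map (by rw [h.symm.map_fst]; exact hF) hY
  set c := 1 / (6 * √(2 * Real.pi)) with hc
  have e : ∀ ω, signRemainder (X ω) * signRemainder (Y ω) =
      centredSign (X ω) * centredSign (Y ω) + c * (centredSign (X ω) * H3 (Y ω)) +
        c * (centredSign (Y ω) * H3 (X ω)) + c ^ 2 * (H3 (X ω) * H3 (Y ω)) := fun ω => by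
    unfold signRemainder
    ring
  have i1 := (compX memLp_centredSign).integrable_mul (compY memLp_centredSign)
  have i2 := ((compX memLp_centredSign).integrable_mul (compY memLp_H3)).const_mul c
  have i3 := ((compY memLp_centredSign).integrable_mul (compX memLp_H3)).const_mul c
  have i4 := ((compX memLp_H3).integrable_mul (compY memLp_H3)).const_mul (c ^ 2)
  simp only [e]
  rw [integral_add, integral_add, integral_add, integral_const_mul, integral_const_mul,
    integral_const_mul, h.integral_centredSign,
    h.integral_mul_H3 measurable_centredSign memLp_centredSign,
    h.symm.integral_mul_H3 measurable_centredSign memLp_centredSign,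
    h.integral_mul_H3 continuous_H3.measurable memLp_H3, integral_H3_sq,
    integral_centredSign_mul_H3]
  rotate_left
  · exact i1
  · exact i2
  · exact i1.add i2
  · exact i3
  · exact (i1.add i2).add i3
  · exact i4
  have hs : √(2 * Real.pi) ^ 2 = 2 * Real.pi := Real.sq_sqrt (by positivity)
  have hs0 : √(2 * Real.pi) ≠ 0 := by positivity
  have e1 : c * (ρ ^ 3 * -(1 / √(2 * Real.pi))) = -(ρ ^ 3 / (12 * Real.pi)) := by
    have : c * (1 / √(2 * Real.pi)) = 1 / (12 * Real.pi) := by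
      rw [hc, one_div_mul_one_div, mul_assoc, ← sq, hs]
      congr 1
      ring
    linear_combination (-ρ ^ 3) * this
  have e2 : c ^ 2 * (ρ ^ 3 * 6) = ρ ^ 3 / (12 * Real.pi) := by
    rw [hc, div_pow, mul_pow, hs]
    field_simp
    ring
  rw [e1, e2]
  ring

end PairMoments

/-! ### Second moments of integrated random fields -/

section SecondMoment

variable {Ω α α' : Type*} [MeasurableSpace Ω] [MeasurableSpace α] [MeasurableSpace α']
  {P : Measure Ω}

/-- An arithmetic–geometric form of the Cauchy–Schwarz inequality, strong enough for the spectral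
bounds below. -/
lemma two_mul_integral_mul_le {a b : Ω → ℝ} (hab : Integrable (fun ω => a ω * b ω) P)
    (ha : Integrable (fun ω => a ω * a ω) P) (hb : Integrable (fun ω => b ω * b ω) P) :
    2 * |∫ ω, a ω * b ω ∂P| ≤ ∫ ω, a ω * a ω ∂P + ∫ ω, b ω * b ω ∂P := by
  rw [← integral_add ha hb]
  have h1 : |∫ ω, a ω * b ω ∂P| ≤ ∫ ω, |a ω * b ω| ∂P := abs_integral_le_integral_abs
  have h2 : ∫ ω, 2 * |a ω * b ω| ∂P ≤ ∫ ω, (a ω * a ω + b ω * b ω) ∂P := by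
    refine integral_mono (hab.norm.const_mul 2) (ha.add hb) fun ω => ?_
    simp only [abs_mul]
    nlinarith [sq_nonneg (|a ω| - |b ω|), sq_abs (a ω), sq_abs (b ω)]
  rw [integral_const_mul] at h2
  linarith

variable [IsProbabilityMeasure P]

lemma integrable_prod_of_bounded_moment {m : Measure α} [IsFiniteMeasure m] {F : Ω × α → ℝ}
    (hF : Measurable F) (hint : ∀ p, Integrable (fun ω => F (ω, p)) P) {C : ℝ}
    (hC : ∀ p, ∫ ω, |F (ω, p)| ∂P ≤ C) : Integrable F (P.prod m) := by
  rw [integrable_prod_iff' hF.aestronglyMeasurable]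
  refine ⟨Eventually.of_forall hint, ?_⟩
  refine Integrable.of_bound (hF.norm.aestronglyMeasurable.prod_swap.integral_prod_right') C
    (Eventually.of_forall fun p => ?_)
  rw [Real.norm_of_nonneg (integral_nonneg fun ω => norm_nonneg _)]
  exact hC p

/-- A random field with uniformly bounded second moments. -/
structure BoundedSecondMoment (P : Measure Ω) (F : Ω × α → ℝ) (C : ℝ) : Prop where
  measurable : Measurable F
  memLp : ∀ p, MemLp (fun ω => F (ω, p)) 2 P
  le : ∀ p, ∫ ω, F (ω, p) ^ 2 ∂P ≤ C

variable {F : Ω × α → ℝ} {G : Ω × α' → ℝ} {C D : ℝ}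

lemma BoundedSecondMoment.integrable_mul (hF : BoundedSecondMoment P F C)
    (hG : BoundedSecondMoment P G D) (m : Measure α) (m' : Measure α') [IsFiniteMeasure m]
    [IsFiniteMeasure m'] :
    Integrable (fun z : Ω × (α × α') => F (z.1, z.2.1) * G (z.1, z.2.2)) (P.prod (m.prod m')) := by
  have hi (p : α × α') : Integrable (fun ω => F (ω, p.1) * G (ω, p.2)) P :=
    (hF.memLp p.1).integrable_mul (hG.memLp p.2)
  refine integrable_prod_of_bounded_moment (C := C + D)
    ((hF.measurable.comp (by fun_prop)).mul (hG.measurable.comp (by fun_prop))) hi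
    fun p => ?_
  have h1 := (hF.memLp p.1).integrable_sq
  have h2 := (hG.memLp p.2).integrable_sq
  calc ∫ ω, |F (ω, p.1) * G (ω, p.2)| ∂P ≤ ∫ ω, (F (ω, p.1) ^ 2 + G (ω, p.2) ^ 2) ∂P := by
        refine integral_mono (hi p).norm (h1.add h2) fun ω => ?_
        simp only [abs_mul]
        nlinarith [sq_nonneg (|F (ω, p.1)| - |G (ω, p.2)|), sq_abs (F (ω, p.1)),
          sq_abs (G (ω, p.2)), sq_nonneg (F (ω, p.1)), sq_nonneg (G (ω, p.2))]
    _ = ∫ ω, F (ω, p.1) ^ 2 ∂P + ∫ ω, G (ω, p.2) ^ 2 ∂P := integral_add h1 h2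
    _ ≤ C + D := add_le_add (hF.le _) (hG.le _)

lemma BoundedSecondMoment.integrable (hF : BoundedSecondMoment P F C) (m : Measure α)
    [IsFiniteMeasure m] : Integrable F (P.prod m) := by
  have hone : BoundedSecondMoment P (fun _ : Ω × Unit => (1 : ℝ)) 1 :=
    ⟨measurable_const, fun _ => memLp_const 1, fun _ => by simp⟩
  refine integrable_prod_of_bounded_moment (C := C + 1) hF.measurable
    (fun p => (hF.memLp p).integrable one_le_two) fun p => ?_
  have h1 := (hF.memLp p).integrable_sq
  calc ∫ ω, |F (ω, p)| ∂P ≤ ∫ ω, (F (ω, p) ^ 2 + 1) ∂P := by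
        refine integral_mono ((hF.memLp p).integrable one_le_two).norm
          (h1.add (integrable_const _)) fun ω => ?_
        simp only
        nlinarith [sq_abs (F (ω, p)), sq_nonneg (|F (ω, p)| - 1)]
    _ = ∫ ω, F (ω, p) ^ 2 ∂P + 1 := by
        rw [integral_add h1 (integrable_const _)]
        simp
    _ ≤ C + 1 := by linarith [hF.le p]

lemma BoundedSecondMoment.integrable_integral_mul (hF : BoundedSecondMoment P F C)
    (hG : BoundedSecondMoment P G D) (m : Measure α) (m' : Measure α') [IsFiniteMeasure m]
    [IsFiniteMeasure m'] :
    Integrable (fun ω => (∫ p, F (ω, p) ∂m) * ∫ q, G (ω, q) ∂m') P := by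
  have h := (hF.integrable_mul hG m m').integral_prod_left
  refine h.congr (Eventually.of_forall fun ω => ?_)
  exact integral_prod_mul (fun p => F (ω, p)) (fun q => G (ω, q))

/-- Fubini's theorem, justified by the uniform second moment bounds on finite measure spaces:
covariances of integrated fields become integrals of covariances. -/
lemma BoundedSecondMoment.integral_mul (hF : BoundedSecondMoment P F C)
    (hG : BoundedSecondMoment P G D) (m : Measure α) (m' : Measure α') [IsFiniteMeasure m]
    [IsFiniteMeasure m'] :
    ∫ ω, (∫ p, F (ω, p) ∂m) * (∫ q, G (ω, q) ∂m') ∂P =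
      ∫ p, ∫ q, ∫ ω, F (ω, p) * G (ω, q) ∂P ∂m' ∂m := by
  have h := hF.integrable_mul hG m m'
  calc _ = ∫ ω, ∫ z : α × α', F (ω, z.1) * G (ω, z.2) ∂(m.prod m') ∂P := by
        congr 1
        ext ω
        exact (integral_prod_mul (fun p => F (ω, p)) (fun q => G (ω, q))).symm
    _ = ∫ z : α × α', ∫ ω, F (ω, z.1) * G (ω, z.2) ∂P ∂(m.prod m') :=
        integral_integral_swap h
    _ = _ := integral_prod _ h.integral_prod_right

end SecondMoment

/-! ### Positivity of the spectrum and the Legendre expansion -/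

section Spectrum

variable {Ω : Type*} [MeasurableSpace Ω] {P : Measure Ω} {Z : S2 × ℝ → Ω → ℝ} {Γ : ℝ → ℝ → ℝ}

lemma IsSphereTimeField.isStdPair (hZ : IsSphereTimeField P Z Γ) (p q : S2 × ℝ) :
    IsStdPair P (Z p) (Z q) (Γ (inner ℝ p.1.1 q.1.1) (p.2 - q.2)) where
  gaussian := hZ.gaussian.hasGaussianLaw_prodMk
  mean_fst := hZ.centred p
  mean_snd := hZ.centred q
  sq_fst := hZ.unit_variance p
  sq_snd := hZ.unit_variance q
  mul := hZ.covariance p.1 q.1 p.2 q.2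

lemma IsSphereTimeField.boundedSecondMoment (hZ : IsSphereTimeField P Z Γ) {f : ℝ → ℝ}
    (hf : Measurable f) (hf2 : MemLp f 2 stdNormal) :
    BoundedSecondMoment P (fun z : Ω × (S2 × ℝ) => f (Z z.2 z.1)) (∫ x, f x ^ 2 ∂stdNormal) := by
  refine ⟨hf.comp hZ.measurable, fun p => ?_, fun p => ?_⟩
  · have h := hZ.isStdPair p p
    refine MemLp.comp_of_map (g := f) (f := Z p) ?_
      (h.gaussian.map_fun (ContinuousLinearMap.fst ℝ ℝ ℝ)).aemeasurable
    rw [h.map_fst]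
    exact hf2
  · exact ((hZ.isStdPair p p).integral_fst (F := fun x => f x ^ 2) (hf.pow_const 2)).le

/-- The weighted field at a fixed time has bounded second moments. -/
lemma IsSphereTimeField.boundedSecondMoment_weight (hZ : IsSphereTimeField P Z Γ) {w : S2 → ℝ}
    (hw : Continuous w) (t : ℝ) :
    ∃ C, BoundedSecondMoment P (fun z : Ω × S2 => w z.2 * Z (z.2, t) z.1) C := by
  obtain ⟨B, hB⟩ := isCompact_univ.exists_bound_of_continuousOn hw.continuousOn
  have hL (p : S2 × ℝ) : MemLp (Z p) 2 P :=
    ((hZ.isStdPair p p).gaussian.map_fun (ContinuousLinearMap.fst ℝ ℝ ℝ)).memLp_two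
  refine ⟨B ^ 2, ?_, fun x => (hL (x, t)).const_mul (w x), fun x => ?_⟩
  · refine (hw.measurable.comp measurable_snd).mul ?_
    exact hZ.measurable.comp (measurable_fst.prodMk (measurable_snd.prodMk measurable_const))
  · simp only [mul_pow]
    rw [integral_const_mul, hZ.unit_variance, mul_one]
    have := hB x (Set.mem_univ x)
    rw [Real.norm_eq_abs] at this
    exact sq_le_sq' (by linarith [abs_le.mp this]) (abs_le.mp this).2

variable [IsProbabilityMeasure P]

lemma IsSphereTimeField.integral_weight_mul (hZ : IsSphereTimeField P Z Γ) {w v : S2 → ℝ}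
    (hw : Continuous w) (hv : Continuous v) (t s : ℝ) :
    ∫ ω, (∫ x, w x * Z (x, t) ω ∂area) * (∫ y, v y * Z (y, s) ω ∂area) ∂P =
      ∫ x, w x * ∫ y, Γ (inner ℝ x.1 y.1) (t - s) * v y ∂area ∂area := by
  obtain ⟨C, hC⟩ := hZ.boundedSecondMoment_weight hw t
  obtain ⟨D, hD⟩ := hZ.boundedSecondMoment_weight hv s
  rw [hC.integral_mul hD area area]
  congr 1
  ext x
  rw [← integral_const_mul]
  congr 1
  ext y
  rw [← hZ.covariance, ← integral_mul_const, ← integral_const_mul]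
  congr 1
  ext ω
  ring

lemma IsSphereTimeField.integrable_weight_mul (hZ : IsSphereTimeField P Z Γ) {w v : S2 → ℝ}
    (hw : Continuous w) (hv : Continuous v) (t s : ℝ) :
    Integrable (fun ω => (∫ x, w x * Z (x, t) ω ∂area) * ∫ y, v y * Z (y, s) ω ∂area) P := by
  obtain ⟨C, hC⟩ := hZ.boundedSecondMoment_weight hw t
  obtain ⟨D, hD⟩ := hZ.boundedSecondMoment_weight hv s
  exact hC.integrable_integral_mul hD area area

/-- The coefficient of `P_ℓ` in the Legendre expansion of `Γ(·, τ)`. -/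
def expansionCoeff (Γ : ℝ → ℝ → ℝ) (ℓ : ℕ) (τ : ℝ) : ℝ :=
  (2 * ℓ + 1) / (4 * Real.pi) * powerSpectrum Γ ℓ τ

/-- The north pole. -/
def pole : S2 := ⟨EuclideanSpace.single 2 1, by simp⟩

@[fun_prop]
lemma continuous_legendre_pole (ℓ : ℕ) :
    Continuous fun x : S2 => (legendre ℓ).eval (inner ℝ pole.1 x.1) := by
  fun_prop

lemma inner_self_sphere (x : S2) : inner ℝ x.1 x.1 = (1 : ℝ) := by
  rw [real_inner_self_eq_norm_sq, norm_eq_of_mem_sphere, one_pow]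

lemma continuous_section (hΓ : Continuous fun q : ℝ × ℝ => Γ q.1 q.2) (τ : ℝ) :
    Continuous fun θ => Γ θ τ := hΓ.comp (continuous_id.prodMk continuous_const)

lemma funk_hecke_field (hΓ : Continuous fun q : ℝ × ℝ => Γ q.1 q.2) (ℓ : ℕ) (τ : ℝ) (x e : S2) :
    ∫ y : S2, Γ (inner ℝ x.1 y.1) τ * (legendre ℓ).eval (inner ℝ e.1 y.1) ∂area =
      powerSpectrum Γ ℓ τ * (legendre ℓ).eval (inner ℝ x.1 e.1) :=
  funk_hecke (continuous_section hΓ τ) ℓ x e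

/-- Funk–Hecke evaluates the inner integral and the reproducing property the outer one.
Nonnegativity of `C_ℓ(0)` and `|C_ℓ(τ)| ≤ C_ℓ(0)` follow, as for any stationary covariance. -/
lemma IsSphereTimeField.harmonic_covariance (hZ : IsSphereTimeField P Z Γ)
    (hΓ : Continuous fun q : ℝ × ℝ => Γ q.1 q.2) (ℓ : ℕ) (t s : ℝ) :
    ∫ ω, (∫ x, (legendre ℓ).eval (inner ℝ pole.1 x.1) * Z (x, t) ω ∂area) *
      (∫ y, (legendre ℓ).eval (inner ℝ pole.1 y.1) * Z (y, s) ω ∂area) ∂P =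
      powerSpectrum Γ ℓ (t - s) * (4 * Real.pi / (2 * ℓ + 1)) := by
  rw [hZ.integral_weight_mul (continuous_legendre_pole ℓ) (continuous_legendre_pole ℓ)]
  simp only [funk_hecke_field hΓ]
  have h := legendre_reproducing ℓ pole pole
  rw [inner_self_sphere, legendre_eval_one, mul_one] at h
  rw [← h, ← integral_const_mul]
  congr 1
  ext x
  rw [real_inner_comm x.1]
  ring

lemma IsSphereTimeField.powerSpectrum_nonneg (hZ : IsSphereTimeField P Z Γ)
    (hΓ : Continuous fun q : ℝ × ℝ => Γ q.1 q.2) (ℓ : ℕ) : 0 ≤ powerSpectrum Γ ℓ 0 := by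
  have h := hZ.harmonic_covariance hΓ ℓ 0 0
  rw [sub_zero] at h
  have h0 : 0 ≤ powerSpectrum Γ ℓ 0 * (4 * Real.pi / (2 * ℓ + 1)) := by
    rw [← h]
    exact integral_nonneg fun ω => mul_self_nonneg _
  have hpi := Real.pi_pos
  exact nonneg_of_mul_nonneg_left h0 (by positivity)

lemma IsSphereTimeField.abs_powerSpectrum_le (hZ : IsSphereTimeField P Z Γ)
    (hΓ : Continuous fun q : ℝ × ℝ => Γ q.1 q.2) (ℓ : ℕ) (τ : ℝ) :
    |powerSpectrum Γ ℓ τ| ≤ powerSpectrum Γ ℓ 0 := by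
  have hw := continuous_legendre_pole ℓ
  have h := two_mul_integral_mul_le (hZ.integrable_weight_mul hw hw τ 0)
    (hZ.integrable_weight_mul hw hw τ τ) (hZ.integrable_weight_mul hw hw 0 0)
  have hpi := Real.pi_pos
  have hc : 0 < 4 * Real.pi / (2 * (ℓ : ℝ) + 1) := by positivity
  rw [hZ.harmonic_covariance hΓ, hZ.harmonic_covariance hΓ, hZ.harmonic_covariance hΓ, sub_self,
    sub_self, sub_zero, abs_mul, abs_of_pos hc] at h
  nlinarith

/-- A Bessel inequality. Let `W` be the field at time `0` integrated against the truncated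
reproducing kernel at the pole, and `s` the partial sum. Then `E[Z(pole) W] = E[W²] = s` and
`E[Z(pole)²] = 1`, so `2 s ≤ 1 + s`. -/
lemma IsSphereTimeField.sum_expansionCoeff_le (hZ : IsSphereTimeField P Z Γ)
    (hΓ : Continuous fun q : ℝ × ℝ => Γ q.1 q.2) (N : ℕ) :
    ∑ ℓ ∈ Finset.range N, expansionCoeff Γ ℓ 0 ≤ 1 := by
  have hpi := Real.pi_pos
  let c : ℕ → ℝ := fun ℓ => (2 * ℓ + 1) / (4 * Real.pi)
  let w : S2 → ℝ := fun x => ∑ ℓ ∈ Finset.range N, c ℓ * (legendre ℓ).eval (inner ℝ pole.1 x.1)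
  have hw : Continuous w := by fun_prop
  have hΓ0 := continuous_section hΓ 0
  have hproj (x : S2) : ∫ y, Γ (inner ℝ x.1 y.1) 0 * w y ∂area =
      ∑ ℓ ∈ Finset.range N, expansionCoeff Γ ℓ 0 * (legendre ℓ).eval (inner ℝ pole.1 x.1) := by
    simp only [w, Finset.mul_sum]
    rw [integral_finsetSum]
    · refine Finset.sum_congr rfl fun ℓ _ => ?_
      have e : ∀ y : S2, Γ (inner ℝ x.1 y.1) 0 * (c ℓ * (legendre ℓ).eval (inner ℝ pole.1 y.1)) =
        c ℓ * (Γ (inner ℝ x.1 y.1) 0 * (legendre ℓ).eval (inner ℝ pole.1 y.1)) := fun y => by ring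
      simp only [e]
      rw [integral_const_mul, funk_hecke_field hΓ, real_inner_comm, expansionCoeff]
      ring
    · intro ℓ _
      apply integrable_area
      exact (hΓ0.comp (continuous_inner_sphere continuous_const continuous_id)).mul
        (continuous_const.mul (continuous_legendre_pole ℓ))
  obtain ⟨D, hD⟩ := hZ.boundedSecondMoment_weight hw 0
  -- Evaluation at the pole is regarded as an integral over a one-point space, so that the Fubini
  -- lemmas for integrated fields apply to it.
  have hP : BoundedSecondMoment P (fun z : Ω × Unit => Z (pole, 0) z.1) 1 := by
    refine ⟨hZ.measurable.comp (measurable_fst.prodMk measurable_const), fun _ => ?_,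
      fun _ => (hZ.unit_variance _).le⟩
    exact ((hZ.isStdPair (pole, 0) (pole, 0)).gaussian.map_fun
      (ContinuousLinearMap.fst ℝ ℝ ℝ)).memLp_two
  have h := two_mul_integral_mul_le (hP.integrable_integral_mul hD (Measure.dirac ()) area)
    (hP.integrable_integral_mul hP (Measure.dirac ()) (Measure.dirac ()))
    (hD.integrable_integral_mul hD area area)
  have e1 : ∫ ω, (∫ _ : Unit, Z (pole, 0) ω ∂(Measure.dirac ())) *
      (∫ y, w y * Z (y, 0) ω ∂area) ∂P = ∑ ℓ ∈ Finset.range N, expansionCoeff Γ ℓ 0 := by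
    rw [hP.integral_mul hD (Measure.dirac ()) area, integral_dirac]
    have e : ∀ y : S2, ∫ ω, Z (pole, 0) ω * (w y * Z (y, 0) ω) ∂P =
        Γ (inner ℝ pole.1 y.1) 0 * w y := fun y => by
      have := hZ.covariance pole y 0 0
      rw [sub_zero] at this
      rw [← this, ← integral_mul_const]
      congr 1
      ext ω
      ring
    simp only [e, hproj, inner_self_sphere, legendre_eval_one, mul_one]
  have e2 : ∫ ω, (∫ _ : Unit, Z (pole, 0) ω ∂(Measure.dirac ())) *
      (∫ _ : Unit, Z (pole, 0) ω ∂(Measure.dirac ())) ∂P = 1 := by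
    simp only [integral_dirac, ← sq]
    exact hZ.unit_variance _
  have e3 : ∫ ω, (∫ x, w x * Z (x, 0) ω ∂area) * (∫ y, w y * Z (y, 0) ω ∂area) ∂P =
      ∑ ℓ ∈ Finset.range N, expansionCoeff Γ ℓ 0 := by
    rw [hZ.integral_weight_mul hw hw, sub_zero]
    simp only [hproj, Finset.mul_sum]
    rw [integral_finsetSum]
    · refine Finset.sum_congr rfl fun ℓ hℓ => ?_
      have := sphere_integral_inner (h := fun t => (∑ k ∈ Finset.range N, c k * (legendre k).eval t)
        * (legendre ℓ).eval t) (by fun_prop) pole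
      rw [integral_sum_legendre_mul _ _ hℓ] at this
      have e : ∀ x : S2, w x * (expansionCoeff Γ ℓ 0 * (legendre ℓ).eval (inner ℝ pole.1 x.1)) =
          expansionCoeff Γ ℓ 0 * (w x * (legendre ℓ).eval (inner ℝ pole.1 x.1)) := fun x => by ring
      simp only [e]
      rw [integral_const_mul]
      simp only [w]
      rw [this]
      simp only [c]
      have : (2 * (ℓ : ℝ) + 1) ≠ 0 := by positivity
      field_simp
      norm_num
    · intro ℓ _
      apply integrable_area
      fun_prop
  rw [e1, e2, e3] at h
  have := le_abs_self (∑ ℓ ∈ Finset.range N, expansionCoeff Γ ℓ 0)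
  linarith

lemma IsSphereTimeField.expansionCoeff_nonneg (hZ : IsSphereTimeField P Z Γ)
    (hΓ : Continuous fun q : ℝ × ℝ => Γ q.1 q.2) (ℓ : ℕ) : 0 ≤ expansionCoeff Γ ℓ 0 := by
  have := hZ.powerSpectrum_nonneg hΓ ℓ
  have hpi := Real.pi_pos
  unfold expansionCoeff
  positivity

lemma IsSphereTimeField.summable_expansionCoeff (hZ : IsSphereTimeField P Z Γ)
    (hΓ : Continuous fun q : ℝ × ℝ => Γ q.1 q.2) : Summable fun ℓ => expansionCoeff Γ ℓ 0 :=
  summable_of_sum_range_le (hZ.expansionCoeff_nonneg hΓ) (hZ.sum_expansionCoeff_le hΓ)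

lemma IsSphereTimeField.abs_expansionCoeff_le (hZ : IsSphereTimeField P Z Γ)
    (hΓ : Continuous fun q : ℝ × ℝ => Γ q.1 q.2) (ℓ : ℕ) (τ : ℝ) :
    |expansionCoeff Γ ℓ τ| ≤ expansionCoeff Γ ℓ 0 := by
  have hpi := Real.pi_pos
  have hc : 0 ≤ (2 * (ℓ : ℝ) + 1) / (4 * Real.pi) := by positivity
  rw [expansionCoeff, expansionCoeff, abs_mul, abs_of_nonneg hc]
  exact mul_le_mul_of_nonneg_left (hZ.abs_powerSpectrum_le hΓ ℓ τ) hc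

/-- A continuous function orthogonal to all Legendre polynomials vanishes. -/
lemma eq_zero_of_orthogonal_legendre {f : ℝ → ℝ} (hf : ContinuousOn f (Set.Icc (-1) 1))
    (h : ∀ ℓ, ∫ θ in (-1 : ℝ)..1, f θ * (legendre ℓ).eval θ = 0) :
    ∀ θ ∈ Set.Icc (-1 : ℝ) 1, f θ = 0 := by
  have hle : (-1 : ℝ) ≤ 1 := by norm_num
  have hmul {g : ℝ → ℝ} (hg : ContinuousOn g (Set.Icc (-1) 1)) :
      IntervalIntegrable (fun θ => f θ * g θ) volume (-1) 1 :=
    ContinuousOn.intervalIntegrable (by rw [Set.uIcc_of_le hle]; exact hf.mul hg)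
  have hpoly (p : ℝ[X]) : ∫ θ in (-1 : ℝ)..1, f θ * p.eval θ = 0 := by
    obtain ⟨c, hc⟩ := exists_legendre_expansion p.natDegree p le_rfl
    simp only [hc, Finset.mul_sum]
    rw [intervalIntegral.integral_finsetSum]
    · refine Finset.sum_eq_zero fun k _ => ?_
      have e : ∀ θ, f θ * (c k * (legendre k).eval θ) = c k * (f θ * (legendre k).eval θ) :=
        fun θ => by ring
      simp only [e]
      rw [intervalIntegral.integral_const_mul, h, mul_zero]
    · intro k _
      exact hmul (by fun_prop)
  obtain ⟨M, hM⟩ := isCompact_Icc.exists_bound_of_continuousOn hf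
  have hM0 : 0 ≤ M := (norm_nonneg _).trans (hM 0 (by norm_num))
  -- Since `f` is orthogonal to every polynomial `p`, `∫ f² = ∫ f (f - p)`, which is arbitrarily
  -- small by Weierstrass.
  have hsq : ∫ θ in (-1 : ℝ)..1, f θ * f θ ≤ 0 := by
    refine le_of_forall_pos_le_add fun ε hε => ?_
    obtain ⟨p, hp⟩ := exists_polynomial_near_of_continuousOn (-1) 1 f hf (ε / (2 * (M + 1)))
      (by positivity)
    have e : ∫ θ in (-1 : ℝ)..1, f θ * f θ = ∫ θ in (-1 : ℝ)..1, f θ * (f θ - p.eval θ) := by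
      simp only [mul_sub]
      rw [intervalIntegral.integral_sub (hmul hf) (hmul (by fun_prop)), hpoly, sub_zero]
    have hb := intervalIntegral.norm_integral_le_of_norm_le_const (a := -1) (b := 1)
      (f := fun θ => f θ * (f θ - p.eval θ)) (C := M * (ε / (2 * (M + 1)))) (fun θ hθ => by
        rw [Set.uIoc_of_le hle] at hθ
        have hθ' : θ ∈ Set.Icc (-1 : ℝ) 1 := ⟨hθ.1.le, hθ.2⟩
        rw [norm_mul]
        refine mul_le_mul (hM θ hθ') ?_ (norm_nonneg _) hM0
        rw [norm_sub_rev]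
        exact (hp θ hθ').le)
    rw [e, zero_add]
    refine (le_abs_self _).trans (hb.trans ?_)
    rw [show |(1 : ℝ) - -1| = 2 by norm_num]
    field_simp
    linarith
  intro θ hθ
  by_contra hne
  have := intervalIntegral.integral_pos (f := fun θ => f θ * f θ) (by norm_num : (-1 : ℝ) < 1)
    (hf.mul hf) (fun θ _ => mul_self_nonneg _) ⟨θ, hθ, mul_self_pos.mpr hne⟩
  linarith

/-- The Legendre expansion of the covariance function. -/
lemma IsSphereTimeField.hasSum_expansion (hZ : IsSphereTimeField P Z Γ)
    (hΓ : Continuous fun q : ℝ × ℝ => Γ q.1 q.2) (τ : ℝ) {θ : ℝ} (hθ : θ ∈ Set.Icc (-1 : ℝ) 1) :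
    HasSum (fun ℓ => expansionCoeff Γ ℓ τ * (legendre ℓ).eval θ) (Γ θ τ) := by
  have hs := hZ.summable_expansionCoeff hΓ
  have hbound (ℓ : ℕ) (t : ℝ) (ht : t ∈ Set.Icc (-1 : ℝ) 1) :
      ‖expansionCoeff Γ ℓ τ * (legendre ℓ).eval t‖ ≤ expansionCoeff Γ ℓ 0 := by
    rw [norm_mul]
    have h1 := hZ.abs_expansionCoeff_le hΓ ℓ τ
    have h2 := abs_legendre_le_one ℓ ht
    calc _ ≤ expansionCoeff Γ ℓ 0 * 1 :=
          mul_le_mul h1 h2 (abs_nonneg _) (hZ.expansionCoeff_nonneg hΓ ℓ)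
      _ = _ := mul_one _
  have hsum (t : ℝ) (ht : t ∈ Set.Icc (-1 : ℝ) 1) :
      Summable fun ℓ => expansionCoeff Γ ℓ τ * (legendre ℓ).eval t :=
    Summable.of_norm_bounded hs fun ℓ => hbound ℓ t ht
  let g : ℝ → ℝ := fun t => ∑' ℓ, expansionCoeff Γ ℓ τ * (legendre ℓ).eval t
  have hg : ContinuousOn g (Set.Icc (-1) 1) :=
    continuousOn_tsum (fun ℓ => by fun_prop) hs fun ℓ t ht => hbound ℓ t ht
  have hΓτ := continuous_section hΓ τ
  have hle : (-1 : ℝ) ≤ 1 := by norm_num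
  -- The sum `g` of the series has the same Legendre coefficients as `Γ(·, τ)`: termwise integration
  -- leaves only the term `ℓ = k`.
  have horth : ∀ k, ∫ t in (-1 : ℝ)..1, (Γ t τ - g t) * (legendre k).eval t = 0 := by
    intro k
    have hgk : ∫ t in (-1 : ℝ)..1, g t * (legendre k).eval t =
        expansionCoeff Γ k τ * (2 / (2 * (k : ℝ) + 1)) := by
      have h1 := intervalIntegral.hasSum_integral_of_dominated_convergence (μ := volume)
        (a := -1) (b := 1)
        (F := fun ℓ t => expansionCoeff Γ ℓ τ * (legendre ℓ).eval t * (legendre k).eval t)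
        (f := fun t => g t * (legendre k).eval t) (fun ℓ _ => expansionCoeff Γ ℓ 0)
        (fun ℓ => by
          apply Continuous.aestronglyMeasurable
          fun_prop)
        (fun ℓ => Eventually.of_forall fun t ht => by
          rw [Set.uIoc_of_le hle] at ht
          have ht' : t ∈ Set.Icc (-1 : ℝ) 1 := ⟨ht.1.le, ht.2⟩
          rw [norm_mul]
          calc _ ≤ expansionCoeff Γ ℓ 0 * 1 :=
                mul_le_mul (hbound ℓ t ht') (abs_legendre_le_one k ht') (abs_nonneg _)
                  (hZ.expansionCoeff_nonneg hΓ ℓ)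
            _ = _ := mul_one _)
        (Eventually.of_forall fun _ _ => hs) intervalIntegrable_const
        (Eventually.of_forall fun t ht => by
          rw [Set.uIoc_of_le hle] at ht
          exact (hsum t ⟨ht.1.le, ht.2⟩).hasSum.mul_right _)
      have h2 : ∀ ℓ, ∫ t in (-1 : ℝ)..1,
          expansionCoeff Γ ℓ τ * (legendre ℓ).eval t * (legendre k).eval t =
          if ℓ = k then expansionCoeff Γ k τ * (2 / (2 * (k : ℝ) + 1)) else 0 := fun ℓ => by
        simp only [mul_assoc]
        rw [intervalIntegral.integral_const_mul, integral_legendre_mul]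
        split_ifs with hlk
        · rw [hlk]
        · rw [mul_zero]
      simp only [h2] at h1
      exact h1.unique (hasSum_ite_eq k _)
    simp only [sub_mul]
    rw [intervalIntegral.integral_sub, hgk, expansionCoeff, powerSpectrum]
    · have hpi := Real.pi_pos.ne'
      have : (2 * (k : ℝ) + 1) ≠ 0 := by positivity
      field_simp
      ring
    · apply Continuous.intervalIntegrable
      fun_prop
    · apply ContinuousOn.intervalIntegrable
      rw [Set.uIcc_of_le hle]
      exact hg.mul (by fun_prop)
  have h0 := eq_zero_of_orthogonal_legendre (hΓτ.continuousOn.sub hg) horth θ hθ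
  have h0' : Γ θ τ = g θ := sub_eq_zero.mp h0
  rw [h0']
  exact (hsum θ hθ).hasSum

end Spectrum

/-! ### The cubic term of the arcsine -/

section Arcsin

lemma tendsto_sub_sin_div_cube :
    Tendsto (fun y : ℝ => (y - Real.sin y) / y ^ 3) (𝓝[≠] 0) (𝓝 (1 / 6)) := by
  rw [tendsto_iff_dist_tendsto_zero]
  have hg : Tendsto (fun y : ℝ => |y| ^ 2 / 100) (𝓝[≠] 0) (𝓝 0) := by
    have : Continuous fun y : ℝ => |y| ^ 2 / 100 := by fun_prop
    simpa using (this.tendsto 0).mono_left (nhdsWithin_le_nhds (s := {0}ᶜ))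
  refine squeeze_zero' (Eventually.of_forall fun _ => dist_nonneg) ?_ hg
  have h1 : ∀ᶠ y : ℝ in 𝓝[≠] 0, |y| ≤ 1 := by
    refine eventually_nhdsWithin_of_eventually_nhds ?_
    have : ∀ᶠ y : ℝ in 𝓝 0, |y| < 1 := by
      have hc : Continuous fun y : ℝ => |y| := continuous_abs
      exact (hc.tendsto 0).eventually (gt_mem_nhds (by simp))
    exact this.mono fun _ h => h.le
  filter_upwards [h1, self_mem_nhdsWithin] with y hy hne
  have hne' : y ≠ 0 := hne
  have hb := Real.sin_bound hy
  have hpos : 0 < |y| ^ 3 := by positivity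
  have e : (y - Real.sin y) / y ^ 3 - 1 / 6 = -(Real.sin y - (y - y ^ 3 / 6)) / y ^ 3 := by
    field_simp
    ring
  rw [Real.dist_eq, e, abs_div, abs_neg, abs_pow, div_le_iff₀ hpos]
  linarith [hb, show |y| ^ 2 / 100 * |y| ^ 3 = |y| ^ 5 / 100 by ring]

/-- The ratio `(arcsin x - x) / x ^ 3`, extended continuously to `0`. -/
def arcsinRatio (x : ℝ) : ℝ := if x = 0 then 1 / 6 else (Real.arcsin x - x) / x ^ 3

lemma arcsin_sub_self (x : ℝ) : Real.arcsin x - x = x ^ 3 * arcsinRatio x := by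
  unfold arcsinRatio
  split_ifs with h
  · simp [h]
  · field_simp

/-- With `y = arcsin x` the ratio is `(y - sin y)/y³` divided by `(sin y / y)³`. -/
lemma tendsto_arcsinRatio_zero : Tendsto arcsinRatio (𝓝[≠] 0) (𝓝 (1 / 6)) := by
  have ha : Tendsto Real.arcsin (𝓝[≠] 0) (𝓝[≠] 0) := by
    refine tendsto_nhdsWithin_iff.mpr ⟨?_, ?_⟩
    · have := Real.continuous_arcsin.tendsto 0
      rw [Real.arcsin_zero] at this
      exact this.mono_left nhdsWithin_le_nhds
    · filter_upwards [self_mem_nhdsWithin] with x hx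
      simpa [Real.arcsin_eq_zero_iff] using hx
  have hs : Tendsto (fun y : ℝ => Real.sin y / y) (𝓝[≠] 0) (𝓝 1) := by
    have := (Real.hasDerivAt_sin 0).tendsto_slope_zero
    rw [Real.cos_zero] at this
    refine this.congr fun y => ?_
    simp [div_eq_inv_mul]
  have h := (tendsto_sub_sin_div_cube.div (hs.pow 3) (by norm_num)).comp ha
  rw [one_pow, div_one] at h
  refine h.congr' ?_
  have h1 : ∀ᶠ x : ℝ in 𝓝[≠] 0, x ∈ Set.Icc (-1 : ℝ) 1 :=
    eventually_nhdsWithin_of_eventually_nhds (Icc_mem_nhds (by norm_num) (by norm_num))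
  filter_upwards [h1, self_mem_nhdsWithin] with x hx hne
  have hne' : x ≠ 0 := hne
  have hA : Real.arcsin x ≠ 0 := by simpa [Real.arcsin_eq_zero_iff] using hne'
  simp only [Function.comp, Pi.div_apply, arcsinRatio, if_neg hne', Real.sin_arcsin hx.1 hx.2]
  field_simp

lemma continuous_arcsinRatio : Continuous arcsinRatio := by
  rw [continuous_iff_continuousAt]
  intro x
  by_cases hx : x = 0
  · subst hx
    rw [continuousAt_iff_punctured_nhds]
    have : arcsinRatio 0 = 1 / 6 := by simp [arcsinRatio]
    rw [this]
    exact tendsto_arcsinRatio_zero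
  · have hc : ContinuousAt (fun y : ℝ => (Real.arcsin y - y) / y ^ 3) x :=
      (Real.continuous_arcsin.continuousAt.sub continuousAt_id).div
        (continuousAt_id.pow 3) (pow_ne_zero 3 hx)
    refine hc.congr ?_
    filter_upwards [isOpen_ne.mem_nhds hx] with y hy
    simp only [arcsinRatio]
    rw [if_neg hy]

lemma exists_arcsinRatio_bound : ∃ M, ∀ x ∈ Set.Icc (-1 : ℝ) 1, |arcsinRatio x| ≤ M :=
  isCompact_Icc.exists_bound_of_continuousOn continuous_arcsinRatio.continuousOn

end Arcsin

/-! ### Power decay -/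

section Decay

/-- The conditional is the effective decay rate: the label `1` stands for the rate `α`. -/
lemma decay_eq (α a τ : ℝ) : decay α a τ = (1 + |τ|) ^ (-(if a = 1 then α else a)) := by
  unfold decay
  split_ifs <;> rfl

lemma rpow_mul_rpow_neg_eq {τ : ℝ} (hτ : 0 < τ) (a b : ℝ) :
    τ ^ b * (1 + |τ|) ^ (-a) = (τ / (1 + τ)) ^ b * (1 + τ) ^ (-(a - b)) := by
  have h1 : 0 < 1 + τ := by linarith
  rw [abs_of_pos hτ, Real.div_rpow hτ.le h1.le, show -(a - b) = b + -a by ring, Real.rpow_add h1]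
  have : (1 + τ) ^ b ≠ 0 := (Real.rpow_pos_of_pos h1 b).ne'
  field_simp

lemma rpow_mul_rpow_neg_le {τ a b : ℝ} (hτ : 0 < τ) (hb : 0 ≤ b) (hab : b ≤ a) :
    τ ^ b * (1 + |τ|) ^ (-a) ≤ 1 := by
  rw [rpow_mul_rpow_neg_eq hτ]
  refine mul_le_one₀ (Real.rpow_le_one (by positivity) ?_ hb) (by positivity)
    (Real.rpow_le_one_of_one_le_of_nonpos (by linarith) (by linarith))
  rw [div_le_one (by linarith)]
  linarith

lemma tendsto_rpow_mul_rpow_neg {a b : ℝ} (hab : b ≤ a) :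
    Tendsto (fun τ : ℝ => τ ^ b * (1 + |τ|) ^ (-a)) atTop (𝓝 (if a = b then 1 else 0)) := by
  have h1 : Tendsto (fun τ : ℝ => τ / (1 + τ)) atTop (𝓝 1) := by
    have h : Tendsto (fun τ : ℝ => 1 - (1 + τ)⁻¹) atTop (𝓝 (1 - 0)) :=
      tendsto_const_nhds.sub (tendsto_inv_atTop_zero.comp (tendsto_atTop_add_const_left _ 1 tendsto_id))
    rw [sub_zero] at h
    refine h.congr' ?_
    filter_upwards [eventually_gt_atTop 0] with τ hτ
    have : 1 + τ ≠ 0 := by positivity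
    field_simp
    ring
  have h2 : Tendsto (fun τ : ℝ => (1 + τ) ^ (-(a - b))) atTop (𝓝 (if a = b then 1 else 0)) := by
    split_ifs with h
    · simp [h]
    · exact (tendsto_rpow_neg_atTop (by rcases hab.lt_or_eq with h' | h'
                                        · linarith
                                        · exact absurd h'.symm h)).comp
        (tendsto_atTop_add_const_left _ 1 tendsto_id)
  have h3 := (h1.rpow_const (p := b) (Or.inl one_ne_zero)).mul h2
  rw [Real.one_rpow, one_mul] at h3
  refine h3.congr' ?_
  filter_upwards [eventually_gt_atTop 0] with τ hτ
  exact (rpow_mul_rpow_neg_eq hτ a b).symm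

end Decay

/-! ### Decay of the covariance function -/

section Covariance

variable {Ω : Type*} [MeasurableSpace Ω] {P : Measure Ω}
  {Z : S2 × ℝ → Ω → ℝ} {Γ : ℝ → ℝ → ℝ}

lemma IsSphereTimeField.mem_Icc (hZ : IsSphereTimeField P Z Γ) {θ : ℝ}
    (hθ : θ ∈ Set.Icc (-1 : ℝ) 1) (τ : ℝ) : Γ θ τ ∈ Set.Icc (-1 : ℝ) 1 := by
  obtain ⟨x, y, rfl⟩ := exists_inner_eq hθ
  have h := (hZ.isStdPair (x, τ) (y, 0)).sq_le_one
  simp only [sub_zero] at h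
  exact abs_le.mp (sq_le_one_iff_abs_le_one _ |>.mp h)

lemma IsSphereTimeField.symm (hZ : IsSphereTimeField P Z Γ) {θ : ℝ}
    (hθ : θ ∈ Set.Icc (-1 : ℝ) 1) (τ : ℝ) : Γ θ (-τ) = Γ θ τ := by
  obtain ⟨x, y, rfl⟩ := exists_inner_eq hθ
  have h1 := hZ.covariance x y τ 0
  have h2 := hZ.covariance y x 0 τ
  rw [sub_zero] at h1
  rw [zero_sub, real_inner_comm] at h2
  rw [← h1, ← h2]
  congr 1
  ext ω
  ring

/-- The Legendre series with the coefficients of `Γ(·, 0)` indexed by `I`. -/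
def partialSection (Γ : ℝ → ℝ → ℝ) (I : Set ℕ) (θ : ℝ) : ℝ :=
  ∑' ℓ : I, expansionCoeff Γ ℓ 0 * (legendre ℓ).eval θ

variable [IsProbabilityMeasure P] {α b : ℝ} {β : ℕ → ℝ}

/-- The supremum over `ℓ` in the memory condition yields one threshold in `τ` valid for every
multipole, as domination of the Legendre series requires. -/
lemma IsSphereTimeField.eventually_abs_le (hZ : IsSphereTimeField P Z Γ)
    (hΓ : Continuous fun q : ℝ × ℝ => Γ q.1 q.2) (hβ : MemoryCondition Γ α β) :
    ∀ᶠ τ in atTop, ∀ ℓ ∈ multipoles Γ,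
      |powerSpectrum Γ ℓ τ| ≤ 2 * powerSpectrum Γ ℓ 0 * decay α (β ℓ) τ := by
  obtain ⟨G, hG, hu⟩ := hβ.factor
  have h := Metric.tendstoUniformlyOn_iff.mp hu 1 one_pos
  filter_upwards [h] with τ hτ ℓ hℓ
  have h0 := hZ.powerSpectrum_nonneg hΓ ℓ
  have hpos : 0 < powerSpectrum Γ ℓ 0 := lt_of_le_of_ne h0 (Ne.symm hℓ)
  have hd : 0 ≤ decay α (β ℓ) τ := by
    rw [decay_eq]
    positivity
  have h1 := hτ ℓ hℓ
  rw [Real.dist_eq, abs_sub_lt_iff] at h1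
  have h2 : |G ℓ τ / powerSpectrum Γ ℓ 0| ≤ 2 := abs_le.mpr ⟨by linarith, by linarith⟩
  rw [abs_div, abs_of_pos hpos, div_le_iff₀ hpos] at h2
  rw [hG ℓ hℓ, abs_mul, abs_of_nonneg hd]
  exact mul_le_mul_of_nonneg_right h2 hd

lemma MemoryCondition.tendsto_powerSpectrum (hβ : MemoryCondition Γ α β) {ℓ : ℕ}
    (hℓ : ℓ ∈ multipoles Γ) (hb : b ≤ if β ℓ = 1 then α else β ℓ) :
    Tendsto (fun τ => τ ^ b * powerSpectrum Γ ℓ τ) atTop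
      (𝓝 (if (if β ℓ = 1 then α else β ℓ) = b then powerSpectrum Γ ℓ 0 else 0)) := by
  obtain ⟨G, hG, hu⟩ := hβ.factor
  have hne : powerSpectrum Γ ℓ 0 ≠ 0 := hℓ
  have h1 : Tendsto (fun τ => G ℓ τ) atTop (𝓝 (powerSpectrum Γ ℓ 0)) := by
    have := (hu.tendsto_at hℓ).const_mul (powerSpectrum Γ ℓ 0)
    rw [mul_one] at this
    refine this.congr fun τ => ?_
    field_simp
  have h2 := h1.mul (tendsto_rpow_mul_rpow_neg hb)
  rw [mul_ite, mul_one, mul_zero] at h2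
  refine h2.congr fun τ => ?_
  rw [hG ℓ hℓ, decay_eq]
  ring

/-- Since `b < 1 < 2 ≤ α`, replacing the label `1` by the rate `α` preserves comparisons with `b`.
-/
lemma MemoryCondition.le_effective (hβ : MemoryCondition Γ α β) (hb1 : b < 1) {ℓ : ℕ}
    (hle : b ≤ β ℓ) : b ≤ if β ℓ = 1 then α else β ℓ := by
  have := hβ.two_le
  split_ifs <;> linarith

lemma MemoryCondition.effective_eq_iff (hβ : MemoryCondition Γ α β) (hb1 : b < 1) (ℓ : ℕ) :
    (if β ℓ = 1 then α else β ℓ) = b ↔ β ℓ = b := by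
  have := hβ.two_le
  split_ifs with h
  · constructor <;> intro h' <;> linarith
  · rfl

lemma IsSphereTimeField.tendsto_expansionCoeff (hZ : IsSphereTimeField P Z Γ)
    (hΓ : Continuous fun q : ℝ × ℝ => Γ q.1 q.2) (hβ : MemoryCondition Γ α β) (hb1 : b < 1)
    (hle : ∀ ℓ ∈ multipoles Γ, b ≤ β ℓ) (ℓ : ℕ) :
    Tendsto (fun τ => τ ^ b * expansionCoeff Γ ℓ τ) atTop
      (𝓝 ((minimalMultipoles Γ β b).indicator (fun ℓ => expansionCoeff Γ ℓ 0) ℓ)) := by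
  classical
  by_cases hℓ : ℓ ∈ multipoles Γ
  · have h := (hβ.tendsto_powerSpectrum hℓ (hβ.le_effective hb1 (hle ℓ hℓ))).const_mul
      ((2 * (ℓ : ℝ) + 1) / (4 * Real.pi))
    simp only [hβ.effective_eq_iff hb1] at h
    have e : (minimalMultipoles Γ β b).indicator (fun ℓ => expansionCoeff Γ ℓ 0) ℓ =
        (2 * (ℓ : ℝ) + 1) / (4 * Real.pi) * if β ℓ = b then powerSpectrum Γ ℓ 0 else 0 := by
      simp only [Set.indicator_apply, minimalMultipoles, Set.mem_ofPred_eq, hℓ, true_and,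
        expansionCoeff, mul_ite, mul_zero]
    rw [e]
    refine h.congr fun τ => ?_
    rw [expansionCoeff]
    ring
  -- An absent multipole vanishes at every time lag, because `|C_ℓ(τ)| ≤ C_ℓ(0)`.
  · have h0 : powerSpectrum Γ ℓ 0 = 0 := by simpa [multipoles] using hℓ
    have hz (τ : ℝ) : expansionCoeff Γ ℓ τ = 0 := by
      have := hZ.abs_powerSpectrum_le hΓ ℓ τ
      rw [h0] at this
      rw [expansionCoeff, abs_nonpos_iff.mp this, mul_zero]
    rw [Set.indicator_of_notMem fun h => hℓ h.1]
    simp [hz]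

lemma IsSphereTimeField.eventually_abs_expansionCoeff_le (hZ : IsSphereTimeField P Z Γ)
    (hΓ : Continuous fun q : ℝ × ℝ => Γ q.1 q.2) (hβ : MemoryCondition Γ α β) (hb0 : 0 ≤ b)
    (hb1 : b < 1) (hle : ∀ ℓ ∈ multipoles Γ, b ≤ β ℓ) :
    ∀ᶠ τ in atTop, ∀ ℓ, |τ ^ b * expansionCoeff Γ ℓ τ| ≤ 2 * expansionCoeff Γ ℓ 0 := by
  filter_upwards [hZ.eventually_abs_le hΓ hβ, eventually_gt_atTop 0] with τ hτ hpos ℓ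
  have hc := hZ.expansionCoeff_nonneg hΓ ℓ
  by_cases hℓ : ℓ ∈ multipoles Γ
  · have h1 := hτ ℓ hℓ
    have h2 := rpow_mul_rpow_neg_le hpos hb0 (hβ.le_effective hb1 (hle ℓ hℓ))
    rw [← decay_eq] at h2
    have h0 := hZ.powerSpectrum_nonneg hΓ ℓ
    have hτb : 0 ≤ τ ^ b := by positivity
    have hpi := Real.pi_pos
    have hk : 0 ≤ (2 * (ℓ : ℝ) + 1) / (4 * Real.pi) := by positivity
    rw [expansionCoeff, expansionCoeff, abs_mul, abs_mul, abs_of_nonneg hτb, abs_of_nonneg hk]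
    calc _ = (2 * (ℓ : ℝ) + 1) / (4 * Real.pi) * (τ ^ b * |powerSpectrum Γ ℓ τ|) := by ring
      _ ≤ (2 * (ℓ : ℝ) + 1) / (4 * Real.pi) * (2 * powerSpectrum Γ ℓ 0) := by
          refine mul_le_mul_of_nonneg_left ?_ hk
          calc _ ≤ τ ^ b * (2 * powerSpectrum Γ ℓ 0 * decay α (β ℓ) τ) :=
                mul_le_mul_of_nonneg_left h1 hτb
            _ = 2 * powerSpectrum Γ ℓ 0 * (τ ^ b * decay α (β ℓ) τ) := by ring
            _ ≤ 2 * powerSpectrum Γ ℓ 0 * 1 := mul_le_mul_of_nonneg_left h2 (by linarith)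
            _ = _ := mul_one _
      _ = _ := by ring
  · have h0 : powerSpectrum Γ ℓ 0 = 0 := by simpa [multipoles] using hℓ
    have h1 := hZ.abs_powerSpectrum_le hΓ ℓ τ
    rw [h0] at h1
    rw [expansionCoeff, abs_nonpos_iff.mp h1]
    simp only [mul_zero, abs_zero]
    linarith

lemma IsSphereTimeField.eventually_abs_field_le (hZ : IsSphereTimeField P Z Γ)
    (hΓ : Continuous fun q : ℝ × ℝ => Γ q.1 q.2) (hβ : MemoryCondition Γ α β) (hb0 : 0 ≤ b)
    (hb1 : b < 1) (hle : ∀ ℓ ∈ multipoles Γ, b ≤ β ℓ) :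
    ∃ D, ∀ᶠ τ in atTop, ∀ θ ∈ Set.Icc (-1 : ℝ) 1, |τ ^ b * Γ θ τ| ≤ D := by
  refine ⟨∑' ℓ, 2 * expansionCoeff Γ ℓ 0, ?_⟩
  filter_upwards [hZ.eventually_abs_expansionCoeff_le hΓ hβ hb0 hb1 hle] with τ hτ θ hθ
  have hs := (hZ.summable_expansionCoeff hΓ).mul_left 2
  have h := (hZ.hasSum_expansion hΓ τ hθ).mul_left (τ ^ b)
  rw [← h.tsum_eq]
  refine tsum_of_norm_bounded (f := fun ℓ => τ ^ b * (expansionCoeff Γ ℓ τ * (legendre ℓ).eval θ))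
    hs.hasSum fun ℓ => ?_
  rw [← mul_assoc, norm_mul]
  calc _ ≤ 2 * expansionCoeff Γ ℓ 0 * 1 := mul_le_mul (hτ ℓ) (abs_legendre_le_one ℓ hθ)
        (abs_nonneg _) (mul_nonneg zero_le_two (hZ.expansionCoeff_nonneg hΓ ℓ))
    _ = _ := mul_one _

/-- Dominated convergence for series: rescaled coefficients with exponent above `b` tend to zero,
those with exponent `b` to their value at `0`, and twice the coefficients at `0` form a summable
majorant. -/
lemma IsSphereTimeField.tendsto_field (hZ : IsSphereTimeField P Z Γ)
    (hΓ : Continuous fun q : ℝ × ℝ => Γ q.1 q.2) (hβ : MemoryCondition Γ α β) (hb0 : 0 ≤ b)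
    (hb1 : b < 1) (hle : ∀ ℓ ∈ multipoles Γ, b ≤ β ℓ) {θ : ℝ} (hθ : θ ∈ Set.Icc (-1 : ℝ) 1) :
    Tendsto (fun τ => τ ^ b * Γ θ τ) atTop
      (𝓝 (partialSection Γ (minimalMultipoles Γ β b) θ)) := by
  have hs := (hZ.summable_expansionCoeff hΓ).mul_left 2
  have h := tendsto_tsum_of_dominated_convergence (𝓕 := atTop)
    (f := fun τ ℓ => τ ^ b * expansionCoeff Γ ℓ τ * (legendre ℓ).eval θ)
    (g := fun ℓ => (minimalMultipoles Γ β b).indicator (fun ℓ => expansionCoeff Γ ℓ 0) ℓ *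
      (legendre ℓ).eval θ) hs
    (fun ℓ => (hZ.tendsto_expansionCoeff hΓ hβ hb1 hle ℓ).mul_const _)
    (by
      filter_upwards [hZ.eventually_abs_expansionCoeff_le hΓ hβ hb0 hb1 hle] with τ hτ ℓ
      rw [norm_mul]
      calc _ ≤ 2 * expansionCoeff Γ ℓ 0 * 1 := mul_le_mul (hτ ℓ) (abs_legendre_le_one ℓ hθ)
            (abs_nonneg _) (mul_nonneg zero_le_two (hZ.expansionCoeff_nonneg hΓ ℓ))
        _ = _ := mul_one _)
  have e : (∑' ℓ, (minimalMultipoles Γ β b).indicator (fun ℓ => expansionCoeff Γ ℓ 0) ℓ *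
      (legendre ℓ).eval θ) = partialSection Γ (minimalMultipoles Γ β b) θ := by
    rw [partialSection, tsum_subtype (minimalMultipoles Γ β b)
      fun ℓ => expansionCoeff Γ ℓ 0 * (legendre ℓ).eval θ]
    congr 1
    ext ℓ
    rw [Set.indicator_mul_left]
  rw [e] at h
  refine h.congr fun τ => ?_
  rw [← (hZ.hasSum_expansion hΓ τ hθ).tsum_eq, ← tsum_mul_left]
  simp only [mul_assoc]

end Covariance

/-! ### Limits of the rescaled kernels -/

section Kernels

variable {Ω : Type*} [MeasurableSpace Ω] {P : Measure Ω}
  {Z : S2 × ℝ → Ω → ℝ} {Γ : ℝ → ℝ → ℝ}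

/-- `∫∫ arcsin Γ(⟨x,y⟩, τ) / (2π) dx dy`, the covariance of the excursion area at level `0`. -/
def arcsinKernel (Γ : ℝ → ℝ → ℝ) (τ : ℝ) : ℝ :=
  4 * Real.pi * ∫ θ in (-1 : ℝ)..1, Real.arcsin (Γ θ τ)

/-- `∫∫ Γ(⟨x,y⟩, τ) ^ 3 / (12π) dx dy`, the covariance of its third chaotic component. -/
def cubeKernel (Γ : ℝ → ℝ → ℝ) (τ : ℝ) : ℝ :=
  2 * Real.pi / 3 * ∫ θ in (-1 : ℝ)..1, Γ θ τ ^ 3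

lemma continuous_swap_field (hΓ : Continuous fun q : ℝ × ℝ => Γ q.1 q.2) :
    Continuous (Function.uncurry fun τ θ => Γ θ τ) :=
  hΓ.comp (continuous_snd.prodMk continuous_fst)

lemma continuous_arcsinKernel (hΓ : Continuous fun q : ℝ × ℝ => Γ q.1 q.2) :
    Continuous (arcsinKernel Γ) :=
  continuous_const.mul (intervalIntegral.continuous_parametric_intervalIntegral_of_continuous'
    (f := fun τ θ => Real.arcsin (Γ θ τ))
    (Real.continuous_arcsin.comp (continuous_swap_field hΓ)) _ _)

lemma continuous_cubeKernel (hΓ : Continuous fun q : ℝ × ℝ => Γ q.1 q.2) :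
    Continuous (cubeKernel Γ) :=
  continuous_const.mul (intervalIntegral.continuous_parametric_intervalIntegral_of_continuous'
    (f := fun τ θ => Γ θ τ ^ 3) (by
      have := continuous_swap_field hΓ
      simp only [Function.uncurry_def] at this ⊢
      exact this.pow 3) _ _)

lemma uIoc_subset_Icc {θ : ℝ} (hθ : θ ∈ Set.uIoc (-1 : ℝ) 1) : θ ∈ Set.Icc (-1 : ℝ) 1 := by
  rw [Set.uIoc_of_le (by norm_num)] at hθ
  exact ⟨hθ.1.le, hθ.2⟩

lemma uIcc_subset_Icc {θ : ℝ} (hθ : θ ∈ Set.uIcc (-1 : ℝ) 1) : θ ∈ Set.Icc (-1 : ℝ) 1 := by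
  rwa [Set.uIcc_of_le (by norm_num)] at hθ

lemma rpow_cube {τ : ℝ} (hτ : 0 ≤ τ) (b : ℝ) : (τ ^ b) ^ 3 = τ ^ (3 * b) := by
  rw [← Real.rpow_natCast, ← Real.rpow_mul hτ]
  congr 1
  push_cast
  ring

variable [IsProbabilityMeasure P] {α b : ℝ} {β : ℕ → ℝ}

lemma IsSphereTimeField.tendsto_cubeKernel (hZ : IsSphereTimeField P Z Γ)
    (hΓ : Continuous fun q : ℝ × ℝ => Γ q.1 q.2) (hβ : MemoryCondition Γ α β) (hb0 : 0 ≤ b)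
    (hb1 : b < 1) (hle : ∀ ℓ ∈ multipoles Γ, b ≤ β ℓ) :
    Tendsto (fun τ => τ ^ (3 * b) * cubeKernel Γ τ) atTop
      (𝓝 (2 * Real.pi / 3 *
        ∫ θ in (-1 : ℝ)..1, partialSection Γ (minimalMultipoles Γ β b) θ ^ 3)) := by
  obtain ⟨D, hD⟩ := hZ.eventually_abs_field_le hΓ hβ hb0 hb1 hle
  have h := intervalIntegral.tendsto_integral_filter_of_dominated_convergence (μ := volume)
    (a := -1) (b := 1) (l := atTop) (F := fun τ θ => (τ ^ b * Γ θ τ) ^ 3)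
    (f := fun θ => partialSection Γ (minimalMultipoles Γ β b) θ ^ 3) (fun _ => D ^ 3)
    (Eventually.of_forall fun τ => by
      have := continuous_section hΓ τ
      apply Continuous.aestronglyMeasurable
      fun_prop)
    (by
      filter_upwards [hD] with τ hτ
      refine Eventually.of_forall fun θ hθ => ?_
      rw [norm_pow]
      exact pow_le_pow_left₀ (norm_nonneg _) (hτ θ (uIoc_subset_Icc hθ)) 3)
    intervalIntegrable_const
    (Eventually.of_forall fun θ hθ =>
      (hZ.tendsto_field hΓ hβ hb0 hb1 hle (uIoc_subset_Icc hθ)).pow 3)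
  refine (h.const_mul (2 * Real.pi / 3)).congr' ?_
  filter_upwards [eventually_ge_atTop 0] with τ hτ
  simp only [mul_pow, rpow_cube hτ]
  rw [intervalIntegral.integral_const_mul, cubeKernel]
  ring

/-- Here `arcsin Γ - Γ = Γ³ · arcsinRatio Γ`. The rescaled cube converges boundedly, and the ratio
is bounded and tends to `1/6` because `Γ → 0`. -/
lemma IsSphereTimeField.tendsto_integral_arcsin_sub (hZ : IsSphereTimeField P Z Γ)
    (hΓ : Continuous fun q : ℝ × ℝ => Γ q.1 q.2) (hβ : MemoryCondition Γ α β) (hb0 : 0 < b)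
    (hb1 : b < 1) (hle : ∀ ℓ ∈ multipoles Γ, b ≤ β ℓ) :
    Tendsto (fun τ => τ ^ (3 * b) * ∫ θ in (-1 : ℝ)..1, (Real.arcsin (Γ θ τ) - Γ θ τ)) atTop
      (𝓝 ((∫ θ in (-1 : ℝ)..1, partialSection Γ (minimalMultipoles Γ β b) θ ^ 3) * (1 / 6))) := by
  obtain ⟨D, hD⟩ := hZ.eventually_abs_field_le hΓ hβ hb0.le hb1 hle
  obtain ⟨M, hM⟩ := exists_arcsinRatio_bound
  have hfield {θ : ℝ} (hθ : θ ∈ Set.Icc (-1 : ℝ) 1) : Tendsto (fun τ => Γ θ τ) atTop (𝓝 0) := by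
    have h := (tendsto_rpow_neg_atTop hb0).mul (hZ.tendsto_field hΓ hβ hb0.le hb1 hle hθ)
    rw [zero_mul] at h
    refine h.congr' ?_
    filter_upwards [eventually_gt_atTop 0] with τ hτ
    rw [← mul_assoc, ← Real.rpow_add hτ, neg_add_cancel, Real.rpow_zero, one_mul]
  have h := intervalIntegral.tendsto_integral_filter_of_dominated_convergence (μ := volume)
    (a := -1) (b := 1) (l := atTop) (F := fun τ θ => (τ ^ b * Γ θ τ) ^ 3 * arcsinRatio (Γ θ τ))
    (f := fun θ => partialSection Γ (minimalMultipoles Γ β b) θ ^ 3 * (1 / 6))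
    (fun _ => D ^ 3 * M)
    (Eventually.of_forall fun τ => by
      have := continuous_section hΓ τ
      have := continuous_arcsinRatio
      apply Continuous.aestronglyMeasurable
      fun_prop)
    (by
      filter_upwards [hD] with τ hτ
      refine Eventually.of_forall fun θ hθ => ?_
      have hθ' := uIoc_subset_Icc hθ
      rw [norm_mul, norm_pow]
      have h1 : ‖τ ^ b * Γ θ τ‖ ≤ D := hτ θ hθ'
      have hD0 : 0 ≤ D := (norm_nonneg _).trans h1
      exact mul_le_mul (pow_le_pow_left₀ (norm_nonneg _) h1 3) (hM _ (hZ.mem_Icc hθ' τ))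
        (norm_nonneg _) (by positivity))
    intervalIntegrable_const
    (Eventually.of_forall fun θ hθ => by
      have hθ' := uIoc_subset_Icc hθ
      refine ((hZ.tendsto_field hΓ hβ hb0.le hb1 hle hθ').pow 3).mul ?_
      have := continuous_arcsinRatio.tendsto 0
      rw [show arcsinRatio 0 = 1 / 6 by simp [arcsinRatio]] at this
      exact this.comp (hfield hθ'))
  rw [intervalIntegral.integral_mul_const] at h
  refine h.congr' ?_
  filter_upwards [eventually_ge_atTop 0] with τ hτ
  rw [← intervalIntegral.integral_const_mul]
  congr 1
  ext θ
  rw [arcsin_sub_self, mul_pow, rpow_cube hτ, mul_assoc]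

lemma powerSpectrum_zero_eq (Γ : ℝ → ℝ → ℝ) (τ : ℝ) :
    powerSpectrum Γ 0 τ = 2 * Real.pi * ∫ θ in (-1 : ℝ)..1, Γ θ τ := by
  simp [powerSpectrum]

/-- The linear part of the arcsine integrates to `2 C_0(τ)`, which `h3` makes negligible; hence the
limit is that of `cubeKernel`. -/
lemma IsSphereTimeField.tendsto_arcsinKernel (hZ : IsSphereTimeField P Z Γ)
    (hΓ : Continuous fun q : ℝ × ℝ => Γ q.1 q.2) (hβ : MemoryCondition Γ α β) (hb0 : 0 < b)
    (hb1 : b < 1) (hle : ∀ ℓ ∈ multipoles Γ, b ≤ β ℓ)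
    (h3 : 3 * b < if β 0 = 1 then α else β 0) :
    Tendsto (fun τ => τ ^ (3 * b) * arcsinKernel Γ τ) atTop
      (𝓝 (2 * Real.pi / 3 *
        ∫ θ in (-1 : ℝ)..1, partialSection Γ (minimalMultipoles Γ β b) θ ^ 3)) := by
  have h1 := (hZ.tendsto_integral_arcsin_sub hΓ hβ hb0 hb1 hle).const_mul (4 * Real.pi)
  have h2 := (hβ.tendsto_powerSpectrum hβ.zero_mem h3.le).const_mul 2
  rw [if_neg h3.ne', mul_zero] at h2
  have h := h1.add h2
  rw [add_zero] at h
  have e : ∀ x : ℝ, 4 * Real.pi * (x * (1 / 6)) = 2 * Real.pi / 3 * x := fun x => by ring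
  rw [e] at h
  refine h.congr fun τ => ?_
  have hc := continuous_section hΓ τ
  have hc' : Continuous fun θ => Real.arcsin (Γ θ τ) := Real.continuous_arcsin.comp hc
  rw [intervalIntegral.integral_sub (hc'.intervalIntegrable _ _) (hc.intervalIntegrable _ _),
    powerSpectrum_zero_eq, arcsinKernel]
  ring

end Kernels

/-! ### The Gaunt series as the integral of a cube -/

section Gaunt

lemma gaunt_eq (a b c : ℕ) : gaunt a b c =
    √((2 * a + 1) / (4 * Real.pi)) * √((2 * b + 1) / (4 * Real.pi)) *
      √((2 * c + 1) / (4 * Real.pi)) * (2 * Real.pi * tripleIntegral a b c) := by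
  have h := sphere_integral_polynomial (legendre a * legendre b * legendre c)
  simp only [eval_mul] at h
  rw [tripleIntegral, ← h, ← integral_const_mul, gaunt]
  congr 1
  ext x
  unfold zonal
  ring

/-- Each normalising root occurs twice, in the Gaunt integral and in the weight, and so becomes the
rational factor of `expansionCoeff`. -/
lemma gauntTerm_eq (Γ : ℝ → ℝ → ℝ) (ℓ : Fin 3 → ℕ) :
    gauntTerm Γ ℓ = 2 * Real.pi * tripleIntegral (ℓ 0) (ℓ 1) (ℓ 2) *
      (expansionCoeff Γ (ℓ 0) 0 * expansionCoeff Γ (ℓ 1) 0 * expansionCoeff Γ (ℓ 2) 0) := by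
  have hpi := Real.pi_pos
  have hs (n : ℕ) : √((2 * (n : ℝ) + 1) / (4 * Real.pi)) * √((2 * (n : ℝ) + 1) / (4 * Real.pi)) =
      (2 * n + 1) / (4 * Real.pi) := Real.mul_self_sqrt (by positivity)
  have h0 := hs (ℓ 0)
  have h1 := hs (ℓ 1)
  have h2 := hs (ℓ 2)
  rw [gauntTerm, gaunt_eq, Fin.prod_univ_three]
  unfold expansionCoeff
  generalize √((2 * (ℓ 0 : ℝ) + 1) / (4 * Real.pi)) = s₀ at *
  generalize √((2 * (ℓ 1 : ℝ) + 1) / (4 * Real.pi)) = s₁ at *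
  generalize √((2 * (ℓ 2 : ℝ) + 1) / (4 * Real.pi)) = s₂ at *
  rw [← h0, ← h1, ← h2]
  ring

variable {Γ : ℝ → ℝ → ℝ} {I : Set ℕ}

lemma gauntTerm_nonneg (h0 : ∀ ℓ, 0 ≤ expansionCoeff Γ ℓ 0) (ℓ : Fin 3 → ℕ) :
    0 ≤ gauntTerm Γ ℓ := by
  have hpi := Real.pi_pos
  have := tripleIntegral_nonneg (ℓ 0) (ℓ 1) (ℓ 2)
  have := h0 (ℓ 0)
  have := h0 (ℓ 1)
  have := h0 (ℓ 2)
  rw [gauntTerm_eq]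
  positivity

/-- Triples of indices as nested pairs. -/
def tripleEquiv (I : Set ℕ) : (Fin 3 → I) ≃ (I × I) × I where
  toFun f := ((f 0, f 1), f 2)
  invFun p := ![p.1.1, p.1.2, p.2]
  left_inv f := by
    ext i
    fin_cases i <;> rfl
  right_inv _ := rfl

lemma hasSum_triple_mul {ι : Type*} {f : ι → ℝ} (hf : Summable fun i => ‖f i‖) :
    HasSum (fun p : (ι × ι) × ι => f p.1.1 * f p.1.2 * f p.2) ((∑' i, f i) ^ 3) := by
  have h1 : HasSum f (∑' i, f i) := hf.of_norm.hasSum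
  have h2 := h1.mul h1 (summable_mul_of_summable_norm hf hf)
  have h2n : Summable fun p : ι × ι => ‖f p.1 * f p.2‖ := hf.mul_norm hf
  have h3 := h2.mul h1 (summable_mul_of_summable_norm h2n hf)
  rwa [show (∑' i, f i) ^ 3 = (∑' i, f i) * (∑' i, f i) * ∑' i, f i by ring]

/-- The cube of an absolutely convergent series is multiplied out and integrated term by term;
`|P_ℓ| ≤ 1` provides a majorant independent of `θ`. -/
lemma hasSum_gauntTerm (h0 : ∀ ℓ, 0 ≤ expansionCoeff Γ ℓ 0)
    (hs : Summable fun ℓ => expansionCoeff Γ ℓ 0) :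
    HasSum (fun ℓ : Fin 3 → I => gauntTerm Γ fun i => ℓ i)
      (2 * Real.pi * ∫ θ in (-1 : ℝ)..1, partialSection Γ I θ ^ 3) := by
  have hc : Summable fun ℓ : I => expansionCoeff Γ ℓ 0 := hs.subtype I
  have hterm {θ : ℝ} (hθ : θ ∈ Set.Icc (-1 : ℝ) 1) (ℓ : I) :
      ‖expansionCoeff Γ ℓ 0 * (legendre ℓ).eval θ‖ ≤ expansionCoeff Γ ℓ 0 := by
    rw [norm_mul, Real.norm_of_nonneg (h0 ℓ)]
    exact mul_le_of_le_one_right (h0 ℓ) (abs_legendre_le_one ℓ hθ)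
  have hcc := (hasSum_triple_mul hc.norm).summable
  have hint := intervalIntegral.hasSum_integral_of_dominated_convergence (μ := volume)
    (a := -1) (b := 1) (F := fun (p : (I × I) × I) θ =>
      (expansionCoeff Γ p.1.1 0 * (legendre p.1.1).eval θ) *
      (expansionCoeff Γ p.1.2 0 * (legendre p.1.2).eval θ) *
      (expansionCoeff Γ p.2 0 * (legendre p.2).eval θ))
    (f := fun θ => partialSection Γ I θ ^ 3)
    (fun p _ => expansionCoeff Γ p.1.1 0 * expansionCoeff Γ p.1.2 0 * expansionCoeff Γ p.2 0)
    (fun p => by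
      apply Continuous.aestronglyMeasurable
      fun_prop)
    (fun p => Eventually.of_forall fun θ hθ => by
      have hθ' := uIoc_subset_Icc hθ
      rw [norm_mul, norm_mul]
      exact mul_le_mul (mul_le_mul (hterm hθ' _) (hterm hθ' _) (norm_nonneg _) (h0 _))
        (hterm hθ' _) (norm_nonneg _) (mul_nonneg (h0 _) (h0 _)))
    (Eventually.of_forall fun _ _ => hcc) intervalIntegrable_const
    (Eventually.of_forall fun θ hθ =>
      hasSum_triple_mul (f := fun ℓ : I => expansionCoeff Γ ℓ 0 * (legendre ℓ).eval θ)
        (Summable.of_norm_bounded hc fun ℓ =>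
          (norm_norm _).trans_le (hterm (uIoc_subset_Icc hθ) ℓ)))
  rw [← (tripleEquiv I).symm.hasSum_iff]
  have hfun : ((fun ℓ : Fin 3 → I => gauntTerm Γ fun i => ℓ i) ∘ (tripleEquiv I).symm) = fun p =>
      2 * Real.pi * ∫ θ in (-1 : ℝ)..1, (expansionCoeff Γ p.1.1 0 * (legendre p.1.1).eval θ) *
      (expansionCoeff Γ p.1.2 0 * (legendre p.1.2).eval θ) *
      (expansionCoeff Γ p.2 0 * (legendre p.2).eval θ) := by
    funext p
    change gauntTerm Γ (fun i => ((tripleEquiv I).symm p i : ℕ)) = _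
    rw [gauntTerm_eq, tripleIntegral, mul_assoc, ← intervalIntegral.integral_mul_const]
    congr 2
    ext θ
    change (legendre p.1.1).eval θ * (legendre p.1.2).eval θ * (legendre p.2).eval θ *
      (expansionCoeff Γ p.1.1 0 * expansionCoeff Γ p.1.2 0 * expansionCoeff Γ p.2 0) = _
    ring
  rw [hfun]
  exact hint.mul_left (2 * Real.pi)

/-- All terms are nonnegative, and the diagonal term at an even `ℓ` is positive. -/
lemma gauntSum_pos (h0 : ∀ ℓ, 0 ≤ expansionCoeff Γ ℓ 0)
    (hs : Summable fun ℓ => expansionCoeff Γ ℓ 0) {ℓ : ℕ} (hℓ : ℓ ∈ I) (he : Even ℓ)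
    (hpos : 0 < expansionCoeff Γ ℓ 0) : 0 < gauntSum Γ I := by
  refine (hasSum_gauntTerm h0 hs).summable.tsum_pos (fun _ => gauntTerm_nonneg h0 _)
    (fun _ => ⟨ℓ, hℓ⟩) ?_
  rw [gauntTerm_eq]
  have hpi := Real.pi_pos
  have := tripleIntegral_self_pos he
  positivity

end Gaunt

/-! ### Second moments of the excursion statistic and its remainder -/

section Statistic

variable {Ω : Type*} [MeasurableSpace Ω] {P : Measure Ω}
  {Z : S2 × ℝ → Ω → ℝ} {Γ : ℝ → ℝ → ℝ}

/-- The product measure on `𝕊² × [0,T]`. -/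
abbrev cylinder (T : ℝ) : Measure (S2 × ℝ) := area.prod (volume.restrict (Set.Icc 0 T))

instance (T : ℝ) : IsFiniteMeasure (volume.restrict (Set.Icc (0 : ℝ) T)) :=
  isFiniteMeasure_restrict.mpr measure_Icc_lt_top.ne

lemma IsSphereTimeField.exists_bound (hZ : IsSphereTimeField P Z Γ) {k : ℝ → ℝ}
    (hk : Continuous k) : ∃ M, ∀ (x y : S2) (τ : ℝ), ‖k (Γ (inner ℝ x.1 y.1) τ)‖ ≤ M := by
  obtain ⟨M, hM⟩ := isCompact_Icc.exists_bound_of_continuousOn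
    (hk.continuousOn (s := Set.Icc (-1 : ℝ) 1))
  exact ⟨M, fun x y τ => hM _ (hZ.mem_Icc (inner_mem_Icc x y) τ)⟩

lemma continuous_integral_field (hΓ : Continuous fun q : ℝ × ℝ => Γ q.1 q.2) {k : ℝ → ℝ}
    (hk : Continuous k) : Continuous fun τ => ∫ θ in (-1 : ℝ)..1, k (Γ θ τ) :=
  intervalIntegral.continuous_parametric_intervalIntegral_of_continuous'
    (f := fun τ θ => k (Γ θ τ)) (hk.comp (continuous_swap_field hΓ)) _ _

lemma setIntegral_Icc_eq {T : ℝ} (hT : 0 ≤ T) (f : ℝ → ℝ) :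
    ∫ t in Set.Icc 0 T, f t = ∫ t in (0 : ℝ)..T, f t := by
  rw [integral_Icc_eq_integral_Ioc, intervalIntegral.integral_of_le hT]

/-- The integrals over two points of the sphere reduce by Archimedes' theorem to `4π · 2π ∫ dθ`,
which explains the factor `8π²`; evenness in time then gives the triangle weight. -/
lemma IsSphereTimeField.integral_cylinder_kernel (hZ : IsSphereTimeField P Z Γ)
    (hΓ : Continuous fun q : ℝ × ℝ => Γ q.1 q.2) {k κ : ℝ → ℝ} (hk : Continuous k)
    (hκ : ∀ τ, κ τ = 8 * Real.pi ^ 2 * ∫ θ in (-1 : ℝ)..1, k (Γ θ τ)) {T : ℝ} (hT : 0 ≤ T) :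
    ∫ p, ∫ q, k (Γ (inner ℝ p.1.1 q.1.1) (p.2 - q.2)) ∂(cylinder T) ∂(cylinder T) =
      2 * triangleIntegral κ T := by
  obtain ⟨M, hM⟩ := hZ.exists_bound hk
  have hc := continuous_integral_field hΓ hk
  have hκc : Continuous κ := by
    rw [funext hκ]
    exact continuous_const.mul hc
  have heven (τ : ℝ) : κ (-τ) = κ τ := by
    rw [hκ, hκ]
    congr 1
    exact intervalIntegral.integral_congr fun θ hθ => by
      simp only [hZ.symm (uIcc_subset_Icc hθ)]
  have hjoint : Continuous fun z : (S2 × ℝ) × (S2 × ℝ) =>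
      k (Γ (inner ℝ z.1.1.1 z.2.1.1) (z.1.2 - z.2.2)) :=
    hk.comp (hΓ.comp ((continuous_inner_sphere (continuous_fst.comp continuous_fst)
      (continuous_fst.comp continuous_snd)).prodMk (by fun_prop)))
  have hinner (p : S2 × ℝ) :
      ∫ q, k (Γ (inner ℝ p.1.1 q.1.1) (p.2 - q.2)) ∂(cylinder T) =
        ∫ s in (0 : ℝ)..T, 2 * Real.pi * ∫ θ in (-1 : ℝ)..1, k (Γ θ (p.2 - s)) := by
    rw [integral_prod_symm, setIntegral_Icc_eq hT]
    · congr 1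
      ext s
      exact sphere_integral_inner (h := fun θ => k (Γ θ (p.2 - s)))
        (hk.comp (continuous_section hΓ _)) p.1
    · refine Integrable.of_bound ?_ M (Eventually.of_forall fun q => hM _ _ _)
      exact (hjoint.comp (continuous_const.prodMk continuous_id)).aestronglyMeasurable
  simp only [hinner]
  have hg : Continuous fun t => ∫ s in (0 : ℝ)..T,
      2 * Real.pi * ∫ θ in (-1 : ℝ)..1, k (Γ θ (t - s)) := by
    refine intervalIntegral.continuous_parametric_intervalIntegral_of_continuous' ?_ _ _
    exact continuous_const.mul (hc.comp (continuous_fst.sub continuous_snd))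
  have hgi : IntegrableOn (fun t => ∫ s in (0 : ℝ)..T,
      2 * Real.pi * ∫ θ in (-1 : ℝ)..1, k (Γ θ (t - s))) (Set.Icc 0 T) :=
    hg.continuousOn.integrableOn_compact isCompact_Icc
  rw [integral_prod_symm _ (hgi.comp_snd area), setIntegral_Icc_eq hT,
    ← integral_integral_sub_eq hκc heven]
  congr 1
  ext t
  simp only
  rw [integral_const, area_real_univ, smul_eq_mul, ← intervalIntegral.integral_const_mul]
  congr 1
  ext s
  rw [hκ]
  ring

lemma IsSphereTimeField.measurable_apply (hZ : IsSphereTimeField P Z Γ) (ω : Ω) :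
    Measurable fun p => Z p ω := hZ.measurable.comp (measurable_const.prodMk measurable_id)

/-- The constant `2π` is half the area of the sphere, and it is also the mean, so centring the area
amounts to centring the indicator. -/
lemma IsSphereTimeField.excursionArea_eq (hZ : IsSphereTimeField P Z Γ) (t : ℝ) (ω : Ω) :
    excursionArea Z 0 t ω = (∫ x, centredSign (Z (x, t) ω) ∂area) + 2 * Real.pi := by
  have hm : Measurable fun x : S2 => Z (x, t) ω :=
    (hZ.measurable_apply ω).comp (measurable_id.prodMk measurable_const)
  have hi : Integrable (fun x : S2 => centredSign (Z (x, t) ω)) area :=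
    Integrable.of_bound (measurable_centredSign.comp hm).aestronglyMeasurable 1
      (Eventually.of_forall fun _ => abs_centredSign_le _)
  have hset : MeasurableSet {x : S2 | 0 ≤ Z (x, t) ω} := measurableSet_le measurable_const hm
  have h1 : ∫ x, (centredSign (Z (x, t) ω) + 1 / 2) ∂area = excursionArea Z 0 t ω := by
    rw [excursionArea, ← integral_indicator_one hset]
    congr 1
    ext x
    by_cases hx : 0 ≤ Z (x, t) ω <;> simp [centredSign, halfLine, Set.indicator, hx]
  rw [← h1, integral_add hi (integrable_const _), integral_const, area_real_univ, smul_eq_mul]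
  ring

variable [IsProbabilityMeasure P]

lemma IsSphereTimeField.integral_sq_cylinder (hZ : IsSphereTimeField P Z Γ)
    (hΓ : Continuous fun q : ℝ × ℝ => Γ q.1 q.2) {f k κ : ℝ → ℝ} (hf : Measurable f)
    (hf2 : MemLp f 2 stdNormal) (hk : Continuous k)
    (hcov : ∀ p q, ∫ ω, f (Z p ω) * f (Z q ω) ∂P = k (Γ (inner ℝ p.1.1 q.1.1) (p.2 - q.2)))
    (hκ : ∀ τ, κ τ = 8 * Real.pi ^ 2 * ∫ θ in (-1 : ℝ)..1, k (Γ θ τ)) {T : ℝ} (hT : 0 ≤ T) :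
    ∫ ω, (∫ p, f (Z p ω) ∂(cylinder T)) ^ 2 ∂P = 2 * triangleIntegral κ T := by
  have hB := hZ.boundedSecondMoment hf hf2
  have h := hB.integral_mul hB (cylinder T) (cylinder T)
  simp only [hcov] at h
  rw [← hZ.integral_cylinder_kernel hΓ hk hκ hT, ← h]
  simp only [sq]

lemma IsSphereTimeField.integrable_sq_cylinder (hZ : IsSphereTimeField P Z Γ) {f : ℝ → ℝ}
    (hf : Measurable f) (hf2 : MemLp f 2 stdNormal) (T : ℝ) :
    Integrable (fun ω => (∫ p, f (Z p ω) ∂(cylinder T)) ^ 2) P := by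
  have hB := hZ.boundedSecondMoment hf hf2
  simpa only [sq] using hB.integrable_integral_mul hB (cylinder T) (cylinder T)

lemma IsSphereTimeField.integral_cylinder_centredSign (hZ : IsSphereTimeField P Z Γ)
    {γ : Type*} [MeasurableSpace γ] (m : Measure γ) [IsFiniteMeasure m] {e : γ → S2 × ℝ}
    (he : Measurable e) : ∫ ω, ∫ p, centredSign (Z (e p) ω) ∂m ∂P = 0 := by
  have hm : Measurable fun z : Ω × γ => Z (e z.2) z.1 :=
    hZ.measurable.comp (measurable_fst.prodMk (he.comp measurable_snd))
  have hi : Integrable (fun z : Ω × γ => centredSign (Z (e z.2) z.1)) (P.prod m) :=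
    Integrable.of_bound (measurable_centredSign.comp hm).aestronglyMeasurable 1
      (Eventually.of_forall fun _ => abs_centredSign_le _)
  rw [integral_integral_swap hi]
  have h (p : γ) : ∫ ω, centredSign (Z (e p) ω) ∂P = 0 :=
    ((hZ.isStdPair (e p) (e p)).integral_fst measurable_centredSign).trans integral_centredSign
  simp [h]

lemma IsSphereTimeField.integral_excursionArea (hZ : IsSphereTimeField P Z Γ) (t : ℝ) :
    ∫ ω, excursionArea Z 0 t ω ∂P = 2 * Real.pi := by
  have he : Measurable fun x : S2 => (x, t) := measurable_id.prodMk measurable_const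
  have hm : Measurable fun z : Ω × S2 => centredSign (Z (z.2, t) z.1) :=
    measurable_centredSign.comp (hZ.measurable.comp (measurable_fst.prodMk
      (he.comp measurable_snd)))
  have hi : Integrable (fun z : Ω × S2 => centredSign (Z (z.2, t) z.1)) (P.prod area) :=
    Integrable.of_bound hm.aestronglyMeasurable 1 (Eventually.of_forall fun _ => abs_centredSign_le _)
  simp only [hZ.excursionArea_eq]
  rw [integral_add hi.integral_prod_left (integrable_const _),
    hZ.integral_cylinder_centredSign area he]
  simp

lemma IsSphereTimeField.excursionStat_eq (hZ : IsSphereTimeField P Z Γ) (T : ℝ) :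
    excursionStat P Z 0 T = fun ω => ∫ p, centredSign (Z p ω) ∂(cylinder T) := by
  ext ω
  rw [excursionStat, integral_prod_symm]
  · congr 1
    ext t
    rw [hZ.integral_excursionArea, hZ.excursionArea_eq, add_sub_cancel_right]
  · exact Integrable.of_bound
      (measurable_centredSign.comp (hZ.measurable_apply ω)).aestronglyMeasurable 1
      (Eventually.of_forall fun _ => abs_centredSign_le _)

lemma IsSphereTimeField.variance_excursionStat (hZ : IsSphereTimeField P Z Γ)
    (hΓ : Continuous fun q : ℝ × ℝ => Γ q.1 q.2) {T : ℝ} (hT : 0 ≤ T) :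
    variance (excursionStat P Z 0 T) P = 2 * triangleIntegral (arcsinKernel Γ) T := by
  have hm : Measurable fun z : Ω × (S2 × ℝ) => centredSign (Z z.2 z.1) :=
    measurable_centredSign.comp hZ.measurable
  rw [hZ.excursionStat_eq, variance_of_integral_eq_zero
    hm.stronglyMeasurable.integral_prod_right'.measurable.aemeasurable
    (hZ.integral_cylinder_centredSign (cylinder T) measurable_id)]
  refine hZ.integral_sq_cylinder hΓ (k := fun x => Real.arcsin x / (2 * Real.pi))
    measurable_centredSign memLp_centredSign (Real.continuous_arcsin.div_const _)
    (fun p q => (hZ.isStdPair p q).integral_centredSign) (fun τ => ?_) hT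
  have hpi := Real.pi_pos.ne'
  rw [intervalIntegral.integral_div, arcsinKernel]
  field_simp
  ring

lemma IsSphereTimeField.integral_sq_signRemainder (hZ : IsSphereTimeField P Z Γ)
    (hΓ : Continuous fun q : ℝ × ℝ => Γ q.1 q.2) {T : ℝ} (hT : 0 ≤ T) :
    ∫ ω, (∫ p, signRemainder (Z p ω) ∂(cylinder T)) ^ 2 ∂P =
      2 * (triangleIntegral (arcsinKernel Γ) T - triangleIntegral (cubeKernel Γ) T) := by
  have hA := continuous_arcsinKernel hΓ
  have hC := continuous_cubeKernel hΓ
  have hsub : triangleIntegral (arcsinKernel Γ) T - triangleIntegral (cubeKernel Γ) T =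
      triangleIntegral (fun τ => arcsinKernel Γ τ - cubeKernel Γ τ) T := by
    unfold triangleIntegral
    rw [← intervalIntegral.integral_sub]
    · simp only [mul_sub]
    · exact Continuous.intervalIntegrable (by fun_prop) _ _
    · exact Continuous.intervalIntegrable (by fun_prop) _ _
  rw [hsub]
  refine hZ.integral_sq_cylinder hΓ
    (k := fun x => Real.arcsin x / (2 * Real.pi) - x ^ 3 / (12 * Real.pi))
    measurable_signRemainder memLp_signRemainder ?_
    (fun p q => (hZ.isStdPair p q).integral_signRemainder) (fun τ => ?_) hT
  · have := Real.continuous_arcsin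
    fun_prop
  · have hpi := Real.pi_pos.ne'
    have hc := continuous_section hΓ τ
    have hc' : Continuous fun θ => Real.arcsin (Γ θ τ) := Real.continuous_arcsin.comp hc
    rw [intervalIntegral.integral_sub, intervalIntegral.integral_div, intervalIntegral.integral_div,
      arcsinKernel, cubeKernel]
    · field_simp
      ring
    · exact Continuous.intervalIntegrable (by fun_prop) _ _
    · exact Continuous.intervalIntegrable (by fun_prop) _ _

/-- Chebyshev's inequality. -/
lemma tendstoInMeasure_of_integral_sq {R : ℝ → Ω → ℝ}
    (hint : ∀ T, Integrable (fun ω => R T ω ^ 2) P)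
    (h : Tendsto (fun T => ∫ ω, R T ω ^ 2 ∂P) atTop (𝓝 0)) :
    TendstoInMeasure P R atTop fun _ => 0 := by
  rw [tendstoInMeasure_iff_measureReal_norm]
  intro ε hε
  have h' := h.div_const (ε ^ 2)
  rw [zero_div] at h'
  refine squeeze_zero (fun _ => measureReal_nonneg) (fun T => ?_) h'
  rw [le_div_iff₀ (by positivity), mul_comm]
  have hset : {ω | ε ≤ ‖R T ω - 0‖} = {ω | ε ^ 2 ≤ R T ω ^ 2} := by
    ext ω
    simp only [sub_zero, Set.mem_ofPred_eq, Real.norm_eq_abs]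
    rw [← sq_abs (R T ω), pow_le_pow_iff_left₀ hε.le (abs_nonneg _) two_ne_zero]
  rw [hset]
  exact mul_meas_ge_le_integral_of_nonneg (Eventually.of_forall fun _ => sq_nonneg _) (hint T) _

/-- Only almost sure: splitting the integral needs `H₃(Z)` integrable on the cylinder, which Fubini
gives for almost every path. -/
lemma IsSphereTimeField.normalized_sub_ae_eq (hZ : IsSphereTimeField P Z Γ) (T : ℝ) :
    (fun ω => 1 / √(variance (excursionStat P Z 0 T) P) *
      ∫ p, signRemainder (Z p ω) ∂(cylinder T)) =ᵐ[P]
    fun ω => excursionStatNormalized P Z 0 T ω -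
      (-(1 / √(variance (excursionStat P Z 0 T) P) / ((3 ! : ℝ) * √(2 * Real.pi))) *
        thirdHermiteIntegral Z T ω) := by
  have h := ((hZ.boundedSecondMoment continuous_H3.measurable memLp_H3).integrable
    (cylinder T)).prod_right_ae
  filter_upwards [h] with ω hω
  have hs : Integrable (fun p => centredSign (Z p ω)) (cylinder T) :=
    Integrable.of_bound (measurable_centredSign.comp (hZ.measurable_apply ω)).aestronglyMeasurable 1
      (Eventually.of_forall fun _ => abs_centredSign_le _)
  have e : ∫ p, signRemainder (Z p ω) ∂(cylinder T) = excursionStat P Z 0 T ω +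
      1 / (6 * √(2 * Real.pi)) * thirdHermiteIntegral Z T ω := by
    unfold signRemainder
    rw [integral_add hs (hω.const_mul _), integral_const_mul, hZ.excursionStat_eq,
      thirdHermiteIntegral]
  rw [e, excursionStatNormalized]
  norm_num [Nat.factorial]
  ring

/-- The second moment of the difference is `(A - C)/A`, with `A` and `C` the triangle integrals of
the two kernels. After division by `N` both tend to the same `c > 0`. -/
lemma IsSphereTimeField.tendstoInMeasure_remainder (hZ : IsSphereTimeField P Z Γ)
    (hΓ : Continuous fun q : ℝ × ℝ => Γ q.1 q.2) {N : ℝ → ℝ} {c : ℝ} (hc : 0 < c)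
    (hN : ∀ᶠ T in atTop, N T ≠ 0)
    (hA : Tendsto (fun T => triangleIntegral (arcsinKernel Γ) T / N T) atTop (𝓝 c))
    (hC : Tendsto (fun T => triangleIntegral (cubeKernel Γ) T / N T) atTop (𝓝 c)) :
    TendstoInMeasure P
      (fun (T : ℝ) (ω : Ω) => excursionStatNormalized P Z 0 T ω -
        (-(1 / √(variance (excursionStat P Z 0 T) P) / ((3 ! : ℝ) * √(2 * Real.pi))) *
          thirdHermiteIntegral Z T ω)) atTop (fun _ => 0) := by
  refine TendstoInMeasure.congr_left hZ.normalized_sub_ae_eq ?_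
  refine tendstoInMeasure_of_integral_sq (fun T => ?_) ?_
  · simp only [mul_pow]
    exact (hZ.integrable_sq_cylinder measurable_signRemainder memLp_signRemainder T).const_mul _
  · have h := (hA.sub hC).div hA hc.ne'
    rw [sub_self, zero_div] at h
    refine h.congr' ?_
    filter_upwards [hN, eventually_ge_atTop 0] with T hNT hT
    simp only [mul_pow, Pi.div_apply]
    rw [integral_const_mul, hZ.integral_sq_signRemainder hΓ hT, div_pow, one_pow,
      Real.sq_sqrt (variance_nonneg _ _), hZ.variance_excursionStat hΓ hT, ← sub_div,
      div_div_div_cancel_right₀ hNT, one_div, mul_inv]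
    ring

end Statistic

/-! ### The two regimes for a globally continuous covariance function -/

section ContinuousCovariance

variable {Ω : Type*} [MeasurableSpace Ω] {P : Measure Ω} [IsProbabilityMeasure P]
  {Z : S2 × ℝ → Ω → ℝ} {Γ : ℝ → ℝ → ℝ} {α βs : ℝ} {β : ℕ → ℝ}

lemma IsSphereTimeField.expansionCoeff_pos (hZ : IsSphereTimeField P Z Γ)
    (hΓ : Continuous fun q : ℝ × ℝ => Γ q.1 q.2) {ℓ : ℕ} (hℓ : ℓ ∈ multipoles Γ) :
    0 < expansionCoeff Γ ℓ 0 := by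
  have h0 : 0 < powerSpectrum Γ ℓ 0 := lt_of_le_of_ne (hZ.powerSpectrum_nonneg hΓ ℓ) (Ne.symm hℓ)
  have hpi := Real.pi_pos
  unfold expansionCoeff
  positivity

lemma IsMinimalExponent.pos (hβ : MemoryCondition Γ α β) (hβs : IsMinimalExponent Γ β βs) :
    0 < βs := by
  obtain ⟨ℓ, hℓ, rfl⟩ := hβs.isLeast.1
  exact (hβ.mem_Ioc ℓ hℓ.1).1

lemma IsMinimalExponent.le (hβs : IsMinimalExponent Γ β βs) (h0 : βs ≤ β 0) :
    ∀ ℓ ∈ multipoles Γ, βs ≤ β ℓ := by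
  intro ℓ hℓ
  rcases Nat.eq_zero_or_pos ℓ with rfl | h
  · exact h0
  · exact hβs.isLeast.2 ⟨ℓ, ⟨hℓ, h⟩, rfl⟩

lemma IsSphereTimeField.gauntSum_eq (hZ : IsSphereTimeField P Z Γ)
    (hΓ : Continuous fun q : ℝ × ℝ => Γ q.1 q.2) (I : Set ℕ) :
    gauntSum Γ I = 2 * Real.pi * ∫ θ in (-1 : ℝ)..1, partialSection Γ I θ ^ 3 :=
  (hasSum_gauntTerm (hZ.expansionCoeff_nonneg hΓ) (hZ.summable_expansionCoeff hΓ)).tsum_eq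

/-- In both regimes, the rescaled covariance of the excursion area and that of its third chaotic
component have the same limit. -/
lemma IsSphereTimeField.tendsto_kernels (hZ : IsSphereTimeField P Z Γ)
    (hΓ : Continuous fun q : ℝ × ℝ => Γ q.1 q.2) (hβ : MemoryCondition Γ α β)
    (hβs : IsMinimalExponent Γ β βs)
    (h : 3 * βs < min 1 (β 0) ∨ (β 0 = 1 ∧ 3 * βs = 1)) :
    Tendsto (fun τ => τ ^ (3 * βs) * arcsinKernel Γ τ) atTop
      (𝓝 (gauntSum Γ (minimalMultipoles Γ β βs) / 3)) ∧
    Tendsto (fun τ => τ ^ (3 * βs) * cubeKernel Γ τ) atTop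
      (𝓝 (gauntSum Γ (minimalMultipoles Γ β βs) / 3)) := by
  have hpos := hβs.pos hβ
  have hα := hβ.two_le
  have h1 : 3 * βs ≤ 1 ∧ 3 * βs ≤ β 0 := by
    rcases h with h | h
    · exact ⟨(lt_min_iff.mp h).1.le, (lt_min_iff.mp h).2.le⟩
    · exact ⟨h.2.le, by rw [h.1, h.2]⟩
  -- When `β 0 = 1` the effective rate of `C_0` is `α ≥ 2`, so the inequality is strict even in the
  -- critical case `3 βs = 1`.
  have h3 : 3 * βs < if β 0 = 1 then α else β 0 := by
    split_ifs with h0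
    · linarith
    · rcases h with h | h
      · exact (lt_min_iff.mp h).2
      · exact absurd h.1 h0
  have hle := hβs.le (by linarith)
  have hb1 : βs < 1 := by linarith
  have e := hZ.gauntSum_eq hΓ (minimalMultipoles Γ β βs)
  have e' : gauntSum Γ (minimalMultipoles Γ β βs) / 3 = 2 * Real.pi / 3 *
      ∫ θ in (-1 : ℝ)..1, partialSection Γ (minimalMultipoles Γ β βs) θ ^ 3 := by
    rw [e]
    ring
  rw [e']
  exact ⟨hZ.tendsto_arcsinKernel hΓ hβ hpos hb1 hle h3,
    hZ.tendsto_cubeKernel hΓ hβ hpos.le hb1 hle⟩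

lemma IsSphereTimeField.summable_gauntTerm (hZ : IsSphereTimeField P Z Γ)
    (hΓ : Continuous fun q : ℝ × ℝ => Γ q.1 q.2) (I : Set ℕ) :
    Summable fun ℓ : Fin 3 → I => gauntTerm Γ fun i => ℓ i :=
  (hasSum_gauntTerm (hZ.expansionCoeff_nonneg hΓ) (hZ.summable_expansionCoeff hΓ)).summable

lemma IsSphereTimeField.gauntSum_pos (hZ : IsSphereTimeField P Z Γ)
    (hΓ : Continuous fun q : ℝ × ℝ => Γ q.1 q.2)
    (heven : ∃ ℓ ∈ minimalMultipoles Γ β βs, Even ℓ) :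
    0 < gauntSum Γ (minimalMultipoles Γ β βs) := by
  obtain ⟨ℓ, hℓ, he⟩ := heven
  exact SphereTime.gauntSum_pos (hZ.expansionCoeff_nonneg hΓ) (hZ.summable_expansionCoeff hΓ) hℓ he
    (hZ.expansionCoeff_pos hΓ hℓ.1)

lemma IsSphereTimeField.tendsto_variance_div (hZ : IsSphereTimeField P Z Γ)
    (hΓ : Continuous fun q : ℝ × ℝ => Γ q.1 q.2) {N : ℝ → ℝ} {c d : ℝ}
    (hA : Tendsto (fun T => triangleIntegral (arcsinKernel Γ) T / N T) atTop (𝓝 c))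
    (hd : 2 * c = d) :
    Tendsto (fun T => variance (excursionStat P Z 0 T) P / N T) atTop (𝓝 d) := by
  rw [← hd]
  refine (hA.const_mul 2).congr' ?_
  filter_upwards [eventually_ge_atTop 0] with T hT
  rw [hZ.variance_excursionStat hΓ hT, mul_div_assoc]

/-- Variance asymptotics in the power regime, and the size of the remainder. -/
lemma IsSphereTimeField.power_regime (hZ : IsSphereTimeField P Z Γ)
    (hΓ : Continuous fun q : ℝ × ℝ => Γ q.1 q.2) (hβ : MemoryCondition Γ α β)
    (hβs : IsMinimalExponent Γ β βs) (heven : ∃ ℓ ∈ minimalMultipoles Γ β βs, Even ℓ)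
    (h : 3 * βs < min 1 (β 0)) :
    Tendsto (fun T : ℝ => variance (excursionStat P Z 0 T) P / T ^ (2 - 3 * βs)) atTop
      (𝓝 (4 / ((3 ! : ℝ) * (1 - 3 * βs) * (2 - 3 * βs)) *
        gauntSum Γ (minimalMultipoles Γ β βs))) ∧
    TendstoInMeasure P
      (fun (T : ℝ) (ω : Ω) => excursionStatNormalized P Z 0 T ω -
        (-(1 / √(variance (excursionStat P Z 0 T) P) / ((3 ! : ℝ) * √(2 * Real.pi))) *
          thirdHermiteIntegral Z T ω)) atTop (fun _ => 0) := by
  have hS := hZ.gauntSum_pos hΓ heven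
  obtain ⟨hA, hC⟩ := hZ.tendsto_kernels hΓ hβ hβs (Or.inl h)
  have h0 : 0 < 3 * βs := by linarith [hβs.pos hβ]
  have h1 : 3 * βs < 1 := (lt_min_iff.mp h).1
  have d1 : 0 < 1 - 3 * βs := by linarith
  have d2 : 0 < 2 - 3 * βs := by linarith
  have tA := tendsto_triangleIntegral_rpow (continuous_arcsinKernel hΓ) h0 h1 hA
  have tC := tendsto_triangleIntegral_rpow (continuous_cubeKernel hΓ) h0 h1 hC
  refine ⟨hZ.tendsto_variance_div hΓ tA ?_, hZ.tendstoInMeasure_remainder hΓ (by positivity) ?_ tA tC⟩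
  -- The factor `2` of the variance times the kernel limit `S/3` is `4 S / 3!`.
  · norm_num [Nat.factorial]
    field_simp
    ring
  · filter_upwards [eventually_gt_atTop 0] with T hT
    exact (Real.rpow_pos_of_pos hT _).ne'

/-- Variance asymptotics in the logarithmic regime, and the size of the remainder. -/
lemma IsSphereTimeField.log_regime (hZ : IsSphereTimeField P Z Γ)
    (hΓ : Continuous fun q : ℝ × ℝ => Γ q.1 q.2) (hβ : MemoryCondition Γ α β)
    (hβs : IsMinimalExponent Γ β βs) (heven : ∃ ℓ ∈ minimalMultipoles Γ β βs, Even ℓ)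
    (h0 : β 0 = 1) (h1 : 3 * βs = 1) :
    Tendsto (fun T : ℝ => variance (excursionStat P Z 0 T) P / (T * Real.log T)) atTop
      (𝓝 (4 / (3 ! : ℝ) * gauntSum Γ (minimalMultipoles Γ β βs))) ∧
    TendstoInMeasure P
      (fun (T : ℝ) (ω : Ω) => excursionStatNormalized P Z 0 T ω -
        (-(1 / √(variance (excursionStat P Z 0 T) P) / ((3 ! : ℝ) * √(2 * Real.pi))) *
          thirdHermiteIntegral Z T ω)) atTop (fun _ => 0) := by
  have hS := hZ.gauntSum_pos hΓ heven
  obtain ⟨hA, hC⟩ := hZ.tendsto_kernels hΓ hβ hβs (Or.inr ⟨h0, h1⟩)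
  simp only [h1, Real.rpow_one] at hA hC
  have tA := tendsto_triangleIntegral_log (continuous_arcsinKernel hΓ) hA
  have tC := tendsto_triangleIntegral_log (continuous_cubeKernel hΓ) hC
  refine ⟨hZ.tendsto_variance_div hΓ tA ?_, hZ.tendstoInMeasure_remainder hΓ (by positivity) ?_ tA tC⟩
  · norm_num [Nat.factorial]
    ring
  · filter_upwards [eventually_gt_atTop 1] with T hT
    exact (mul_pos (by linarith) (Real.log_pos hT)).ne'

end ContinuousCovariance

/-! ### Reduction to a globally continuous covariance function -/

section Clamp

variable {Ω : Type*} [MeasurableSpace Ω] {P : Measure Ω}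
  {Z : S2 × ℝ → Ω → ℝ} {Γ : ℝ → ℝ → ℝ} {α βs : ℝ} {β : ℕ → ℝ}

/-- `Γ` with its first argument clamped to `[-1,1]`. -/
def clampCovariance (Γ : ℝ → ℝ → ℝ) (θ τ : ℝ) : ℝ := Γ (max (-1) (min 1 θ)) τ

lemma clampCovariance_of_mem {θ : ℝ} (hθ : θ ∈ Set.Icc (-1 : ℝ) 1) (τ : ℝ) :
    clampCovariance Γ θ τ = Γ θ τ := by
  rw [clampCovariance, min_eq_right hθ.2, max_eq_right hθ.1]

/-- Clamping retracts the plane onto the strip `[-1,1] × ℝ`, where `Γ` is continuous. -/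
lemma IsSphereTimeField.continuous_clamp (hZ : IsSphereTimeField P Z Γ) :
    Continuous fun q : ℝ × ℝ => clampCovariance Γ q.1 q.2 := by
  refine hZ.continuous.comp_continuous (f := fun q : ℝ × ℝ => (max (-1) (min 1 q.1), q.2))
    (by fun_prop) fun q => ⟨⟨le_max_left _ _, ?_⟩, Set.mem_univ _⟩
  exact max_le (by norm_num) (min_le_left _ _)

lemma IsSphereTimeField.clamp (hZ : IsSphereTimeField P Z Γ) :
    IsSphereTimeField P Z (clampCovariance Γ) where
  measurable := hZ.measurable
  gaussian := hZ.gaussian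
  centred := hZ.centred
  covariance x y t s := by rw [hZ.covariance, clampCovariance_of_mem (inner_mem_Icc x y)]
  continuous := hZ.continuous_clamp.continuousOn
  unit_variance := hZ.unit_variance

lemma powerSpectrum_clamp (Γ : ℝ → ℝ → ℝ) :
    powerSpectrum (clampCovariance Γ) = powerSpectrum Γ := by
  ext ℓ τ
  unfold powerSpectrum
  congr 1
  exact intervalIntegral.integral_congr fun θ hθ => by
    simp only [clampCovariance_of_mem (uIcc_subset_Icc hθ)]

lemma multipoles_clamp (Γ : ℝ → ℝ → ℝ) : multipoles (clampCovariance Γ) = multipoles Γ := by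
  simp only [multipoles, powerSpectrum_clamp]

lemma minimalMultipoles_clamp (Γ : ℝ → ℝ → ℝ) (β : ℕ → ℝ) (βs : ℝ) :
    minimalMultipoles (clampCovariance Γ) β βs = minimalMultipoles Γ β βs := by
  simp only [minimalMultipoles, multipoles_clamp]

lemma gauntTerm_clamp (Γ : ℝ → ℝ → ℝ) : gauntTerm (clampCovariance Γ) = gauntTerm Γ := by
  ext ℓ
  simp only [gauntTerm, powerSpectrum_clamp]

lemma gauntSum_clamp (Γ : ℝ → ℝ → ℝ) : gauntSum (clampCovariance Γ) = gauntSum Γ := by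
  ext I
  simp only [gauntSum, gauntTerm_clamp]

lemma MemoryCondition.clamp (hβ : MemoryCondition Γ α β) :
    MemoryCondition (clampCovariance Γ) α β where
  two_le := hβ.two_le
  mem_Ioc := by simpa only [multipoles_clamp] using hβ.mem_Ioc
  factor := by simpa only [multipoles_clamp, powerSpectrum_clamp] using hβ.factor
  zero_mem := by simpa only [multipoles_clamp] using hβ.zero_mem
  integral_pos := by simpa only [powerSpectrum_clamp] using hβ.integral_pos

lemma IsMinimalExponent.clamp (hβs : IsMinimalExponent Γ β βs) :
    IsMinimalExponent (clampCovariance Γ) β βs where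
  isLeast := by simpa only [multipoles_clamp] using hβs.isLeast
  second := by simpa only [multipoles_clamp, minimalMultipoles_clamp] using hβs.second

end Clamp

end SphereTime

end

theorem theorem3 {Ω : Type*} [MeasurableSpace Ω] (P : Measure Ω) [IsProbabilityMeasure P]
    (Z : SphereTime.S2 × ℝ → Ω → ℝ) (Γ : ℝ → ℝ → ℝ) (hZ : SphereTime.IsSphereTimeField P Z Γ)
    (α : ℝ) (β : ℕ → ℝ) (hβ : SphereTime.MemoryCondition Γ α β)
    (βs : ℝ) (hβs : SphereTime.IsMinimalExponent Γ β βs)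
    (heven : ∃ ℓ ∈ SphereTime.minimalMultipoles Γ β βs, Even ℓ) :
    -- the series over triples of minimal multipoles converges absolutely, and its sum is positive
    (Summable fun ℓ : Fin 3 → SphereTime.minimalMultipoles Γ β βs =>
      SphereTime.gauntTerm Γ (fun i => ℓ i)) ∧
    0 < SphereTime.gauntSum Γ (SphereTime.minimalMultipoles Γ β βs) ∧
    -- the variance when `3 βs < min 1 β₀`
    (3 * βs < min 1 (β 0) →
      Tendsto (fun T : ℝ =>
          variance (SphereTime.excursionStat P Z 0 T) P / T ^ (2 - 3 * βs)) atTop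
        (𝓝 (4 / ((3 ! : ℝ) * (1 - 3 * βs) * (2 - 3 * βs)) *
          SphereTime.gauntSum Γ (SphereTime.minimalMultipoles Γ β βs)))) ∧
    -- the variance when `β₀ = 1` and `3 βs = 1`
    (β 0 = 1 → 3 * βs = 1 →
      Tendsto (fun T : ℝ =>
          variance (SphereTime.excursionStat P Z 0 T) P / (T * Real.log T)) atTop
        (𝓝 (4 / (3 ! : ℝ) * SphereTime.gauntSum Γ (SphereTime.minimalMultipoles Γ β βs)))) ∧
    -- in both regimes the third chaotic component dominates
    ((3 * βs < min 1 (β 0) ∨ (β 0 = 1 ∧ 3 * βs = 1)) →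
      TendstoInMeasure P
        (fun (T : ℝ) (ω : Ω) =>
          SphereTime.excursionStatNormalized P Z 0 T ω -
            (-(1 / √(variance (SphereTime.excursionStat P Z 0 T) P) /
                ((3 ! : ℝ) * √(2 * Real.pi))) * SphereTime.thirdHermiteIntegral Z T ω))
        atTop (fun _ => 0)) := by
  have hΓ := hZ.continuous_clamp
  have hZc := hZ.clamp
  have hI := SphereTime.minimalMultipoles_clamp Γ β βs
  have heven' : ∃ ℓ ∈ SphereTime.minimalMultipoles (SphereTime.clampCovariance Γ) β βs, Even ℓ := by
    rwa [hI]
  -- The spectral quantities depend on `Γ` only through its values on `[-1,1] × ℝ`, and the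
  -- statistics not at all, so the result for the clamped covariance is the one sought.
  rw [← SphereTime.gauntSum_clamp, ← SphereTime.gauntTerm_clamp, ← hI]
  refine ⟨hZc.summable_gauntTerm hΓ _, hZc.gauntSum_pos hΓ heven',
    fun h => (hZc.power_regime hΓ hβ.clamp hβs.clamp heven' h).1,
    fun h0 h1 => (hZc.log_regime hΓ hβ.clamp hβs.clamp heven' h0 h1).1, ?_⟩
  rintro (h | ⟨h0, h1⟩)
  · exact (hZc.power_regime hΓ hβ.clamp hβs.clamp heven' h).2
  · exact (hZc.log_regime hΓ hβ.clamp hβs.clamp heven' h0 h1).2
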